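/- Let $\lambda>0$. There is a constant $c$, depending only on $\lambda$, with the following property. Let $d\ge 1$, $0<T<\infty$, and let $\mathscr A=C^{1,2}_b((0,T)\times\mathbb R^d)$ be the space of bounded continuous functions $f(t,x)$ on $(0,T)\times\mathbb R^d$ with bounded continuous derivatives $\partial_t f,\nabla f,\nabla^2 f$ ($\nabla$ acts on $x$ only), and $\mathscr A_c$ the subspace of those with compact support in $(0,T)\times\mathbb R^d$. Write $L^2_tL^2_x=L^2((0,T)\times\mathbb R^d)$. Let $a=(a^{i,j})$ be a measurable field of symmetric $d\times d$ matrices on $(0,T)\times\mathbb R^d$ that is bounded and elliptic with constant $\lambda$, i.e. $a\in L^\infty_tL^\infty_x$ and $a(v,v)\ge\lambda|v|^2$ for every $v\in\mathbb R^d$, a.e. in $(0,T)\times\mathbb R^d$, and assume that the distributional derivative $\partial_t a$ belongs to $L^\infty_tL^\infty_x$ (matrices are normed by $|A|^2=\sum_{i,j}(A^{i,j})^2$). Then there is exactly one strongly continuous semigroup $({\sf P}^\alpha_a)_{\alpha\ge0}$ of bounded operators on $L^2_tL^2_x$ that is associated with the Dirichlet form $f\mapsto\int a(\nabla f,\nabla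 f)\,d\mathscr L^{1+d}$ on $L^2_t(W^{1,2}_x)$, i.e. whose generator is the operator $\Delta_a f=\operatorname{div}(a\nabla f)$ given by: $f\in D(\Delta_a)$ and $\Delta_af=h$ if and only if $f\in L^2_t(W^{1,2}_x)$, $h\in L^2_tL^2_x$ and $\int a(\nabla f,\nabla g)\,d\mathscr L^{1+d}=-\int hg\,d\mathscr L^{1+d}$ for all $g\in L^2_t(W^{1,2}_x)$. Moreover: (i) for every $\alpha\in(0,1)$, $u\in\mathscr A_c$ and $f\in\mathscr A\cap L^2_tL^2_x$, the function $({\sf P}^\alpha_au)\,\partial_tf+(\partial_tu)\,{\sf P}^\alpha_af$ is integrable on $(0,T)\times\mathbb R^d$, and the weak commutator $$\int u\,[{\sf P}^\alpha_a,\partial_t]f\,d\mathscr L^{1+d}:=\int_{(0,T)\times\mathbb R^d}\big[({\sf P}^\alpha_au)\,\partial_tf+(\partial_tu)\,{\sf P}^\alpha_af\big]\,d\mathscr L^{1+d}$$ satisfies $$\Big|\int u\,[{\sf P}^\alpha_a,\partial_t]f\,d\mathscr L^{1+d}\Big|\le c\,\|\partial_ta\|_{L^\infty_tL^\infty_x}\,\|u\|_{L^2_tL^2_x}\,\|f\|_{L^2_tL^2_x};$$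 (ii) for every $\alpha\ge0$, ${\sf P}^\alpha_a$ maps $W^{1,2}_t(L^2_x)$ into itself, where $W^{1,2}_t(L^2_x)$ is the space of $f\in L^2_tL^2_x$ whose distributional derivative $\partial_tf$ on $(0,T)\times\mathbb R^d$ belongs to $L^2_tL^2_x$. -/

import Mathlib

open MeasureTheory Set Filter Topology
open scoped NNReal ENNReal

noncomputable section

namespace TimeCommutator

/-- Points `(t, x)` of `ℝ × ℝ^d`; `ℝ^d` carries the Euclidean norm. -/
abbrev SpaceTime (d : ℕ) : Type := ℝ × EuclideanSpace ℝ (Fin d)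

/-- The open slab `(0,T) × ℝ^d`. -/
def slab (d : ℕ) (T : ℝ) : Set (SpaceTime d) := Ioo 0 T ×ˢ univ

/-- Lebesgue measure on the slab `(0,T) × ℝ^d`. -/
def slabMeasure (d : ℕ) (T : ℝ) : Measure (SpaceTime d) := volume.restrict (slab d T)

/-- `L²_t L²_x = L²((0,T) × ℝ^d)`, real valued. -/
abbrev L2 (d : ℕ) (T : ℝ) := Lp ℝ 2 (slabMeasure d T)

/-- `L²_t L²_x` for vector fields with values in `ℝ^d`. -/
abbrev L2Vec (d : ℕ) (T : ℝ) := Lp (EuclideanSpace ℝ (Fin d)) 2 (slabMeasure d T)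

/-- Classical partial derivative `∂_t f`. -/
def timeDeriv {d : ℕ} (f : SpaceTime d → ℝ) (p : SpaceTime d) : ℝ :=
  deriv (fun t => f (t, p.2)) p.1

/-- Classical derivative of `f` in the variable `x`. -/
def spaceFDeriv {d : ℕ} (f : SpaceTime d → ℝ) (p : SpaceTime d) :
    EuclideanSpace ℝ (Fin d) →L[ℝ] ℝ :=
  fderiv ℝ (fun x => f (p.1, x)) p.2

/-- Classical second derivative of `f` in the variable `x`. -/
def spaceFDeriv2 {d : ℕ} (f : SpaceTime d → ℝ) (p : SpaceTime d) :
    EuclideanSpace ℝ (Fin d) →L[ℝ] (EuclideanSpace ℝ (Fin d) →L[ℝ] ℝ) :=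
  fderiv ℝ (fun x => spaceFDeriv f (p.1, x)) p.2

/-- Classical partial derivative `∂_i f`. -/
def spaceDeriv {d : ℕ} (i : Fin d) (f : SpaceTime d → ℝ) (p : SpaceTime d) : ℝ :=
  spaceFDeriv f p (EuclideanSpace.single i 1)

/-- `𝒜 = C^{1,2}_b((0,T) × ℝ^d)`: bounded and continuous, with bounded and (jointly) continuous
derivatives `∂_t f`, `∇f`, `∇²f`. Only the values of `f` on the slab matter. -/
structure IsTest {d : ℕ} (T : ℝ) (f : SpaceTime d → ℝ) : Prop where
  cont : ContinuousOn f (slab d T)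
  diff_time : ∀ p ∈ slab d T, DifferentiableAt ℝ (fun t => f (t, p.2)) p.1
  cont_time : ContinuousOn (timeDeriv f) (slab d T)
  diff_space : ∀ p ∈ slab d T, DifferentiableAt ℝ (fun x => f (p.1, x)) p.2
  cont_space : ContinuousOn (spaceFDeriv f) (slab d T)
  diff_space2 : ∀ p ∈ slab d T, DifferentiableAt ℝ (fun x => spaceFDeriv f (p.1, x)) p.2
  cont_space2 : ContinuousOn (spaceFDeriv2 f) (slab d T)
  bounded : ∃ C : ℝ, ∀ p ∈ slab d T,
    |f p| ≤ C ∧ |timeDeriv f p| ≤ C ∧ ‖spaceFDeriv f p‖ ≤ C ∧ ‖spaceFDeriv2 f p‖ ≤ C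

/-- `𝒜_c = C^{1,2}_c((0,T) × ℝ^d)`: members of `𝒜` with compact support in the open slab. -/
structure IsTestC {d : ℕ} (T : ℝ) (f : SpaceTime d → ℝ) : Prop extends IsTest T f where
  compact_supp : ∃ K : Set (SpaceTime d), IsCompact K ∧ K ⊆ slab d T ∧
    ∀ p ∈ slab d T, p ∉ K → f p = 0

theorem measurableSet_slab (d : ℕ) (T : ℝ) : MeasurableSet (slab d T) :=
  measurableSet_Ioo.prod MeasurableSet.univ

theorem IsTestC.memLp {d : ℕ} {T : ℝ} {u : SpaceTime d → ℝ} (hu : IsTestC T u) :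
    MemLp u 2 (slabMeasure d T) := by
  obtain ⟨C, hC⟩ := hu.bounded
  obtain ⟨K, hK, -, hK0⟩ := hu.compact_supp
  have hmeas : AEStronglyMeasurable u (slabMeasure d T) :=
    hu.cont.aestronglyMeasurable (measurableSet_slab d T)
  have hfin : slabMeasure d T K ≠ ∞ :=
    ((Measure.restrict_apply_le _ _).trans_lt hK.measure_lt_top).ne
  have hind : MemLp (K.indicator fun _ => C) 2 (slabMeasure d T) :=
    memLp_indicator_const 2 hK.measurableSet C (Or.inr hfin)
  refine hind.mono hmeas ?_
  filter_upwards [ae_restrict_mem (measurableSet_slab d T)] with p hp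
  by_cases hpK : p ∈ K
  · rw [indicator_of_mem hpK, Real.norm_eq_abs, Real.norm_eq_abs]
    exact (hC p hp).1.trans (le_abs_self C)
  · rw [hK0 p hp hpK]
    simp

/-- `g = ∂_t u` in the sense of distributions on `(0,T) × ℝ^d`. -/
def IsWeakTimeDeriv {d : ℕ} (T : ℝ) (u g : SpaceTime d → ℝ) : Prop :=
  ∀ φ : SpaceTime d → ℝ, IsTestC T φ →
    ∫ p, timeDeriv φ p * u p ∂(slabMeasure d T) = - ∫ p, φ p * g p ∂(slabMeasure d T)

/-- `f ∈ W^{1,2}_t(L²_x)`: the distributional derivative `∂_t f` lies in `L²_t L²_x`. -/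
def MemW12t {d : ℕ} {T : ℝ} (f : L2 d T) : Prop :=
  ∃ g : L2 d T, IsWeakTimeDeriv T f g

/-- `f ∈ L²_t(W^{1,2}_x)` with distributional gradient `∇f = F` in the variable `x`. -/
def IsWeakGrad {d : ℕ} {T : ℝ} (f : L2 d T) (F : L2Vec d T) : Prop :=
  ∀ φ : SpaceTime d → ℝ, IsTestC T φ → ∀ i : Fin d,
    ∫ p, spaceDeriv i φ p * f p ∂(slabMeasure d T) = - ∫ p, φ p * F p i ∂(slabMeasure d T)

/-- The bilinear form `A(v,w) = ∑ A^{ij} v^i w^j`. -/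
def matForm {d : ℕ} (A : Matrix (Fin d) (Fin d) ℝ) (v w : EuclideanSpace ℝ (Fin d)) : ℝ :=
  ∑ i, ∑ j, A i j * v i * w j

/-- The norm `|A| = (∑ (A^{ij})²)^{1/2}`. -/
def matNorm {d : ℕ} (A : Matrix (Fin d) (Fin d) ℝ) : ℝ :=
  Real.sqrt (∑ i, ∑ j, A i j ^ 2)

/-- `‖B‖_{L^∞_t L^∞_x}` of a matrix field on the slab. -/
def linfNorm {d : ℕ} (T : ℝ) (B : SpaceTime d → Matrix (Fin d) (Fin d) ℝ) : ℝ≥0∞ :=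
  eLpNorm (fun p => matNorm (B p)) ∞ (slabMeasure d T)

/-- `a` is a measurable, symmetric, essentially bounded matrix field on `(0,T) × ℝ^d`, elliptic
with constant `lam`. -/
structure IsBoundedElliptic {d : ℕ} (T lam : ℝ)
    (a : SpaceTime d → Matrix (Fin d) (Fin d) ℝ) : Prop where
  meas : ∀ i j, AEStronglyMeasurable (fun p => a p i j) (slabMeasure d T)
  symm : ∀ᵐ p ∂(slabMeasure d T), (a p).IsSymm
  bounded : linfNorm T a < ∞
  elliptic : ∀ᵐ p ∂(slabMeasure d T), ∀ v : EuclideanSpace ℝ (Fin d),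
    lam * ‖v‖ ^ 2 ≤ matForm (a p) v v

/-- `B = ∂_t a` in the sense of distributions, entry by entry, with `B ∈ L^∞_t L^∞_x`. -/
structure IsBoundedTimeDeriv {d : ℕ} (T : ℝ)
    (a B : SpaceTime d → Matrix (Fin d) (Fin d) ℝ) : Prop where
  meas : ∀ i j, AEStronglyMeasurable (fun p => B p i j) (slabMeasure d T)
  bounded : linfNorm T B < ∞
  deriv : ∀ i j, IsWeakTimeDeriv T (fun p => a p i j) (fun p => B p i j)

/-- The graph of the self-adjoint operator `Δ_a = div(a∇)` of the form
`f ↦ ∫ a(∇f,∇f)` with domain `L²_t(W^{1,2}_x)`: `f ∈ D(Δ_a)` and `Δ_a f = h` means that `f` lies in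
the form domain and `∫ a(∇f,∇g) = - ∫ h g` for every `g` in the form domain. -/
def IsDivFormOp {d : ℕ} {T : ℝ} (a : SpaceTime d → Matrix (Fin d) (Fin d) ℝ)
    (f h : L2 d T) : Prop :=
  ∃ F : L2Vec d T, IsWeakGrad f F ∧ ∀ (g : L2 d T) (G : L2Vec d T), IsWeakGrad g G →
    ∫ p, matForm (a p) (F p) (G p) ∂(slabMeasure d T) = - ∫ p, h p * g p ∂(slabMeasure d T)

/-- `P` is the semigroup on `L²((0,T) × ℝ^d)` associated with the form `f ↦ ∫ a(∇f,∇f)` on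
`L²_t(W^{1,2}_x)`: the strongly continuous semigroup whose infinitesimal generator (with its exact
domain) is the operator `Δ_a` of the form. -/
structure IsFormSemigroup {d : ℕ} {T : ℝ} (a : SpaceTime d → Matrix (Fin d) (Fin d) ℝ)
    (P : ℝ≥0 → (L2 d T →L[ℝ] L2 d T)) : Prop where
  map_zero : P 0 = ContinuousLinearMap.id ℝ (L2 d T)
  map_add : ∀ s r : ℝ≥0, P (s + r) = (P s).comp (P r)
  cont : ∀ f : L2 d T, Continuous fun s => P s f
  generator : ∀ f h : L2 d T,
    Tendsto (fun s : ℝ≥0 => (s : ℝ)⁻¹ • (P s f - f)) (𝓝[>] 0) (𝓝 h) ↔ IsDivFormOp a f h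

/-- The integrand `(P^α u) ∂_t f + (∂_t u) P^α f` whose integral over the slab defines
`∫ u [P^α, ∂_t] f`; here `Pu` and `Pf` stand for `P^α u` and `P^α f`. -/
def commIntegrand {d : ℕ} {T : ℝ} (u f : SpaceTime d → ℝ) (Pu Pf : L2 d T) (p : SpaceTime d) : ℝ :=
  Pu p * timeDeriv f p + timeDeriv u p * Pf p

end TimeCommutator

end

open TimeCommutator

/-! The estimate is proved with time translations in place of `∂_t` and with resolvents in place of
the semigroup, with constants that survive both limits.

Let `J τ` be the resolvent `(1 - τ Δ_a)⁻¹`, let `N τ` be its spatial gradient, and let `shift r` be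
the translation `t ↦ t + r` of the extension by zero. Translation commutes with the weak spatial
gradient (`IsWeakGrad.shift`), and its adjoint is `shift (-r)`. Test the equation of `J τ φ` with
`shift (-r) (J τ g)` and that of `J τ g` with `shift r (J τ φ)`: all that remains is `a(t + r) -
a(t)`, which is at most `r ‖∂_t a‖_∞`. So the commutator of `J τ` with the translation is at most `τ
r ‖∂_t a‖_∞ ‖N τ φ‖ ‖N τ g‖` (`IsFormResolvent.abs_commutator_le`). For a power `J τ ^ n` the
commutator telescopes. The energy estimate gives `τ λ ∑ ‖N τ (J τ ^ k g)‖² ≤ ‖g‖² / 2`, and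
Cauchy–Schwarz then yields `r ‖∂_t a‖_∞ ‖φ‖ ‖g‖ / (2λ)`, uniformly in `n` and `τ`
(`IsFormResolvent.abs_commutator_pow_le`). The Yosida exponentials are Poisson averages of powers of
`J τ`, so they inherit this bound, and so does their strong limit, the semigroup
(`IsResolventFamily.norm_apply_semigroup_le`).

Dividing by `r` and letting `r → 0` gives (i) with `c = 1/(2λ)`. In this limit `∂_t f` is merely
bounded, so `P^α u` has to be integrable: this follows from an energy estimate with the weight `(1 +
|x|²)^d` (`IsSemigroupOf.integrable_apply`). It also has to vanish near `t = 0` and `t = T`, where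
the zero extension may jump. It does, because `Δ_a` contains no time derivative and the semigroup
therefore commutes with multiplication by functions of `t` (`HasTimeMargin.semigroup`).

For (ii), the same commutator bound and the `O(r)` increments of `f` bound the difference quotients
of `P^α f` tested against `L²` functions that vanish near the ends of the time interval. Riesz
representation then produces the weak derivative.

Existence of the semigroup is the Hille–Yosida construction, with resolvents from Lax–Milgram;
uniqueness is Gronwall's inequality for the difference of two orbits. -/

noncomputable section

namespace TimeCommutator

/-! ### Hille–Yosida theory for dissipative operators on a Hilbert space. -/

section Semigroup

open scoped InnerProductSpace

variable {H : Type*} [NormedAddCommGroup H] [InnerProductSpace ℝ H]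

/-- `G` is the graph of a single-valued dissipative operator `A` on a Hilbert space and
`J τ = (1 - τ A)⁻¹` are its resolvents. -/
structure IsResolventFamily (G : Submodule ℝ (H × H)) (J : ℝ → H →L[ℝ] H) : Prop where
  dissip : ∀ f h, (f, h) ∈ G → ⟪h, f⟫_ℝ ≤ 0
  single : ∀ h, ((0 : H), h) ∈ G → h = 0
  mem : ∀ τ, 0 < τ → ∀ g, (J τ g, τ⁻¹ • (J τ g - g)) ∈ G

/-- The easy half of Banach–Steinhaus. It reduces each strong convergence below to vectors in the
domain of the generator, where explicit rates are available. -/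
theorem tendsto_zero_of_dense {ι : Type*} {l : Filter ι} {M : ι → H →L[ℝ] H} {C : ℝ}
    (hM : ∀ i, ‖M i‖ ≤ C) {D : Set H} (hD : Dense D)
    (h : ∀ x ∈ D, Tendsto (fun i => M i x) l (𝓝 0)) (x : H) :
    Tendsto (fun i => M i x) l (𝓝 0) := by
  have hC : 0 ≤ |C| := abs_nonneg C
  rw [Metric.tendsto_nhds]
  intro ε hε
  obtain ⟨y, hy, hxy⟩ := Metric.mem_closure_iff.1 (hD x) (ε / (2 * (|C| + 1))) (by positivity)
  filter_upwards [Metric.tendsto_nhds.1 (h y hy) (ε / 2) (by positivity)] with i hi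
  rw [dist_zero_right] at hi ⊢
  rw [dist_eq_norm, lt_div_iff₀ (by positivity)] at hxy
  have h1 : ‖M i (x - y)‖ ≤ |C| * ‖x - y‖ :=
    (M i).le_of_opNorm_le ((hM i).trans (le_abs_self C)) _
  have h2 : M i x = M i (x - y) + M i y := by simp
  rw [h2]
  refine (norm_add_le _ _).trans_lt ?_
  nlinarith [norm_nonneg (x - y)]

section Exp

variable [CompleteSpace H]

/-- Since `exp (c (J - 1)) = e^{-c} ∑ c^k / k! J^k` is an average of the powers of `J` with Poisson
weights of total mass one, any bound that is linear in the operator and uniform over the powers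
passes to the exponential with the same constant. This is used for contractivity and for the
commutator estimate alike. -/
theorem norm_apply_exp_le_of_pow {F : Type*} [NormedAddCommGroup F] [NormedSpace ℝ F]
    (J : H →L[ℝ] H) (ℓ : (H →L[ℝ] H) →L[ℝ] F) {K : ℝ} (hK : ∀ k : ℕ, ‖ℓ (J ^ k)‖ ≤ K)
    {c : ℝ} (hc : 0 ≤ c) : ‖ℓ (NormedSpace.exp (c • (J - 1)))‖ ≤ K := by
  have h1 : NormedSpace.exp (c • (J - 1)) = Real.exp (-c) • NormedSpace.exp (c • J) := by
    have e : c • (J - 1) = c • J + algebraMap ℝ (H →L[ℝ] H) (-c) := by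
      rw [Algebra.algebraMap_eq_smul_one, smul_sub, neg_smul, sub_eq_add_neg]
    let _ : NormedAlgebra ℚ (H →L[ℝ] H) := NormedAlgebra.restrictScalars ℚ ℝ _
    rw [e, NormedSpace.exp_add_of_commute (Algebra.commutes (-c) (c • J)).symm]
    rw [← NormedSpace.algebraMap_exp_comm, ← Real.exp_eq_exp_ℝ, ← Algebra.commutes,
      Algebra.algebraMap_eq_smul_one, smul_mul_assoc, one_mul]
  have h2 : HasSum (fun k : ℕ => ((k.factorial : ℝ)⁻¹ * c ^ k) • ℓ (J ^ k))
      (ℓ (NormedSpace.exp (c • J))) := by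
    have := (NormedSpace.exp_series_hasSum_exp' (𝕂 := ℝ) (c • J)).mapL ℓ
    simpa [smul_pow, smul_smul] using this
  have h3 : HasSum (fun k : ℕ => ((k.factorial : ℝ)⁻¹ * c ^ k) * K) (Real.exp c * K) := by
    have := (NormedSpace.exp_series_hasSum_exp' (𝕂 := ℝ) c).mul_right K
    rw [← Real.exp_eq_exp_ℝ] at this
    simpa using this
  have h4 : ‖ℓ (NormedSpace.exp (c • J))‖ ≤ Real.exp c * K := by
    rw [← h2.tsum_eq]
    refine tsum_of_norm_bounded h3 fun k => ?_
    rw [norm_smul, Real.norm_of_nonneg (by positivity)]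
    exact mul_le_mul_of_nonneg_left (hK k) (by positivity)
  rw [h1, map_smul, norm_smul, Real.norm_of_nonneg (Real.exp_pos _).le]
  calc Real.exp (-c) * ‖ℓ (NormedSpace.exp (c • J))‖ ≤ Real.exp (-c) * (Real.exp c * K) :=
        mul_le_mul_of_nonneg_left h4 (Real.exp_pos _).le
    _ = K := by rw [← mul_assoc, ← Real.exp_add]; simp

theorem norm_exp_le_one_of_contraction {J : H →L[ℝ] H} (hJ : ‖J‖ ≤ 1) {c : ℝ} (hc : 0 ≤ c) :
    ‖NormedSpace.exp (c • (J - 1))‖ ≤ 1 := by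
  refine norm_apply_exp_le_of_pow J (ContinuousLinearMap.id ℝ _) (fun k => ?_) hc
  rcases subsingleton_or_nontrivial H with h | h
  · have : J ^ k = 0 := Subsingleton.elim _ _
    simp [this]
  · exact (norm_pow_le J k).trans (pow_le_one₀ (norm_nonneg _) hJ)

theorem hasDerivAt_exp_smul_apply (A : H →L[ℝ] H) (x : H) (r : ℝ) :
    HasDerivAt (fun r : ℝ => NormedSpace.exp (r • A) x) (NormedSpace.exp (r • A) (A x)) r := by
  have := (hasDerivAt_exp_smul_const (𝕂 := ℝ) A r).clm_apply (hasDerivAt_const r x)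
  simpa using this

theorem norm_exp_sub_exp_le {A B : H →L[ℝ] H} (hAB : Commute A B)
    (hA : ∀ s : ℝ, 0 ≤ s → ‖NormedSpace.exp (s • A)‖ ≤ 1)
    (hB : ∀ s : ℝ, 0 ≤ s → ‖NormedSpace.exp (s • B)‖ ≤ 1) {s : ℝ} (hs : 0 ≤ s) (x : H) :
    ‖NormedSpace.exp (s • A) x - NormedSpace.exp (s • B) x‖ ≤ s * ‖A x - B x‖ := by
  -- Interpolate along `r ↦ e^{rA} e^{(s-r)B} x`. By commutativity the derivative is `e^{rA}
  -- e^{(s-r)B} (A x - B x)`, of norm at most `‖A x - B x‖`.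
  have hd : ∀ r ∈ Icc (0 : ℝ) s, HasDerivWithinAt
      (fun r : ℝ => (NormedSpace.exp (r • A) * NormedSpace.exp ((s - r) • B)) x)
      ((NormedSpace.exp (r • A) * NormedSpace.exp ((s - r) • B)) (A x - B x)) (Icc 0 s) r := by
    intro r _
    have h1 := hasDerivAt_exp_smul_const (𝕂 := ℝ) A r
    have h2 := (hasDerivAt_exp_smul_const (𝕂 := ℝ) B (s - r)).scomp r
      ((hasDerivAt_id r).const_sub s)
    have h3 := ((h1.mul h2).clm_apply (hasDerivAt_const r x)).hasDerivWithinAt (s := Icc 0 s)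
    have hc : Commute A (NormedSpace.exp ((s - r) • B)) :=
      (hAB.smul_right (s - r)).exp_right
    have hc' : A (NormedSpace.exp ((s - r) • B) x) = NormedSpace.exp ((s - r) • B) (A x) := by
      simpa using DFunLike.congr_fun hc.eq x
    refine h3.congr_deriv ?_
    simp [hc', ← sub_eq_add_neg]
  have := norm_image_sub_le_of_norm_deriv_le_segment' hd (C := ‖A x - B x‖) ?_ s
    (right_mem_Icc.2 hs)
  · simpa [mul_comm] using this
  · intro r hr
    refine (ContinuousLinearMap.le_opNorm _ _).trans ?_
    refine mul_le_of_le_one_left (norm_nonneg _) ((norm_mul_le _ _).trans ?_)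
    exact mul_le_one₀ (hA r hr.1) (norm_nonneg _) (hB _ (by linarith [hr.2]))

theorem norm_exp_apply_sub_le {A : H →L[ℝ] H}
    (hA : ∀ s : ℝ, 0 ≤ s → ‖NormedSpace.exp (s • A)‖ ≤ 1) {s : ℝ} (hs : 0 ≤ s) (x : H) :
    ‖NormedSpace.exp (s • A) x - x‖ ≤ s * ‖A x‖ := by
  have := norm_image_sub_le_of_norm_deriv_le_segment' (f := fun r : ℝ => NormedSpace.exp (r • A) x)
    (a := 0) (b := s) (C := ‖A x‖)
    (fun r _ => (hasDerivAt_exp_smul_apply A x r).hasDerivWithinAt) (fun r hr => ?_) s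
    (right_mem_Icc.2 hs)
  · simpa [mul_comm] using this
  · exact ((NormedSpace.exp (r • A)).le_of_opNorm_le (hA r hr.1) _).trans (by simp)

theorem norm_exp_apply_sub_sub_le {A : H →L[ℝ] H}
    (hA : ∀ s : ℝ, 0 ≤ s → ‖NormedSpace.exp (s • A)‖ ≤ 1) {s : ℝ} (hs : 0 ≤ s) (x : H) :
    ‖NormedSpace.exp (s • A) x - x - s • A x‖ ≤ s * (s * ‖A (A x)‖) := by
  have := norm_image_sub_le_of_norm_deriv_le_segment'
    (f := fun r : ℝ => NormedSpace.exp (r • A) x - r • A x)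
    (f' := fun r : ℝ => NormedSpace.exp (r • A) (A x) - A x)
    (a := 0) (b := s) (C := s * ‖A (A x)‖)
    (fun r _ => ?_) (fun r hr => ?_) s (right_mem_Icc.2 hs)
  · rw [mul_comm]
    convert this using 2
    · simp; abel
    · simp
  · have := ((hasDerivAt_exp_smul_apply A x r).sub ((hasDerivAt_id r).smul_const (A x)))
    simpa using! this.hasDerivWithinAt
  · exact (norm_exp_apply_sub_le hA hr.1 _).trans
      (mul_le_mul_of_nonneg_right hr.2.le (norm_nonneg _))

end Exp

namespace IsResolventFamily

variable {G : Submodule ℝ (H × H)} {J : ℝ → H →L[ℝ] H} (hG : IsResolventFamily G J)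
  {τ σ : ℝ} {f h g : H}
include hG

/-- Two elements of the graph solve the same resolvent equation. Their difference has the form `(k,
τ⁻¹ k)`, and dissipativity forces `k = 0`. -/
theorem apply_eq (hτ : 0 < τ) (hf : (f, h) ∈ G) : J τ (f - τ • h) = f := by
  have h1 := G.sub_mem (hG.mem τ hτ (f - τ • h)) hf
  set k := J τ (f - τ • h) - f with hk
  have h2 : ((J τ (f - τ • h), τ⁻¹ • (J τ (f - τ • h) - (f - τ • h))) - (f, h) : H × H)
      = (k, τ⁻¹ • k) := by
    ext
    · simp [hk]
    · simp only [Prod.snd_sub, hk]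
      rw [sub_sub_eq_add_sub, add_sub_right_comm, smul_add, inv_smul_smul₀ hτ.ne',
        add_sub_cancel_right]
  rw [h2] at h1
  have h3 := hG.dissip _ _ h1
  rw [real_inner_smul_left, real_inner_self_eq_norm_sq] at h3
  have h4 : ‖k‖ ^ 2 ≤ 0 := nonpos_of_mul_nonpos_right h3 (inv_pos.2 hτ)
  have h5 : k = 0 := by simpa using le_antisymm h4 (sq_nonneg _)
  exact sub_eq_zero.1 (hk ▸ h5)

theorem apply_sub (hτ : 0 < τ) (hf : (f, h) ∈ G) : J τ f - f = τ • J τ h := by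
  have := hG.apply_eq hτ hf
  rw [map_sub, map_smul] at this
  nth_rw 2 [← this]
  abel

theorem apply_mem (hτ : 0 < τ) (hf : (f, h) ∈ G) : (J τ f, J τ h) ∈ G := by
  have h1 := hG.mem τ hτ f
  rwa [hG.apply_sub hτ hf, inv_smul_smul₀ hτ.ne'] at h1

/-- `J τ` preserves the graph, so applying it to the equation that defines `J σ g` produces the
equation that defines `J σ (J τ g)`. -/
theorem apply_comm (hτ : 0 < τ) (hσ : 0 < σ) (g : H) : J τ (J σ g) = J σ (J τ g) := by
  have h1 := hG.apply_eq hσ (hG.apply_mem hτ (hG.mem σ hσ g))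
  rw [map_smul, smul_inv_smul₀ hσ.ne', map_sub (J τ), sub_sub_cancel] at h1
  exact h1.symm

theorem norm_sq_le (hτ : 0 < τ) (g : H) : ‖J τ g‖ ^ 2 ≤ ⟪g, J τ g⟫_ℝ := by
  have h1 := hG.dissip _ _ (hG.mem τ hτ g)
  rw [real_inner_smul_left] at h1
  have h2 := nonpos_of_mul_nonpos_right h1 (inv_pos.2 hτ)
  rw [inner_sub_left, real_inner_self_eq_norm_sq] at h2
  linarith

theorem norm_apply_le (hτ : 0 < τ) (g : H) : ‖J τ g‖ ≤ ‖g‖ := by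
  have h1 := (hG.norm_sq_le hτ g).trans (real_inner_le_norm _ _)
  by_contra! h2
  nlinarith [norm_nonneg g]

theorem norm_le_one (hτ : 0 < τ) : ‖J τ‖ ≤ 1 :=
  ContinuousLinearMap.opNorm_le_bound _ zero_le_one fun g => by
    simpa using hG.norm_apply_le hτ g

variable [CompleteSpace H]

/-- If `k` is orthogonal to the domain, then `⟪k, J 1 k⟫ = 0`, hence `J 1 k = 0` by `norm_sq_le`.
Then `(0, -k)` lies in the graph, and single-valuedness gives `k = 0`. -/
theorem dense_domain : Dense {f : H | ∃ h, (f, h) ∈ G} := by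
  have h1 : {f : H | ∃ h, (f, h) ∈ G} = (G.map (LinearMap.fst ℝ H H) : Set H) := by
    ext f
    simp
  rw [h1, Submodule.dense_iff_topologicalClosure_eq_top,
    Submodule.topologicalClosure_eq_top_iff, Submodule.eq_bot_iff]
  intro k hk
  rw [Submodule.mem_orthogonal] at hk
  have h2 : ⟪J 1 k, k⟫_ℝ = 0 := hk _ ⟨_, hG.mem 1 one_pos k, rfl⟩
  have h3 := hG.norm_sq_le one_pos k
  rw [real_inner_comm, h2] at h3
  have h4 : J 1 k = 0 := by simpa using le_antisymm h3 (sq_nonneg _)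
  have h5 := hG.mem 1 one_pos k
  rw [h4] at h5
  simpa using hG.single _ h5

omit hG [CompleteSpace H] in
/-- The parameter of the `n`-th Yosida approximation. -/
theorem inv_pos_nat (n : ℕ) : 0 < ((n : ℝ) + 1)⁻¹ := by positivity

theorem tendsto_apply (x : H) : Tendsto (fun n : ℕ => J ((n : ℝ) + 1)⁻¹ x) atTop (𝓝 x) := by
  have := tendsto_zero_of_dense (l := atTop) (C := 2)
    (M := fun n : ℕ => J ((n : ℝ) + 1)⁻¹ - ContinuousLinearMap.id ℝ H) (fun n => ?_)
    hG.dense_domain ?_ x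
  · simpa using this.add_const x
  · refine (norm_sub_le _ _).trans ?_
    linarith [hG.norm_le_one (inv_pos_nat n), ContinuousLinearMap.norm_id_le (𝕜 := ℝ) (E := H)]
  · rintro f ⟨h, hf⟩
    have h0 : Tendsto (fun n : ℕ => ((n : ℝ) + 1)⁻¹ * ‖h‖) atTop (𝓝 0) := by
      simpa [one_div] using (tendsto_one_div_add_atTop_nhds_zero_nat (𝕜 := ℝ)).mul_const ‖h‖
    refine squeeze_zero_norm (fun n => ?_) h0
    simp only [sub_apply, ContinuousLinearMap.id_apply]
    rw [hG.apply_sub (inv_pos_nat n) hf, norm_smul, Real.norm_of_nonneg (inv_pos_nat n).le]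
    exact mul_le_mul_of_nonneg_left (hG.norm_apply_le (inv_pos_nat n) h) (inv_pos_nat n).le

omit hG [CompleteSpace H] in
variable (J) in
/-- The Yosida approximations of the generator. -/
def _root_.TimeCommutator.yosida (n : ℕ) : H →L[ℝ] H := ((n : ℝ) + 1) • (J ((n : ℝ) + 1)⁻¹ - 1)

omit [CompleteSpace H] in
theorem yosida_apply (n : ℕ) (hf : (f, h) ∈ G) : yosida J n f = J ((n : ℝ) + 1)⁻¹ h := by
  have := hG.apply_sub (inv_pos_nat n) hf
  simp only [yosida, smul_apply, sub_apply, one_apply_eq_self, this]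
  rw [smul_inv_smul₀ (by positivity)]

theorem norm_exp_yosida_le (n : ℕ) {s : ℝ} (hs : 0 ≤ s) :
    ‖NormedSpace.exp (s • yosida J n)‖ ≤ 1 := by
  rw [yosida, smul_smul]
  exact norm_exp_le_one_of_contraction (hG.norm_le_one (inv_pos_nat n)) (by positivity)

omit [CompleteSpace H] in
theorem commute_yosida (n m : ℕ) : Commute (yosida J n) (yosida J m) := by
  have : Commute (J ((n : ℝ) + 1)⁻¹) (J ((m : ℝ) + 1)⁻¹) := by
    ext x
    exact hG.apply_comm (inv_pos_nat n) (inv_pos_nat m) x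
  exact (((this.sub_left (Commute.one_left _)).sub_right
    ((Commute.one_right _))).smul_left _).smul_right _

theorem cauchySeq_exp_yosida (s : ℝ≥0) (x : H) :
    CauchySeq fun n => NormedSpace.exp ((s : ℝ) • yosida J n) x := by
  rw [cauchySeq_iff_tendsto_dist_atTop_0]
  have := tendsto_zero_of_dense (l := (atTop : Filter (ℕ × ℕ))) (C := 2)
    (M := fun n => NormedSpace.exp ((s : ℝ) • yosida J n.1) -
      NormedSpace.exp ((s : ℝ) • yosida J n.2)) (fun n => ?_) hG.dense_domain ?_ x
  · simpa [dist_eq_norm] using this.norm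
  · refine (norm_sub_le _ _).trans ?_
    exact (add_le_add (hG.norm_exp_yosida_le n.1 s.2) (hG.norm_exp_yosida_le n.2 s.2)).trans_eq
      (by norm_num)
  · rintro f ⟨h, hf⟩
    have h0 : Tendsto (fun n : ℕ × ℕ => (s : ℝ) *
        ‖J ((n.1 : ℝ) + 1)⁻¹ h - J ((n.2 : ℝ) + 1)⁻¹ h‖) atTop (𝓝 0) := by
      have h1 := (hG.tendsto_apply h).comp (tendsto_fst (f := atTop) (g := (atTop : Filter ℕ)))
      have h2 := (hG.tendsto_apply h).comp (tendsto_snd (f := (atTop : Filter ℕ)) (g := atTop))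
      rw [prod_atTop_atTop_eq] at h1 h2
      simpa using ((h1.sub h2).norm.const_mul (s : ℝ))
    refine squeeze_zero_norm (fun n => ?_) h0
    have := norm_exp_sub_exp_le (hG.commute_yosida n.1 n.2)
      (fun r hr => hG.norm_exp_yosida_le n.1 hr) (fun r hr => hG.norm_exp_yosida_le n.2 hr) s.2 f
    rwa [hG.yosida_apply n.1 hf, hG.yosida_apply n.2 hf] at this

/-- The contraction semigroup generated by `G`. -/
def semigroup (s : ℝ≥0) : H →L[ℝ] H :=
  continuousLinearMapOfTendsto (fun n => NormedSpace.exp ((s : ℝ) • yosida J n))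
    (tendsto_pi_nhds.2 fun x => (cauchySeq_tendsto_of_complete (hG.cauchySeq_exp_yosida s x)).choose_spec)

theorem tendsto_semigroup (s : ℝ≥0) (x : H) :
    Tendsto (fun n => NormedSpace.exp ((s : ℝ) • yosida J n) x) atTop (𝓝 (hG.semigroup s x)) :=
  (cauchySeq_tendsto_of_complete (hG.cauchySeq_exp_yosida s x)).choose_spec

theorem norm_semigroup_apply_le (s : ℝ≥0) (x : H) : ‖hG.semigroup s x‖ ≤ ‖x‖ :=
  le_of_tendsto (hG.tendsto_semigroup s x).norm <| Eventually.of_forall fun n => by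
    simpa using (NormedSpace.exp ((s : ℝ) • yosida J n)).le_of_opNorm_le
      (hG.norm_exp_yosida_le n s.2) x

theorem semigroup_zero : hG.semigroup 0 = ContinuousLinearMap.id ℝ H := by
  ext x
  refine tendsto_nhds_unique (hG.tendsto_semigroup 0 x) ?_
  simp

theorem semigroup_add (s r : ℝ≥0) :
    hG.semigroup (s + r) = (hG.semigroup s).comp (hG.semigroup r) := by
  ext x
  refine tendsto_nhds_unique (hG.tendsto_semigroup (s + r) x) ?_
  have h1 := hG.tendsto_semigroup s (hG.semigroup r x)
  -- A product of strongly convergent operators converges strongly because the left factors are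
  -- contractions.
  have h2 : Tendsto (fun n => NormedSpace.exp ((s : ℝ) • yosida J n)
      (NormedSpace.exp ((r : ℝ) • yosida J n) x - hG.semigroup r x)) atTop (𝓝 0) := by
    refine squeeze_zero_norm (a := fun n => ‖NormedSpace.exp ((r : ℝ) • yosida J n) x -
      hG.semigroup r x‖) (fun n => ?_) ?_
    · simpa using (NormedSpace.exp ((s : ℝ) • yosida J n)).le_of_opNorm_le
        (hG.norm_exp_yosida_le n s.2) (NormedSpace.exp ((r : ℝ) • yosida J n) x -
          hG.semigroup r x)
    · simpa using ((hG.tendsto_semigroup r x).sub_const (hG.semigroup r x)).norm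
  have h3 := h2.add h1
  rw [zero_add] at h3
  refine h3.congr fun n => ?_
  let _ : NormedAlgebra ℚ (H →L[ℝ] H) := NormedAlgebra.restrictScalars ℚ ℝ _
  rw [map_sub, sub_add_cancel, NNReal.coe_add, add_smul, NormedSpace.exp_add_of_commute]
  · rfl
  · exact ((Commute.refl _).smul_left _).smul_right _

theorem norm_semigroup_sub_le (s : ℝ≥0) (hf : (f, h) ∈ G) :
    ‖hG.semigroup s f - f‖ ≤ s * ‖h‖ :=
  le_of_tendsto ((hG.tendsto_semigroup s f).sub_const f).norm <| Eventually.of_forall fun n => by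
    refine (norm_exp_apply_sub_le (fun r hr => hG.norm_exp_yosida_le n hr) s.2 f).trans ?_
    rw [hG.yosida_apply n hf]
    exact mul_le_mul_of_nonneg_left (hG.norm_apply_le (inv_pos_nat n) h) s.2

theorem norm_semigroup_sub_sub_le (s : ℝ≥0) {k : H} (hf : (f, h) ∈ G) (hh : (h, k) ∈ G) :
    ‖hG.semigroup s f - f - (s : ℝ) • h‖ ≤ s * (s * ‖k‖) := by
  refine le_of_tendsto (((hG.tendsto_semigroup s f).sub_const f).sub
    ((hG.tendsto_apply h).const_smul (s : ℝ))).norm <| Eventually.of_forall fun n => ?_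
  have := norm_exp_apply_sub_sub_le (fun r hr => hG.norm_exp_yosida_le n hr) s.2 f
  rw [hG.yosida_apply n hf, hG.yosida_apply n (hG.apply_mem (inv_pos_nat n) hh)] at this
  refine this.trans (mul_le_mul_of_nonneg_left (mul_le_mul_of_nonneg_left ?_ s.2) s.2)
  exact (hG.norm_apply_le (inv_pos_nat n) _).trans (hG.norm_apply_le (inv_pos_nat n) _)

theorem continuous_semigroup (x : H) : Continuous fun s => hG.semigroup s x := by
  -- In `ℝ≥0` the distance `|s - r|` is written `max s r - min s r`; the smaller time factors out as
  -- a contraction.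
  have key : ∀ (s r : ℝ≥0) (y : H),
      ‖hG.semigroup s y - hG.semigroup r y‖ ≤ ‖hG.semigroup (max s r - min s r) y - y‖ := by
    intro s r y
    wlog hsr : r ≤ s generalizing s r
    · rw [norm_sub_rev, max_comm, min_comm]
      exact this r s (le_of_not_ge hsr)
    rw [max_eq_left hsr, min_eq_right hsr]
    have h1 : s = r + (s - r) := (add_tsub_cancel_of_le hsr).symm
    nth_rw 1 [h1]
    rw [hG.semigroup_add, ContinuousLinearMap.comp_apply, ← map_sub]
    exact hG.norm_semigroup_apply_le _ _
  rw [continuous_iff_continuousAt]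
  intro r
  rw [ContinuousAt, tendsto_iff_norm_sub_tendsto_zero]
  have := tendsto_zero_of_dense (l := 𝓝 r) (C := 2)
    (M := fun s => hG.semigroup s - hG.semigroup r) (fun s => ?_) hG.dense_domain ?_ x
  · simpa using this.norm
  · refine ContinuousLinearMap.opNorm_le_bound _ zero_le_two fun y => ?_
    refine (norm_sub_le _ _).trans ?_
    exact (add_le_add (hG.norm_semigroup_apply_le s y) (hG.norm_semigroup_apply_le r y)).trans_eq
      (two_mul _).symm
  · rintro f ⟨h, hf⟩
    have h0 : Tendsto (fun s : ℝ≥0 => ((max s r - min s r : ℝ≥0) : ℝ) * ‖h‖) (𝓝 r) (𝓝 0) := by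
      have : Continuous fun s : ℝ≥0 => ((max s r - min s r : ℝ≥0) : ℝ) * ‖h‖ := by fun_prop
      simpa using this.tendsto r
    refine squeeze_zero_norm (fun s => ?_) h0
    exact (key s r f).trans (hG.norm_semigroup_sub_le _ hf)

/-- Taylor's formula with a second-order remainder needs `f` in the domain of the square of the
generator. So `f` is replaced by `J f` with a small resolvent parameter. The error is controlled by
the first-order bound, uniformly in `s`, through `‖h - J h‖`. The parameter is fixed first, and then
`s → 0`. -/
theorem tendsto_of_mem (hf : (f, h) ∈ G) :
    Tendsto (fun s : ℝ≥0 => (s : ℝ)⁻¹ • (hG.semigroup s f - f)) (𝓝[>] 0) (𝓝 h) := by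
  have bound : ∀ (n : ℕ) (s : ℝ≥0), 0 < s → ‖(s : ℝ)⁻¹ • (hG.semigroup s f - f) - h‖ ≤
      2 * ‖h - J ((n : ℝ) + 1)⁻¹ h‖ +
        s * ‖((n : ℝ) + 1)⁻¹⁻¹ • (J ((n : ℝ) + 1)⁻¹ h - h)‖ := by
    intro n s hs
    have hs' : (0 : ℝ) < s := hs
    have hn := inv_pos_nat n
    have h1 := hG.norm_semigroup_sub_le s (G.sub_mem hf (hG.apply_mem hn hf))
    have h2 := hG.norm_semigroup_sub_sub_le s (hG.apply_mem hn hf) (hG.mem _ hn h)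
    set f' := J ((n : ℝ) + 1)⁻¹ f
    set h' := J ((n : ℝ) + 1)⁻¹ h
    set k := ((n : ℝ) + 1)⁻¹⁻¹ • (h' - h)
    simp only at h1
    have e : (s : ℝ)⁻¹ • (hG.semigroup s f - f) - h =
        (s : ℝ)⁻¹ • (hG.semigroup s (f - f') - (f - f')) +
        (s : ℝ)⁻¹ • (hG.semigroup s f' - f' - (s : ℝ) • h') + (h' - h) := by
      rw [smul_sub _ _ ((s : ℝ) • h'), inv_smul_smul₀ hs'.ne', map_sub]
      simp only [smul_sub]
      abel
    rw [e]
    have h3 : ‖(s : ℝ)⁻¹ • (hG.semigroup s (f - f') - (f - f'))‖ ≤ ‖h - h'‖ := by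
      rw [norm_smul, norm_inv, Real.norm_of_nonneg hs'.le, inv_mul_le_iff₀ hs']
      exact h1
    have h4 : ‖(s : ℝ)⁻¹ • (hG.semigroup s f' - f' - (s : ℝ) • h')‖ ≤ s * ‖k‖ := by
      rw [norm_smul, norm_inv, Real.norm_of_nonneg hs'.le, inv_mul_le_iff₀ hs']
      exact h2
    have h5 := norm_add₃_le (a := (s : ℝ)⁻¹ • (hG.semigroup s (f - f') - (f - f')))
      (b := (s : ℝ)⁻¹ • (hG.semigroup s f' - f' - (s : ℝ) • h')) (c := h' - h)
    rw [norm_sub_rev h' h] at h5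
    linarith
  rw [Metric.tendsto_nhds]
  intro ε hε
  have h1 : Tendsto (fun n : ℕ => 2 * ‖h - J ((n : ℝ) + 1)⁻¹ h‖) atTop (𝓝 0) := by
    simpa using (((hG.tendsto_apply h).const_sub h).norm.const_mul 2)
  obtain ⟨n, hn⟩ := ((tendsto_order.1 h1).2 (ε / 2) (by positivity)).exists
  have h2 : Tendsto (fun s : ℝ≥0 => (s : ℝ) *
      ‖((n : ℝ) + 1)⁻¹⁻¹ • (J ((n : ℝ) + 1)⁻¹ h - h)‖) (𝓝[>] 0) (𝓝 0) := by
    have : Continuous (fun s : ℝ≥0 => (s : ℝ) *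
      ‖((n : ℝ) + 1)⁻¹⁻¹ • (J ((n : ℝ) + 1)⁻¹ h - h)‖) := by fun_prop
    simpa using (this.tendsto 0).mono_left nhdsWithin_le_nhds
  filter_upwards [(tendsto_order.1 h2).2 (ε / 2) (by positivity), self_mem_nhdsWithin] with s hs h0
  rw [dist_eq_norm]
  linarith [bound n s h0]

theorem mem_of_tendsto
    (h1 : Tendsto (fun s : ℝ≥0 => (s : ℝ)⁻¹ • (hG.semigroup s f - f)) (𝓝[>] 0) (𝓝 h)) :
    (f, h) ∈ G := by
  -- Maximality: `f' = J 1 (f - h)` is in the domain, and the right derivative at `0` of the orbit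
  -- of `f - f'` is `f - f'` itself. Contractivity makes the inner product of `f - f'` with this
  -- derivative nonpositive, so `f = f'`.
  have h2 := hG.mem 1 one_pos (f - h)
  rw [inv_one, one_smul] at h2
  set f' := J 1 (f - h)
  have h3 := (h1.sub (hG.tendsto_of_mem h2))
  have h4 : h - (f' - (f - h)) = f - f' := by abel
  rw [h4] at h3
  have h5 : Tendsto (fun s : ℝ≥0 => ⟪(s : ℝ)⁻¹ • (hG.semigroup s (f - f') - (f - f')), f - f'⟫_ℝ)
      (𝓝[>] 0) (𝓝 ⟪f - f', f - f'⟫_ℝ) := by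
    refine Tendsto.inner (h3.congr fun s => ?_) tendsto_const_nhds
    rw [map_sub]
    simp only [smul_sub]
    abel
  have h6 : ⟪f - f', f - f'⟫_ℝ ≤ 0 := by
    refine le_of_tendsto h5 (Eventually.of_forall fun s => ?_)
    rw [real_inner_smul_left, inner_sub_left, real_inner_self_eq_norm_sq]
    refine mul_nonpos_of_nonneg_of_nonpos (by positivity) ?_
    have := real_inner_le_norm (hG.semigroup s (f - f')) (f - f')
    nlinarith [hG.norm_semigroup_apply_le s (f - f'), norm_nonneg (f - f')]
  have h7 : f = f' := by
    rw [real_inner_self_eq_norm_sq] at h6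
    exact sub_eq_zero.1 (by simpa using le_antisymm h6 (sq_nonneg _))
  rw [← h7] at h2
  simpa using h2

/-- Strongly continuous semigroups on `H` with generator of graph `G`. -/
structure _root_.TimeCommutator.IsSemigroupOf (G : Submodule ℝ (H × H))
    (Q : ℝ≥0 → H →L[ℝ] H) : Prop where
  map_zero : Q 0 = ContinuousLinearMap.id ℝ H
  map_add : ∀ s r : ℝ≥0, Q (s + r) = (Q s).comp (Q r)
  cont : ∀ f : H, Continuous fun s => Q s f
  generator : ∀ f h : H,
    Tendsto (fun s : ℝ≥0 => (s : ℝ)⁻¹ • (Q s f - f)) (𝓝[>] 0) (𝓝 h) ↔ (f, h) ∈ G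

theorem isSemigroupOf : IsSemigroupOf G hG.semigroup :=
  ⟨hG.semigroup_zero, hG.semigroup_add, hG.continuous_semigroup,
    fun _ _ => ⟨hG.mem_of_tendsto, hG.tendsto_of_mem⟩⟩

end IsResolventFamily

namespace IsSemigroupOf

variable {G : Submodule ℝ (H × H)} {Q R : ℝ≥0 → H →L[ℝ] H} {f h : H}

theorem apply_mem (hQ : IsSemigroupOf G Q) (hf : (f, h) ∈ G) (s : ℝ≥0) : (Q s f, Q s h) ∈ G := by
  rw [← hQ.generator] at hf ⊢
  refine (((Q s).continuous.tendsto h).comp hf).congr fun r => ?_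
  simp only [Function.comp_apply]
  rw [map_smul, map_sub, ← ContinuousLinearMap.comp_apply, ← ContinuousLinearMap.comp_apply,
    ← hQ.map_add, ← hQ.map_add, add_comm]

/-- The semigroup law moves the derivative at time zero to time `s`. Only the right derivative
results, which suffices for Gronwall's inequality. -/
theorem hasDerivWithinAt (hQ : IsSemigroupOf G Q) (hf : (f, h) ∈ G) {s : ℝ} (hs : 0 ≤ s) :
    HasDerivWithinAt (fun r : ℝ => Q r.toNNReal f) (Q s.toNNReal h) (Ici s) s := by
  rw [← hasDerivWithinAt_Ioi_iff_Ici, hasDerivWithinAt_iff_tendsto_slope' (by simp)]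
  have h1 : Tendsto (fun r : ℝ => (r - s).toNNReal) (𝓝[>] s) (𝓝[>] 0) := by
    refine tendsto_nhdsWithin_of_tendsto_nhds_of_eventually_within _ ?_ ?_
    · have : Continuous fun r : ℝ => (r - s).toNNReal := by fun_prop
      simpa using (this.tendsto s).mono_left nhdsWithin_le_nhds
    · filter_upwards [self_mem_nhdsWithin] with r hr
      simpa using hr
  refine (((Q s.toNNReal).continuous.tendsto h).comp
    (((hQ.generator f h).2 hf).comp h1)).congr' ?_
  filter_upwards [self_mem_nhdsWithin] with r hr
  have hr' : 0 ≤ r - s := (sub_pos.2 hr).le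
  have h2 : r.toNNReal = s.toNNReal + (r - s).toNNReal := by
    rw [← Real.toNNReal_add hs hr', add_sub_cancel]
  simp only [Function.comp_apply]
  rw [slope_def_module, h2, hQ.map_add, map_smul, map_sub, Real.coe_toNNReal _ hr']
  rfl

/-- Gronwall's inequality for a quadratic form along a curve. -/
theorem _root_.TimeCommutator.inner_le_of_inner_deriv_le {W : H →L[ℝ] H}
    (hW : ∀ x y, ⟪W x, y⟫_ℝ = ⟪x, W y⟫_ℝ) {C : ℝ} {v w : ℝ → H} (hv : Continuous v)
    (hd : ∀ s, 0 ≤ s → HasDerivWithinAt v (w s) (Ici s) s)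
    (hC : ∀ s, 0 ≤ s → ⟪W (v s), w s⟫_ℝ ≤ C * ⟪W (v s), v s⟫_ℝ) {s : ℝ} (hs : 0 ≤ s) :
    ⟪W (v s), v s⟫_ℝ ≤ Real.exp (2 * C * s) * ⟪W (v 0), v 0⟫_ℝ := by
  have hd' : ∀ r ∈ Ico 0 s, HasDerivWithinAt
      (fun r : ℝ => Real.exp (-(2 * C) * r) * ⟪W (v r), v r⟫_ℝ)
      (Real.exp (-(2 * C) * r) * (2 * (⟪W (v r), w r⟫_ℝ - C * ⟪W (v r), v r⟫_ℝ))) (Ici r) r := by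
    intro r hr
    have h1 := ((W.hasFDerivAt (x := v r)).comp_hasDerivWithinAt r (hd r hr.1)).inner ℝ (hd r hr.1)
    have h2 : HasDerivAt (fun r : ℝ => Real.exp (-(2 * C) * r))
        (Real.exp (-(2 * C) * r) * (-(2 * C))) r := by
      simpa using ((hasDerivAt_id r).const_mul (-(2 * C))).exp
    refine (h2.hasDerivWithinAt.mul h1).congr_deriv ?_
    simp only [Function.comp_apply]
    rw [hW (w r), real_inner_comm (W (v r)) (w r)]
    ring
  -- The quantity `e^{-2Cr} ⟪W v, v⟫` has nonpositive right derivative and is therefore bounded by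
  -- its initial value.
  have h3 := image_le_of_deriv_right_le_deriv_boundary
    (f := fun r : ℝ => Real.exp (-(2 * C) * r) * ⟪W (v r), v r⟫_ℝ) (a := 0) (b := s)
    (B := fun _ => ⟪W (v 0), v 0⟫_ℝ) (B' := fun _ => 0)
    (Continuous.continuousOn (by fun_prop)) hd' (by simp) continuousOn_const
    (fun r _ => hasDerivWithinAt_const _ _ _) (fun r hr => ?_) (right_mem_Icc.2 hs)
  · have h4 : Real.exp (2 * C * s) * Real.exp (-(2 * C) * s) = 1 := by
      rw [← Real.exp_add]
      simp
    calc ⟪W (v s), v s⟫_ℝ = Real.exp (2 * C * s) * (Real.exp (-(2 * C) * s) * ⟪W (v s), v s⟫_ℝ) := by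
          rw [← mul_assoc, h4, one_mul]
      _ ≤ _ := mul_le_mul_of_nonneg_left h3 (Real.exp_pos _).le
  · have := hC r hr.1
    exact mul_nonpos_of_nonneg_of_nonpos (Real.exp_pos _).le (by linarith)

theorem inner_le (hQ : IsSemigroupOf G Q) (hG : Dense {f : H | ∃ h, (f, h) ∈ G}) {W : H →L[ℝ] H}
    (hW : ∀ x y, ⟪W x, y⟫_ℝ = ⟪x, W y⟫_ℝ) {C : ℝ}
    (hC : ∀ f h, (f, h) ∈ G → ⟪W f, h⟫_ℝ ≤ C * ⟪W f, f⟫_ℝ) (s : ℝ≥0) (f : H) :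
    ⟪W (Q s f), Q s f⟫_ℝ ≤ Real.exp (2 * C * s) * ⟪W f, f⟫_ℝ := by
  refine hG.induction (P := fun f => ⟪W (Q s f), Q s f⟫_ℝ ≤ Real.exp (2 * C * s) * ⟪W f, f⟫_ℝ)
    ?_ (isClosed_le (by fun_prop) (by fun_prop)) f
  rintro f ⟨h, hf⟩
  have := inner_le_of_inner_deriv_le hW (v := fun r => Q r.toNNReal f)
    ((hQ.cont f).comp continuous_real_toNNReal) (fun r hr => hQ.hasDerivWithinAt hf hr)
    (fun r _ => hC _ _ (hQ.apply_mem hf _)) s.2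
  simpa [hQ.map_zero] using this

/-- For initial data in the domain, the difference of the two orbits solves the same dissipative
equation and starts at `0`. Gronwall with `W = 1` and `C = 0` makes it vanish; density does the
rest. -/
theorem unique [CompleteSpace H] (hQ : IsSemigroupOf G Q) (hR : IsSemigroupOf G R)
    (hG : Dense {f : H | ∃ h, (f, h) ∈ G}) (hdis : ∀ f h, (f, h) ∈ G → ⟪h, f⟫_ℝ ≤ 0) : Q = R := by
  ext s f
  refine hG.induction (P := fun f => Q s f = R s f) ?_
    (isClosed_eq (by fun_prop) (by fun_prop)) f
  rintro f ⟨h, hf⟩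
  have := inner_le_of_inner_deriv_le (W := ContinuousLinearMap.id ℝ H) (fun _ _ => rfl)
    (v := fun r => Q r.toNNReal f - R r.toNNReal f) (C := 0)
    (((hQ.cont f).sub (hR.cont f)).comp continuous_real_toNNReal)
    (fun r hr => (hQ.hasDerivWithinAt hf hr).sub (hR.hasDerivWithinAt hf hr))
    (fun r _ => ?_) s.coe_nonneg
  · simp only [Real.toNNReal_coe, Real.toNNReal_zero, hQ.map_zero, hR.map_zero, sub_self,
      ContinuousLinearMap.id_apply, inner_zero_left, mul_zero] at this
    exact sub_eq_zero.1 (real_inner_self_nonpos.1 this)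
  · rw [zero_mul, ContinuousLinearMap.id_apply, real_inner_comm]
    exact hdis _ _ (G.sub_mem (hQ.apply_mem hf _) (hR.apply_mem hf _))

end IsSemigroupOf

/-- A linear functional, continuous for the norm and sequentially continuous for the strong
topology, that is bounded on powers of resolvents is bounded on the semigroup. -/
theorem IsResolventFamily.norm_apply_semigroup_le [CompleteSpace H] {G : Submodule ℝ (H × H)}
    {J : ℝ → H →L[ℝ] H} (hG : IsResolventFamily G J) (ℓ : (H →L[ℝ] H) →L[ℝ] ℝ)
    (hℓ : ∀ (L : ℕ → H →L[ℝ] H) (M : H →L[ℝ] H), (∀ x, Tendsto (fun n => L n x) atTop (𝓝 (M x))) →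
      Tendsto (fun n => ℓ (L n)) atTop (𝓝 (ℓ M))) {K : ℝ}
    (hK : ∀ τ, 0 < τ → ∀ k : ℕ, |ℓ (J τ ^ k)| ≤ K) (s : ℝ≥0) : |ℓ (hG.semigroup s)| ≤ K := by
  refine le_of_tendsto (hℓ _ _ (hG.tendsto_semigroup s)).abs (Eventually.of_forall fun n => ?_)
  rw [yosida, smul_smul, ← Real.norm_eq_abs]
  exact norm_apply_exp_le_of_pow _ ℓ (hK _ (inv_pos_nat n)) (by positivity)

end Semigroup
end TimeCommutator

/-! ### Calculus of `C^{1,2}` functions, extension by zero, and cutoffs in time. -/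

namespace TimeCommutator

open scoped ContDiff

variable {d : ℕ} {T : ℝ}

theorem isOpen_slab (d : ℕ) (T : ℝ) : IsOpen (slab d T) := isOpen_Ioo.prod isOpen_univ

/-- Local `C^{1,2}` regularity on a set. -/
structure IsC12On (U : Set (SpaceTime d)) (f : SpaceTime d → ℝ) : Prop where
  cont : ContinuousOn f U
  diff_time : ∀ p ∈ U, DifferentiableAt ℝ (fun t => f (t, p.2)) p.1
  cont_time : ContinuousOn (timeDeriv f) U
  diff_space : ∀ p ∈ U, DifferentiableAt ℝ (fun x => f (p.1, x)) p.2
  cont_space : ContinuousOn (spaceFDeriv f) U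
  diff_space2 : ∀ p ∈ U, DifferentiableAt ℝ (fun x => spaceFDeriv f (p.1, x)) p.2
  cont_space2 : ContinuousOn (spaceFDeriv2 f) U

theorem IsTest.isC12On {f : SpaceTime d → ℝ} (hf : IsTest T f) : IsC12On (slab d T) f :=
  ⟨hf.cont, hf.diff_time, hf.cont_time, hf.diff_space, hf.cont_space, hf.diff_space2,
    hf.cont_space2⟩

section Local

variable {U V : Set (SpaceTime d)} {f g : SpaceTime d → ℝ}

theorem eventually_time (hU : IsOpen U) {p : SpaceTime d} (hp : p ∈ U) :
    ∀ᶠ t in 𝓝 p.1, (t, p.2) ∈ U :=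
  (Continuous.tendsto' (by fun_prop : Continuous fun t : ℝ => (t, p.2)) p.1 p rfl).eventually
    (hU.mem_nhds hp)

theorem eventually_space (hU : IsOpen U) {p : SpaceTime d} (hp : p ∈ U) :
    ∀ᶠ x in 𝓝 p.2, (p.1, x) ∈ U :=
  (Continuous.tendsto' (by fun_prop : Continuous fun x => (p.1, x)) p.2 p rfl).eventually
    (hU.mem_nhds hp)

theorem timeDeriv_congr (hU : IsOpen U) (h : EqOn f g U) : EqOn (timeDeriv f) (timeDeriv g) U :=
  fun _ hp => EventuallyEq.deriv_eq ((eventually_time hU hp).mono fun _ ht => h ht)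

theorem spaceFDeriv_congr (hU : IsOpen U) (h : EqOn f g U) :
    EqOn (spaceFDeriv f) (spaceFDeriv g) U :=
  fun _ hp => EventuallyEq.fderiv_eq ((eventually_space hU hp).mono fun _ hx => h hx)

theorem spaceFDeriv2_congr (hU : IsOpen U) (h : EqOn f g U) :
    EqOn (spaceFDeriv2 f) (spaceFDeriv2 g) U :=
  fun _ hp => EventuallyEq.fderiv_eq
    ((eventually_space hU hp).mono fun _ hx => spaceFDeriv_congr hU h hx)

theorem spaceDeriv_congr (hU : IsOpen U) (h : EqOn f g U) (i : Fin d) :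
    EqOn (spaceDeriv i f) (spaceDeriv i g) U := fun p hp => by
  simp only [spaceDeriv, spaceFDeriv_congr hU h hp]

theorem IsC12On.congr (hU : IsOpen U) (hf : IsC12On U f) (h : EqOn f g U) : IsC12On U g where
  cont := hf.cont.congr h.symm
  diff_time p hp := (hf.diff_time p hp).congr_of_eventuallyEq
    ((eventually_time hU hp).mono fun _ ht => (h ht).symm)
  cont_time := hf.cont_time.congr (timeDeriv_congr hU h).symm
  diff_space p hp := (hf.diff_space p hp).congr_of_eventuallyEq
    ((eventually_space hU hp).mono fun _ hx => (h hx).symm)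
  cont_space := hf.cont_space.congr (spaceFDeriv_congr hU h).symm
  diff_space2 p hp := (hf.diff_space2 p hp).congr_of_eventuallyEq
    ((eventually_space hU hp).mono fun _ hx => (spaceFDeriv_congr hU h hx).symm)
  cont_space2 := hf.cont_space2.congr (spaceFDeriv2_congr hU h).symm

theorem IsC12On.mono (hf : IsC12On U f) (h : V ⊆ U) : IsC12On V f where
  cont := hf.cont.mono h
  diff_time p hp := hf.diff_time p (h hp)
  cont_time := hf.cont_time.mono h
  diff_space p hp := hf.diff_space p (h hp)
  cont_space := hf.cont_space.mono h
  diff_space2 p hp := hf.diff_space2 p (h hp)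
  cont_space2 := hf.cont_space2.mono h

theorem IsC12On.union (hU : IsOpen U) (hV : IsOpen V) (hf : IsC12On U f) (hf' : IsC12On V f) :
    IsC12On (U ∪ V) f where
  cont := hf.cont.union_of_isOpen hf'.cont hU hV
  diff_time p hp := hp.elim (hf.diff_time p) (hf'.diff_time p)
  cont_time := hf.cont_time.union_of_isOpen hf'.cont_time hU hV
  diff_space p hp := hp.elim (hf.diff_space p) (hf'.diff_space p)
  cont_space := hf.cont_space.union_of_isOpen hf'.cont_space hU hV
  diff_space2 p hp := hp.elim (hf.diff_space2 p) (hf'.diff_space2 p)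
  cont_space2 := hf.cont_space2.union_of_isOpen hf'.cont_space2 hU hV

theorem timeDeriv_mul (hf : IsC12On U f) (hg : IsC12On U g) {p : SpaceTime d} (hp : p ∈ U) :
    timeDeriv (fun q => f q * g q) p = timeDeriv f p * g p + f p * timeDeriv g p :=
  deriv_fun_mul (hf.diff_time p hp) (hg.diff_time p hp)

theorem spaceFDeriv_mul (hf : IsC12On U f) (hg : IsC12On U g) {p : SpaceTime d} (hp : p ∈ U) :
    spaceFDeriv (fun q => f q * g q) p = f p • spaceFDeriv g p + g p • spaceFDeriv f p :=
  fderiv_fun_mul (hf.diff_space p hp) (hg.diff_space p hp)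

theorem spaceDeriv_mul (hf : IsC12On U f) (hg : IsC12On U g) (i : Fin d) {p : SpaceTime d}
    (hp : p ∈ U) : spaceDeriv i (fun q => f q * g q) p
      = f p * spaceDeriv i g p + g p * spaceDeriv i f p := by
  simp [spaceDeriv, spaceFDeriv_mul hf hg hp]

theorem spaceFDeriv_mul_hasFDerivAt (hU : IsOpen U) (hf : IsC12On U f) (hg : IsC12On U g)
    {p : SpaceTime d} (hp : p ∈ U) :
    HasFDerivAt (fun x => spaceFDeriv (fun q => f q * g q) (p.1, x))
      ((f p • spaceFDeriv2 g p + (spaceFDeriv f p).smulRight (spaceFDeriv g p)) +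
        (g p • spaceFDeriv2 f p + (spaceFDeriv g p).smulRight (spaceFDeriv f p))) p.2 := by
  have h1 := ((hf.diff_space p hp).hasFDerivAt.fun_smul (hg.diff_space2 p hp).hasFDerivAt).fun_add
    ((hg.diff_space p hp).hasFDerivAt.fun_smul (hf.diff_space2 p hp).hasFDerivAt)
  refine h1.congr_of_eventuallyEq ((eventually_space hU hp).mono fun x hx => ?_)
  exact spaceFDeriv_mul hf hg hx

set_option maxSynthPendingDepth 3 in
theorem IsC12On.mul (hU : IsOpen U) (hf : IsC12On U f) (hg : IsC12On U g) :
    IsC12On U (fun q => f q * g q) where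
  cont := hf.cont.mul hg.cont
  diff_time p hp := (hf.diff_time p hp).fun_mul (hg.diff_time p hp)
  cont_time := ((hf.cont_time.mul hg.cont).add (hf.cont.mul hg.cont_time)).congr
    fun p hp => timeDeriv_mul hf hg hp
  diff_space p hp := (hf.diff_space p hp).fun_mul (hg.diff_space p hp)
  cont_space := ((hf.cont.smul hg.cont_space).add (hg.cont.smul hf.cont_space)).congr
    fun p hp => spaceFDeriv_mul hf hg hp
  diff_space2 p hp := (spaceFDeriv_mul_hasFDerivAt hU hf hg hp).differentiableAt
  cont_space2 := by
    have h1 : ∀ {a b : SpaceTime d → EuclideanSpace ℝ (Fin d) →L[ℝ] ℝ}, ContinuousOn a U →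
        ContinuousOn b U → ContinuousOn (fun p => (a p).smulRight (b p)) U := fun ha hb =>
      (((ContinuousLinearMap.smulRightL ℝ (EuclideanSpace ℝ (Fin d))
        (EuclideanSpace ℝ (Fin d) →L[ℝ] ℝ)).continuous.comp_continuousOn ha).clm_apply hb)
    refine (((hf.cont.smul hg.cont_space2).add (h1 hf.cont_space hg.cont_space)).add
      ((hg.cont.smul hf.cont_space2).add (h1 hg.cont_space hf.cont_space))).congr fun p hp => ?_
    exact (spaceFDeriv_mul_hasFDerivAt hU hf hg hp).fderiv

theorem isC12On_zero : IsC12On U (fun _ : SpaceTime d => (0 : ℝ)) := by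
  have h1 : timeDeriv (fun _ : SpaceTime d => (0 : ℝ)) = fun _ => 0 := by
    ext p; simp [timeDeriv]
  have h2 : spaceFDeriv (fun _ : SpaceTime d => (0 : ℝ)) = fun _ => 0 := by
    ext p; simp [spaceFDeriv]
  have h3 : spaceFDeriv2 (fun _ : SpaceTime d => (0 : ℝ)) = fun _ => 0 := by
    ext p; simp [spaceFDeriv2, h2]
  refine ⟨continuousOn_const, fun _ _ => differentiableAt_const _, ?_,
    fun _ _ => differentiableAt_const _, ?_, fun _ _ => ?_, ?_⟩
  · rw [h1]; exact continuousOn_const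
  · rw [h2]; exact continuousOn_const
  · rw [h2]; exact differentiableAt_const _
  · rw [h3]; exact continuousOn_const

theorem derivs_eq_zero (hU : IsOpen U) (h : EqOn f (fun _ => 0) U) {p : SpaceTime d} (hp : p ∈ U) :
    timeDeriv f p = 0 ∧ spaceFDeriv f p = 0 ∧ spaceFDeriv2 f p = 0 := by
  rw [timeDeriv_congr hU h hp, spaceFDeriv_congr hU h hp, spaceFDeriv2_congr hU h hp]
  simp [timeDeriv, spaceFDeriv, spaceFDeriv2]

end Local

section Smooth

theorem hasFDerivAt_slice {F : Type*} [NormedAddCommGroup F] [NormedSpace ℝ F]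
    {g : SpaceTime d → F} {p : SpaceTime d} (hg : DifferentiableAt ℝ g p) :
    HasFDerivAt (fun x => g (p.1, x))
      ((fderiv ℝ g p).comp (ContinuousLinearMap.inr ℝ ℝ (EuclideanSpace ℝ (Fin d)))) p.2 := by
  have h1 : HasFDerivAt g (fderiv ℝ g p) ((fun x => (p.1, x)) p.2) := hg.hasFDerivAt
  exact h1.comp p.2 (hasFDerivAt_prodMk_right p.1 p.2)

theorem hasDerivAt_time {g : SpaceTime d → ℝ} {p : SpaceTime d} (hg : DifferentiableAt ℝ g p) :
    HasDerivAt (fun t => g (t, p.2)) (fderiv ℝ g p (1, 0)) p.1 := by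
  have h1 : HasFDerivAt g (fderiv ℝ g p) ((fun t : ℝ => (t, p.2)) p.1) := hg.hasFDerivAt
  exact h1.comp_hasDerivAt p.1 ((hasDerivAt_id p.1).prodMk (hasDerivAt_const p.1 p.2))

theorem isC12On_of_contDiff {m : SpaceTime d → ℝ} (hm : ContDiff ℝ ∞ m)
    (U : Set (SpaceTime d)) : IsC12On U m := by
  have hd : Differentiable ℝ m := hm.differentiable (by simp)
  have h1 : timeDeriv m = fun p => fderiv ℝ m p (1, 0) :=
    funext fun p => (hasDerivAt_time (hd p)).deriv
  have h2 : spaceFDeriv m = fun p => (fderiv ℝ m p).comp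
      (ContinuousLinearMap.inr ℝ ℝ (EuclideanSpace ℝ (Fin d))) :=
    funext fun p => (hasFDerivAt_slice (hd p)).fderiv
  have hc : ContDiff ℝ ∞ (fderiv ℝ m) := hm.fderiv_right (by simp)
  have h2' : ContDiff ℝ ∞ (spaceFDeriv m) := by
    rw [h2]; fun_prop
  have hd' : Differentiable ℝ (spaceFDeriv m) := h2'.differentiable (by simp)
  have h3 : spaceFDeriv2 m = fun p => (fderiv ℝ (spaceFDeriv m) p).comp
      (ContinuousLinearMap.inr ℝ ℝ (EuclideanSpace ℝ (Fin d))) :=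
    funext fun p => (hasFDerivAt_slice (hd' p)).fderiv
  have hc' : ContDiff ℝ ∞ (fderiv ℝ (spaceFDeriv m)) := h2'.fderiv_right (by simp)
  refine ⟨hm.continuous.continuousOn, fun p _ => (hasDerivAt_time (hd p)).differentiableAt, ?_,
    fun p _ => (hasFDerivAt_slice (hd p)).differentiableAt, h2'.continuous.continuousOn,
    fun p _ => (hasFDerivAt_slice (hd' p)).differentiableAt, ?_⟩
  · rw [h1]
    have := hc.continuous
    fun_prop
  · rw [h3]
    have := hc'.continuous
    fun_prop

end Smooth

section Compact

set_option maxSynthPendingDepth 3 in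
theorem IsC12On.isTestC {f : SpaceTime d → ℝ} (hf : IsC12On (slab d T) f) {K : Set (SpaceTime d)}
    (hK : IsCompact K) (hKs : K ⊆ slab d T) (h0 : ∀ p ∈ slab d T, p ∉ K → f p = 0) :
    IsTestC T f := by
  have hU : IsOpen (slab d T ∩ Kᶜ) := (isOpen_slab d T).inter hK.isClosed.isOpen_compl
  have hz : EqOn f (fun _ => 0) (slab d T ∩ Kᶜ) := fun p hp => h0 p hp.1 hp.2
  obtain ⟨C1, h1⟩ := hK.exists_bound_of_continuousOn (hf.cont.mono hKs)
  obtain ⟨C2, h2⟩ := hK.exists_bound_of_continuousOn (hf.cont_time.mono hKs)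
  obtain ⟨C3, h3⟩ := hK.exists_bound_of_continuousOn (hf.cont_space.mono hKs)
  obtain ⟨C4, h4⟩ := hK.exists_bound_of_continuousOn (hf.cont_space2.mono hKs)
  have a1 := le_abs_self C1
  have a2 := le_abs_self C2
  have a3 := le_abs_self C3
  have a4 := le_abs_self C4
  have b1 := abs_nonneg C1
  have b2 := abs_nonneg C2
  have b3 := abs_nonneg C3
  have b4 := abs_nonneg C4
  refine ⟨⟨hf.cont, hf.diff_time, hf.cont_time, hf.diff_space, hf.cont_space, hf.diff_space2,
    hf.cont_space2, |C1| + |C2| + |C3| + |C4|, fun p hp => ?_⟩, K, hK, hKs, h0⟩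
  by_cases hpK : p ∈ K
  · have c1 := h1 p hpK
    have c2 := h2 p hpK
    have c3 := h3 p hpK
    have c4 := h4 p hpK
    rw [Real.norm_eq_abs] at c1 c2
    refine ⟨?_, ?_, ?_, ?_⟩ <;> linarith
  · obtain ⟨e2, e3, e4⟩ := derivs_eq_zero hU hz ⟨hp, hpK⟩
    rw [h0 p hp hpK, e2, e3, e4]
    simp only [abs_zero, norm_zero]
    exact ⟨by positivity, by positivity, by positivity, by positivity⟩

theorem isTestC_of_contDiff {φ : SpaceTime d → ℝ} (hφ : ContDiff ℝ ∞ φ) (hc : HasCompactSupport φ)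
    (hs : tsupport φ ⊆ slab d T) : IsTestC T φ :=
  (isC12On_of_contDiff hφ _).isTestC hc hs fun _ _ hp => image_eq_zero_of_notMem_tsupport hp

theorem IsTestC.mul_contDiff {φ m : SpaceTime d → ℝ} (hφ : IsTestC T φ) (hm : ContDiff ℝ ∞ m) :
    IsTestC T (fun p => m p * φ p) := by
  obtain ⟨K, hK, hKs, h0⟩ := hφ.compact_supp
  exact ((isC12On_of_contDiff hm _).mul (isOpen_slab d T) hφ.isC12On).isTestC hK hKs
    fun p hp hpK => by rw [h0 p hp hpK, mul_zero]

/-- The extension by zero of a test function. -/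
theorem IsTestC.indicator {φ : SpaceTime d → ℝ} (hφ : IsTestC T φ) :
    IsC12On univ ((slab d T).indicator φ) ∧ HasCompactSupport ((slab d T).indicator φ) ∧
      tsupport ((slab d T).indicator φ) ⊆ slab d T := by
  obtain ⟨K, hK, hKs, h0⟩ := hφ.compact_supp
  have hz : ∀ p, p ∉ K → (slab d T).indicator φ p = 0 := fun p hp => by
    by_cases hps : p ∈ slab d T
    · rw [indicator_of_mem hps, h0 p hps hp]
    · rw [indicator_of_notMem hps]
  have hsub : tsupport ((slab d T).indicator φ) ⊆ K :=
    closure_minimal (fun p hp => by_contra fun h => hp (hz p h)) hK.isClosed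
  refine ⟨?_, hK.of_isClosed_subset (isClosed_tsupport _) hsub, hsub.trans hKs⟩
  -- Two open sets cover the whole space: on the slab the extension is `φ`, off `K` it is zero.
  -- Regularity is local, so it glues.
  have hu : slab d T ∪ Kᶜ = univ := by
    ext p
    by_cases hp : p ∈ K
    · simp [hKs hp]
    · simp [hp]
  rw [← hu]
  refine IsC12On.union (isOpen_slab d T) hK.isClosed.isOpen_compl
    (hφ.isC12On.congr (isOpen_slab d T) fun p hp => (indicator_of_mem hp _).symm)
    (isC12On_zero.congr hK.isClosed.isOpen_compl fun p hp => (hz p hp).symm)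

end Compact

section Shift

/-- Translation in time. -/
def timeShift (h : ℝ) (p : SpaceTime d) : SpaceTime d := (p.1 + h, p.2)

theorem timeDeriv_comp_timeShift (f : SpaceTime d → ℝ) (h : ℝ) (p : SpaceTime d) :
    timeDeriv (fun q => f (timeShift h q)) p = timeDeriv f (timeShift h p) :=
  deriv_comp_add_const (f := fun t => f (t, p.2)) h p.1

theorem spaceDeriv_comp_timeShift (f : SpaceTime d → ℝ) (h : ℝ) (i : Fin d) :
    spaceDeriv i (fun q => f (timeShift h q)) = fun p => spaceDeriv i f (timeShift h p) := rfl

theorem continuous_timeShift (h : ℝ) : Continuous (timeShift (d := d) h) := by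
  unfold timeShift; fun_prop

theorem IsC12On.comp_timeShift {f : SpaceTime d → ℝ} (hf : IsC12On univ f) (h : ℝ) :
    IsC12On univ (fun q => f (timeShift h q)) := by
  have hc := (continuous_timeShift (d := d) h).continuousOn (s := univ)
  have hm : MapsTo (timeShift (d := d) h) univ univ := mapsTo_univ _ _
  refine ⟨hf.cont.comp hc hm, fun p _ => ?_, ?_, fun p _ => hf.diff_space (timeShift h p) trivial,
    hf.cont_space.comp hc hm, fun p _ => hf.diff_space2 (timeShift h p) trivial,
    hf.cont_space2.comp hc hm⟩
  · have := (hf.diff_time (timeShift h p) trivial).comp p.1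
      ((differentiableAt_id (𝕜 := ℝ) (x := p.1)).add_const h)
    exact this
  · rw [funext (timeDeriv_comp_timeShift f h)]
    exact hf.cont_time.comp hc hm

end Shift

section Cutoff

/-- Smooth cutoffs of the interval `(0, T)`. -/
def cutoff (T : ℝ) (n : ℕ) (t : ℝ) : ℝ :=
  Real.smoothTransition (n * t - 1) * Real.smoothTransition (n * (T - t) - 1)

theorem contDiff_cutoff (n : ℕ) : ContDiff ℝ ∞ (cutoff T n) := by
  unfold cutoff
  exact (Real.smoothTransition.contDiff.comp (by fun_prop)).mul
    (Real.smoothTransition.contDiff.comp (by fun_prop))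

theorem contDiff_cutoff_fst (n : ℕ) : ContDiff ℝ ∞ (fun p : SpaceTime d => cutoff T n p.1) :=
  (contDiff_cutoff n).comp contDiff_fst

theorem cutoff_nonneg (n : ℕ) (t : ℝ) : 0 ≤ cutoff T n t :=
  mul_nonneg (Real.smoothTransition.nonneg _) (Real.smoothTransition.nonneg _)

theorem cutoff_le_one (n : ℕ) (t : ℝ) : cutoff T n t ≤ 1 :=
  mul_le_one₀ (Real.smoothTransition.le_one _) (Real.smoothTransition.nonneg _)
    (Real.smoothTransition.le_one _)

theorem cutoff_eq_zero {n : ℕ} {t : ℝ} (ht : n * t ≤ 1 ∨ n * (T - t) ≤ 1) : cutoff T n t = 0 := by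
  rcases ht with ht | ht
  · rw [cutoff, Real.smoothTransition.zero_of_nonpos (by linarith), zero_mul]
  · rw [cutoff, Real.smoothTransition.zero_of_nonpos (x := n * (T - t) - 1) (by linarith), mul_zero]

theorem cutoff_eq_one {n : ℕ} {t : ℝ} (h1 : 2 ≤ n * t) (h2 : 2 ≤ n * (T - t)) :
    cutoff T n t = 1 := by
  rw [cutoff, Real.smoothTransition.one_of_one_le (by linarith),
    Real.smoothTransition.one_of_one_le (by linarith), one_mul]

theorem eventually_cutoff_eq_one {δ : ℝ} (hδ : 0 < δ) :
    ∀ᶠ n : ℕ in atTop, ∀ t, δ ≤ t → t ≤ T - δ → cutoff T n t = 1 := by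
  obtain ⟨N, hN⟩ := exists_nat_ge (2 / δ)
  filter_upwards [eventually_ge_atTop N] with n hn t h1 h2
  have h3 : 2 / δ ≤ n := hN.trans (by exact_mod_cast hn)
  rw [div_le_iff₀ hδ] at h3
  have h4 : (0 : ℝ) ≤ n := Nat.cast_nonneg n
  exact cutoff_eq_one (by nlinarith) (by nlinarith)

theorem tendsto_cutoff {t : ℝ} (ht : t ∈ Ioo 0 T) :
    Tendsto (fun n => cutoff T n t) atTop (𝓝 1) := by
  have hδ : 0 < min t (T - t) := lt_min ht.1 (sub_pos.2 ht.2)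
  refine tendsto_const_nhds.congr' ?_
  filter_upwards [eventually_cutoff_eq_one (T := T) hδ] with n hn
  exact (hn t (min_le_left _ _) (by linarith [min_le_right t (T - t)])).symm

/-- A compactly supported function becomes a test function on the slab after a cutoff in time. -/
theorem IsC12On.cutoff_isTestC {ψ : SpaceTime d → ℝ} (hψ : IsC12On univ ψ)
    (hc : HasCompactSupport ψ) {n : ℕ} (hn : 0 < n) :
    IsTestC T (fun p => cutoff T n p.1 * ψ p) := by
  have hn' : (0 : ℝ) < n := by exact_mod_cast hn
  refine ((((isC12On_of_contDiff (contDiff_cutoff_fst n) univ).mul isOpen_univ hψ)).mono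
    (subset_univ _)).isTestC (K := tsupport ψ ∩ {p | (n : ℝ)⁻¹ ≤ p.1 ∧ p.1 ≤ T - (n : ℝ)⁻¹}) ?_ ?_ ?_
  · refine hc.isCompact.inter_right ?_
    exact (isClosed_le continuous_const continuous_fst).inter
      (isClosed_le continuous_fst continuous_const)
  · rintro p ⟨-, h1, h2⟩
    have : 0 < (n : ℝ)⁻¹ := by positivity
    exact ⟨⟨by linarith, by linarith⟩, trivial⟩
  · intro p _ hp
    by_cases h1 : p ∈ tsupport ψ
    · rw [cutoff_eq_zero, zero_mul]
      by_contra! h2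
      refine hp ⟨h1, ?_, ?_⟩
      · rw [inv_le_iff_one_le_mul₀ hn']; nlinarith [h2.1]
      · rw [le_sub_comm, inv_le_iff_one_le_mul₀ hn']; nlinarith [h2.2]
    · rw [image_eq_zero_of_notMem_tsupport h1, mul_zero]

theorem exists_time_margin {K : Set (SpaceTime d)} (hK : IsCompact K)
    (hKs : K ⊆ slab d T) : ∃ δ > 0, ∀ p ∈ K, δ ≤ p.1 ∧ p.1 ≤ T - δ := by
  rcases K.eq_empty_or_nonempty with rfl | hne
  · exact ⟨1, one_pos, by simp⟩
  obtain ⟨p, hp, hpm⟩ := hK.exists_isMinOn hne (f := fun p => min p.1 (T - p.1))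
    (Continuous.continuousOn (by fun_prop))
  refine ⟨min p.1 (T - p.1), lt_min (hKs hp).1.1 (sub_pos.2 (hKs hp).1.2), fun q hq => ?_⟩
  have : min p.1 (T - p.1) ≤ min q.1 (T - q.1) := hpm hq
  exact ⟨this.trans (min_le_left _ _), by linarith [this.trans (min_le_right _ _)]⟩

end Cutoff

end TimeCommutator

/-! ### The weak spatial gradient and translations in time. -/

namespace TimeCommutator

open scoped ContDiff InnerProductSpace

variable {d : ℕ} {T : ℝ}

instance : (volume : Measure (SpaceTime d)).IsAddHaarMeasure := by
  rw [Measure.volume_eq_prod]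
  infer_instance

theorem integral_slab_eq {k k' : SpaceTime d → ℝ} (h : EqOn k k' (slab d T))
    (h0 : ∀ p, p ∉ slab d T → k' p = 0) : ∫ p, k p ∂(slabMeasure d T) = ∫ p, k' p := by
  rw [slabMeasure, setIntegral_congr_fun (measurableSet_slab d T) h,
    setIntegral_eq_integral_of_forall_compl_eq_zero h0]

theorem spaceDeriv_eq_zero {U : Set (SpaceTime d)} (hU : IsOpen U) {f : SpaceTime d → ℝ}
    (h : EqOn f (fun _ => 0) U) (i : Fin d) {p : SpaceTime d} (hp : p ∈ U) :
    spaceDeriv i f p = 0 := by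
  simp [spaceDeriv, (derivs_eq_zero hU h hp).2.1]

section CompactSupport

variable {ψ χ : SpaceTime d → ℝ}

theorem timeDeriv_eq_zero_of_notMem_tsupport {p : SpaceTime d} (hp : p ∉ tsupport ψ) :
    timeDeriv ψ p = 0 :=
  (derivs_eq_zero (isClosed_tsupport ψ).isOpen_compl
    (fun _ hq => image_eq_zero_of_notMem_tsupport hq) hp).1

theorem spaceDeriv_eq_zero_of_notMem_tsupport (i : Fin d) {p : SpaceTime d} (hp : p ∉ tsupport ψ) :
    spaceDeriv i ψ p = 0 :=
  spaceDeriv_eq_zero (isClosed_tsupport ψ).isOpen_compl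
    (fun _ hq => image_eq_zero_of_notMem_tsupport hq) i hp

theorem IsC12On.continuous (h : IsC12On univ ψ) : Continuous ψ := continuousOn_univ.1 h.cont

theorem IsC12On.continuous_timeDeriv (h : IsC12On univ ψ) : Continuous (timeDeriv ψ) :=
  continuousOn_univ.1 h.cont_time

theorem IsC12On.continuous_spaceDeriv (h : IsC12On univ ψ) (i : Fin d) :
    Continuous (spaceDeriv i ψ) :=
  (continuousOn_univ.1 h.cont_space).clm_apply continuous_const

theorem hasCompactSupport_timeDeriv (hc : HasCompactSupport ψ) :
    HasCompactSupport (timeDeriv ψ) :=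
  HasCompactSupport.intro hc fun _ hp => timeDeriv_eq_zero_of_notMem_tsupport hp

theorem hasCompactSupport_spaceDeriv (hc : HasCompactSupport ψ) (i : Fin d) :
    HasCompactSupport (spaceDeriv i ψ) :=
  HasCompactSupport.intro hc fun _ hp => spaceDeriv_eq_zero_of_notMem_tsupport i hp

theorem memLp_of_compact (h : Continuous ψ) (hc : HasCompactSupport ψ) :
    MemLp ψ 2 (slabMeasure d T) :=
  (h.memLp_of_hasCompactSupport hc).restrict _

theorem integrable_mul_of_memLp {α : Type*} {m : MeasurableSpace α} {μ : Measure α} {f g : α → ℝ}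
    (hf : MemLp f 2 μ) (hg : MemLp g 2 μ) : Integrable (fun p => f p * g p) μ :=
  MemLp.integrable_mul hf hg

theorem integral_mul_spaceDeriv (hψ : IsC12On univ ψ) (hψc : HasCompactSupport ψ)
    (hχ : IsC12On univ χ) (i : Fin d) :
    ∫ p, ψ p * spaceDeriv i χ p = - ∫ p, spaceDeriv i ψ p * χ p := by
  have hl : ∀ {f : SpaceTime d → ℝ}, IsC12On univ f → ∀ p, HasLineDerivAt ℝ f (spaceDeriv i f p) p
      (0, EuclideanSpace.single i 1) := by
    intro f hf p
    have h1 := (hf.diff_space p trivial).hasFDerivAt.hasLineDerivAt (EuclideanSpace.single i 1)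
    have h2 : ∀ t : ℝ, p + t • ((0 : ℝ), EuclideanSpace.single i (1 : ℝ)) =
      (p.1, p.2 + t • EuclideanSpace.single i (1 : ℝ)) := fun t => by ext <;> simp
    unfold HasLineDerivAt at h1 ⊢
    simp only [h2]
    exact h1
  have := integral_bilinear_hasLineDerivAt_right_eq_neg_left_of_integrable (μ := volume)
    (B := ContinuousLinearMap.mul ℝ ℝ) (f := ψ) (g := χ)
    (v := ((0 : ℝ), EuclideanSpace.single i (1 : ℝ)))
    (((hψ.continuous_spaceDeriv i).mul hχ.continuous).integrable_of_hasCompactSupport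
      (hasCompactSupport_spaceDeriv hψc i).mul_right)
    ((hψ.continuous.mul (hχ.continuous_spaceDeriv i)).integrable_of_hasCompactSupport hψc.mul_right)
    ((hψ.continuous.mul hχ.continuous).integrable_of_hasCompactSupport hψc.mul_right)
    (fun p _ => hl hψ p) (fun p _ => hl hχ p)
  simpa using this

end CompactSupport

section TestC

variable {φ : SpaceTime d → ℝ}

theorem ae_mem_slab : ∀ᵐ p ∂(slabMeasure d T), p ∈ slab d T :=
  ae_restrict_mem (measurableSet_slab d T)

theorem ae_of_forall_slab {P : SpaceTime d → Prop} (h : ∀ p ∈ slab d T, P p) :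
    ∀ᵐ p ∂(slabMeasure d T), P p :=
  ae_mem_slab.mono h

theorem eqOn_indicator (φ : SpaceTime d → ℝ) : EqOn ((slab d T).indicator φ) φ (slab d T) :=
  fun _ hp => indicator_of_mem hp _

theorem IsTestC.memLp_timeDeriv (hφ : IsTestC T φ) : MemLp (timeDeriv φ) 2 (slabMeasure d T) :=
  (memLp_of_compact hφ.indicator.1.continuous_timeDeriv
    (hasCompactSupport_timeDeriv hφ.indicator.2.1)).ae_eq
    (ae_of_forall_slab (timeDeriv_congr (isOpen_slab d T) (eqOn_indicator φ)))

theorem IsTestC.memLp_spaceDeriv (hφ : IsTestC T φ) (i : Fin d) :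
    MemLp (spaceDeriv i φ) 2 (slabMeasure d T) :=
  (memLp_of_compact (hφ.indicator.1.continuous_spaceDeriv i)
    (hasCompactSupport_spaceDeriv hφ.indicator.2.1 i)).ae_eq
    (ae_of_forall_slab (spaceDeriv_congr (isOpen_slab d T) (eqOn_indicator φ) i))

theorem IsTestC.memLp_smul_single (hφ : IsTestC T φ) (i : Fin d) :
    MemLp (fun p => φ p • (EuclideanSpace.single i 1 : EuclideanSpace ℝ (Fin d))) 2
      (slabMeasure d T) := by
  refine hφ.memLp.of_le (hφ.memLp.1.smul_const _) (Eventually.of_forall fun p => ?_)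
  simp [norm_smul]

theorem L2Vec.memLp_apply (F : L2Vec d T) (i : Fin d) :
    MemLp (fun p => F p i) 2 (slabMeasure d T) := by
  have := (Lp.memLp F).const_inner (𝕜 := ℝ) (EuclideanSpace.single i 1)
  simpa [EuclideanSpace.inner_single_left] using this

theorem inner_toLp_eq_integral {f : SpaceTime d → ℝ} (hf : MemLp f 2 (slabMeasure d T))
    (g : L2 d T) : ⟪hf.toLp f, g⟫_ℝ = ∫ p, f p * g p ∂(slabMeasure d T) := by
  rw [L2.inner_def]
  refine integral_congr_ae ?_
  filter_upwards [hf.coeFn_toLp] with p hp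
  rw [hp, real_inner_eq_re_inner]
  simp [mul_comm]

theorem L2.inner_eq_integral (f g : L2 d T) : ⟪f, g⟫_ℝ = ∫ p, f p * g p ∂(slabMeasure d T) := by
  rw [MeasureTheory.L2.inner_def]
  refine integral_congr_ae (Eventually.of_forall fun p => ?_)
  simp [mul_comm]

theorem IsTestC.inner_smul_single (hφ : IsTestC T φ) (i : Fin d) (F : L2Vec d T) :
    ⟪(hφ.memLp_smul_single i).toLp _, F⟫_ℝ = ∫ p, φ p * F p i ∂(slabMeasure d T) := by
  rw [MeasureTheory.L2.inner_def]
  refine integral_congr_ae ?_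
  filter_upwards [(hφ.memLp_smul_single i).coeFn_toLp] with p hp
  rw [hp, real_inner_smul_left]
  simp [EuclideanSpace.inner_single_left]

theorem isWeakGrad_iff {f : L2 d T} {F : L2Vec d T} : IsWeakGrad f F ↔
    ∀ (φ : SpaceTime d → ℝ) (hφ : IsTestC T φ) (i : Fin d),
      ⟪(hφ.memLp_spaceDeriv i).toLp _, f⟫_ℝ + ⟪(hφ.memLp_smul_single i).toLp _, F⟫_ℝ = 0 := by
  refine forall₃_congr fun φ hφ i => ?_
  rw [hφ.inner_smul_single, inner_toLp_eq_integral, eq_neg_iff_add_eq_zero]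

variable (d T) in
/-- The graph of the weak gradient in space. -/
def gradGraph : Submodule ℝ (WithLp 2 (L2 d T × L2Vec d T)) where
  carrier := {v | IsWeakGrad v.fst v.snd}
  add_mem' {v w} hv hw := by
    simp only [Set.mem_ofPred_eq, isWeakGrad_iff] at hv hw ⊢
    intro φ hφ i
    rw [WithLp.add_fst, WithLp.add_snd, inner_add_right, inner_add_right]
    linarith [hv φ hφ i, hw φ hφ i]
  zero_mem' := by
    simp only [Set.mem_ofPred_eq, isWeakGrad_iff]
    simp
  smul_mem' c v hv := by
    simp only [Set.mem_ofPred_eq, isWeakGrad_iff] at hv ⊢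
    intro φ hφ i
    rw [WithLp.smul_fst, WithLp.smul_snd, real_inner_smul_right, real_inner_smul_right, ← mul_add,
      hv φ hφ i, mul_zero]

/-- Each test function and each index impose one continuous linear condition. Closedness makes the
graph a Hilbert space for the `L²` product norm, the setting of Lax–Milgram. -/
theorem isClosed_gradGraph : IsClosed (gradGraph d T : Set (WithLp 2 (L2 d T × L2Vec d T))) := by
  have : (gradGraph d T : Set (WithLp 2 (L2 d T × L2Vec d T))) =
      ⋂ (φ : SpaceTime d → ℝ) (hφ : IsTestC T φ) (i : Fin d), {v | ⟪(hφ.memLp_spaceDeriv i).toLp _,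
        v.fst⟫_ℝ + ⟪(hφ.memLp_smul_single i).toLp _, v.snd⟫_ℝ = 0} := by
    ext v
    simp only [mem_iInter]
    exact isWeakGrad_iff
  rw [this]
  refine isClosed_iInter fun φ => isClosed_iInter fun hφ => isClosed_iInter fun i => ?_
  refine isClosed_eq ?_ continuous_const
  exact (continuous_const.inner (WithLp.prod_continuous_ofLp 2 _ _).fst).add
    (continuous_const.inner (WithLp.prod_continuous_ofLp 2 _ _).snd)

theorem IsWeakGrad.add {f g : L2 d T} {F G : L2Vec d T} (hf : IsWeakGrad f F)
    (hg : IsWeakGrad g G) : IsWeakGrad (f + g) (F + G) :=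
  (gradGraph d T).add_mem (x := WithLp.toLp 2 (f, F)) (y := WithLp.toLp 2 (g, G)) hf hg

theorem IsWeakGrad.smul {f : L2 d T} {F : L2Vec d T} (c : ℝ) (hf : IsWeakGrad f F) :
    IsWeakGrad (c • f) (c • F) :=
  (gradGraph d T).smul_mem (x := WithLp.toLp 2 (f, F)) c hf

theorem isWeakGrad_zero : IsWeakGrad (0 : L2 d T) (0 : L2Vec d T) := (gradGraph d T).zero_mem

/-- Smooth functions with compact support determine a function on the slab. -/
theorem ae_eq_zero_of_test {f : SpaceTime d → ℝ} (hf : MemLp f 2 (slabMeasure d T))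
    (h : ∀ φ : SpaceTime d → ℝ, ContDiff ℝ ∞ φ → HasCompactSupport φ → tsupport φ ⊆ slab d T →
      ∫ p, φ p * f p ∂(slabMeasure d T) = 0) : f =ᵐ[slabMeasure d T] 0 := by
  have hm : MemLp ((slab d T).indicator f) 2 volume :=
    (memLp_indicator_iff_restrict (measurableSet_slab d T)).2 hf
  have := (isOpen_slab d T).ae_eq_zero_of_integral_contDiff_smul_eq_zero (μ := volume)
    (f := (slab d T).indicator f)
    ((hm.locallyIntegrable (by norm_num)).locallyIntegrableOn _) (fun φ h1 h2 h3 => ?_)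
  · filter_upwards [ae_restrict_of_ae this, ae_mem_slab] with p hp hps
    have := hp hps
    rwa [indicator_of_mem hps] at this
  · rw [← h φ h1 h2 h3]
    refine (integral_slab_eq (fun p hp => ?_) fun p hp => ?_).symm
    · simp [hp]
    · simp [hp]

theorem IsWeakGrad.unique_zero {F : L2Vec d T} (h : IsWeakGrad (0 : L2 d T) F) : F = 0 := by
  have h1 : ∀ i : Fin d, (fun p => F p i) =ᵐ[slabMeasure d T] 0 := by
    refine fun i => ae_eq_zero_of_test (L2Vec.memLp_apply F i) fun φ h1 h2 h3 => ?_
    have hφ := isTestC_of_contDiff h1 h2 h3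
    have := isWeakGrad_iff.1 h φ hφ i
    rwa [inner_zero_right, zero_add, hφ.inner_smul_single] at this
  refine Lp.ext ?_
  filter_upwards [ae_all_iff.2 h1, Lp.coeFn_zero (EuclideanSpace ℝ (Fin d)) 2 (slabMeasure d T)]
    with p hp h0
  rw [h0]
  ext i
  simpa using hp i

/-- This supplies enough members of the form domain to separate points of `L²`, so that `Δ_a f` is
determined by the form. -/
theorem exists_isWeakGrad_of_contDiff {φ : SpaceTime d → ℝ} (h1 : ContDiff ℝ ∞ φ)
    (h2 : HasCompactSupport φ) (hm : MemLp φ 2 (slabMeasure d T)) :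
    ∃ G : L2Vec d T, IsWeakGrad (hm.toLp φ) G := by
  have hφ := isC12On_of_contDiff h1 univ
  let G : SpaceTime d → EuclideanSpace ℝ (Fin d) := fun p => WithLp.toLp 2 fun i => spaceDeriv i φ p
  have hGc : Continuous G :=
    (PiLp.continuous_toLp 2 _).comp (continuous_pi fun i => hφ.continuous_spaceDeriv i)
  have hGs : HasCompactSupport G := HasCompactSupport.intro h2 fun p hp => by
    ext i
    simpa [G] using spaceDeriv_eq_zero_of_notMem_tsupport i hp
  have hGm : MemLp G 2 (slabMeasure d T) := (hGc.memLp_of_hasCompactSupport hGs).restrict _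
  refine ⟨hGm.toLp G, fun ψ hψ i => ?_⟩
  obtain ⟨ψ1, ψ2, ψ3⟩ := hψ.indicator
  have key := integral_mul_spaceDeriv ψ1 ψ2 hφ i
  have e1 : ∫ p, spaceDeriv i ψ p * hm.toLp φ p ∂(slabMeasure d T) =
      ∫ p, spaceDeriv i ((slab d T).indicator ψ) p * φ p := by
    rw [integral_congr_ae (g := fun p => spaceDeriv i ψ p * φ p)
      (hm.coeFn_toLp.mono fun p hp => by simp only [hp])]
    refine integral_slab_eq (fun p hp => ?_) fun p hp => ?_
    · simp only [spaceDeriv_congr (isOpen_slab d T) (eqOn_indicator ψ) i hp]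
    · rw [spaceDeriv_eq_zero_of_notMem_tsupport i (fun h => hp (ψ3 h)), zero_mul]
  have e2 : ∫ p, ψ p * hGm.toLp G p i ∂(slabMeasure d T) =
      ∫ p, (slab d T).indicator ψ p * spaceDeriv i φ p := by
    rw [integral_congr_ae (g := fun p => ψ p * spaceDeriv i φ p)
      (hGm.coeFn_toLp.mono fun p hp => by simp only [hp, G])]
    refine integral_slab_eq (fun p hp => ?_) fun p hp => ?_
    · simp [hp]
    · simp [hp]
  rw [e1, e2, key, neg_neg]

theorem eq_zero_of_integral_formDomain {k : L2 d T} (h : ∀ (g : L2 d T) (G : L2Vec d T),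
    IsWeakGrad g G → ∫ p, k p * g p ∂(slabMeasure d T) = 0) : k = 0 := by
  refine Lp.ext ((ae_eq_zero_of_test (Lp.memLp k) fun φ h1 h2 h3 => ?_).trans
    (Lp.coeFn_zero _ _ _).symm)
  have hm := (isTestC_of_contDiff h1 h2 h3).memLp
  obtain ⟨G, hG⟩ := exists_isWeakGrad_of_contDiff h1 h2 hm
  rw [← h _ G hG]
  refine integral_congr_ae (hm.coeFn_toLp.mono fun p hp => ?_)
  simp only [hp, mul_comm]

/-- Product rule for the weak gradient. -/
theorem IsWeakGrad.mul {f f' : L2 d T} {F F' : L2Vec d T} (hf : IsWeakGrad f F)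
    {m : SpaceTime d → ℝ} (hm : ContDiff ℝ ∞ m)
    (hf' : f' =ᵐ[slabMeasure d T] fun p => m p * f p)
    (hF' : ∀ i, ∀ᵐ p ∂(slabMeasure d T), F' p i = m p * F p i + f p * spaceDeriv i m p) :
    IsWeakGrad f' F' := by
  intro φ hφ i
  have hmφ := hφ.mul_contDiff hm
  have i1 := integrable_mul_of_memLp (hφ.memLp_spaceDeriv i) (Lp.memLp f')
  have i2 := integrable_mul_of_memLp (hmφ.memLp_spaceDeriv i) (Lp.memLp f)
  have i3 := integrable_mul_of_memLp hφ.memLp (L2Vec.memLp_apply F' i)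
  have i4 := integrable_mul_of_memLp hmφ.memLp (L2Vec.memLp_apply F i)
  have key := hf _ hmφ i
  have e : (fun p => spaceDeriv i φ p * f' p + φ p * F' p i) =ᵐ[slabMeasure d T]
      fun p => spaceDeriv i (fun q => m q * φ q) p * f p + m p * φ p * F p i := by
    filter_upwards [hf', hF' i, ae_mem_slab] with p h1 h2 hp
    rw [h1, h2, spaceDeriv_mul (isC12On_of_contDiff hm _) hφ.isC12On i hp]
    ring
  have e' := integral_congr_ae e
  rw [integral_add i1 i3, integral_add i2 i4, key, neg_add_cancel] at e'
  linarith

/-- Test functions need not vanish near `t = 0` and `t = T`: a cutoff in time passes through the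
spatial derivative untouched and is removed by dominated convergence. -/
theorem IsWeakGrad.integral_compactSupport {f : L2 d T} {F : L2Vec d T} (hf : IsWeakGrad f F)
    {ψ : SpaceTime d → ℝ} (h1 : IsC12On univ ψ) (h2 : HasCompactSupport ψ) (i : Fin d) :
    ∫ p, spaceDeriv i ψ p * f p ∂(slabMeasure d T) = - ∫ p, ψ p * F p i ∂(slabMeasure d T) := by
  have key : ∀ n : ℕ, ∫ p, cutoff T (n + 1) p.1 * (spaceDeriv i ψ p * f p) ∂(slabMeasure d T) =
      - ∫ p, cutoff T (n + 1) p.1 * (ψ p * F p i) ∂(slabMeasure d T) := by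
    intro n
    have := hf _ (h1.cutoff_isTestC h2 (T := T) n.succ_pos) i
    simp only [mul_assoc] at this
    rw [← this]
    refine integral_congr_ae (Eventually.of_forall fun p => ?_)
    have h0 : spaceDeriv i (fun q : SpaceTime d => cutoff T (n + 1) q.1) p = 0 := by
      simp [spaceDeriv, spaceFDeriv]
    simp only
    rw [spaceDeriv_mul (isC12On_of_contDiff (contDiff_cutoff_fst (n + 1)) univ) h1 i trivial, h0]
    ring
  have lim : ∀ {k : SpaceTime d → ℝ}, Integrable k (slabMeasure d T) → Tendsto (fun n : ℕ =>
      ∫ p, cutoff T (n + 1) p.1 * k p ∂(slabMeasure d T)) atTop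
      (𝓝 (∫ p, k p ∂(slabMeasure d T))) := by
    intro k hk
    refine tendsto_integral_of_dominated_convergence (fun p => ‖k p‖) (fun n => ?_) hk.norm
      (fun n => ?_) ?_
    · exact (contDiff_cutoff_fst (n + 1)).continuous.aestronglyMeasurable.mul hk.1
    · refine Eventually.of_forall fun p => ?_
      rw [norm_mul, Real.norm_of_nonneg (cutoff_nonneg _ _)]
      exact mul_le_of_le_one_left (norm_nonneg _) (cutoff_le_one _ _)
    · filter_upwards [ae_mem_slab] with p hp
      simpa using ((tendsto_cutoff hp.1).comp (tendsto_add_atTop_nat 1)).mul_const (k p)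
  have l1 := lim (integrable_mul_of_memLp (memLp_of_compact (h1.continuous_spaceDeriv i)
    (hasCompactSupport_spaceDeriv h2 i)) (Lp.memLp f))
  have l2 := lim (integrable_mul_of_memLp (memLp_of_compact h1.continuous h2)
    (L2Vec.memLp_apply F i))
  simp only [key] at l1
  exact tendsto_nhds_unique l1 l2.neg

end TestC

section ShiftOperator

variable {V : Type*} [NormedAddCommGroup V]

theorem measurePreserving_timeShift (h : ℝ) :
    MeasurePreserving (timeShift (d := d) h) volume volume := by
  have : timeShift (d := d) h = fun p => p + (h, 0) := by
    ext p <;> simp [timeShift]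
  rw [this]
  exact measurePreserving_add_right volume _

theorem timeShift_timeShift (h k : ℝ) (p : SpaceTime d) :
    timeShift h (timeShift k p) = timeShift (k + h) p := by
  simp [timeShift, add_assoc]

@[simp] theorem timeShift_zero (p : SpaceTime d) : timeShift 0 p = p := by simp [timeShift]

theorem integral_comp_timeShift (h : ℝ) (k : SpaceTime d → ℝ) :
    ∫ p, k (timeShift h p) = ∫ p, k p := by
  have : timeShift (d := d) h = fun p => p + (h, 0) := by
    ext p <;> simp [timeShift]
  rw [this]
  exact integral_add_right_eq_self k _

/-- Change of variables for translations inside the slab. -/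
theorem integral_indicator_timeShift (h : ℝ) (k : SpaceTime d → ℝ) :
    ∫ p, (slab d T).indicator k (timeShift h p) ∂(slabMeasure d T) =
      ∫ p, (slab d T).indicator 1 (timeShift (-h) p) * k p ∂(slabMeasure d T) := by
  have e1 : ∫ p, (slab d T).indicator k (timeShift h p) ∂(slabMeasure d T) =
      ∫ p, (slab d T).indicator 1 p * (slab d T).indicator k (timeShift h p) :=
    integral_slab_eq (fun p hp => by simp [hp]) (fun p hp => by simp [hp])
  have e2 : ∫ p, (slab d T).indicator 1 (timeShift (-h) p) * k p ∂(slabMeasure d T) =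
      ∫ p, (slab d T).indicator 1 (timeShift (-h) p) * (slab d T).indicator k p :=
    integral_slab_eq (fun p hp => by simp [hp]) (fun p hp => by simp [hp])
  rw [e1, e2, ← integral_comp_timeShift h fun p =>
    (slab d T).indicator 1 (timeShift (-h) p) * (slab d T).indicator k p]
  simp [timeShift_timeShift]

theorem memLp_shift (h : ℝ) (f : Lp V 2 (slabMeasure d T)) :
    MemLp (fun p => (slab d T).indicator f (timeShift h p)) 2 (slabMeasure d T) :=
  ((((memLp_indicator_iff_restrict (measurableSet_slab d T)).2 (Lp.memLp f)).comp_measurePreserving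
    (measurePreserving_timeShift h))).restrict _

/-- Translation in time of the extension by zero, restricted to the slab. -/
def shift (h : ℝ) (f : Lp V 2 (slabMeasure d T)) : Lp V 2 (slabMeasure d T) :=
  (memLp_shift h f).toLp _

theorem coeFn_shift (h : ℝ) (f : Lp V 2 (slabMeasure d T)) :
    shift h f =ᵐ[slabMeasure d T] fun p => (slab d T).indicator f (timeShift h p) :=
  (memLp_shift h f).coeFn_toLp

theorem norm_shift_le (h : ℝ) (f : Lp V 2 (slabMeasure d T)) : ‖shift h f‖ ≤ ‖f‖ := by
  rw [shift, Lp.norm_toLp, Lp.norm_def]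
  refine ENNReal.toReal_mono (Lp.memLp f).2.ne ?_
  calc eLpNorm (fun p => (slab d T).indicator f (timeShift h p)) 2 (slabMeasure d T)
      ≤ eLpNorm ((slab d T).indicator f ∘ timeShift h) 2 volume :=
        eLpNorm_mono_measure _ Measure.restrict_le_self
    _ = eLpNorm ((slab d T).indicator f) 2 volume :=
        eLpNorm_comp_measurePreserving
          ((memLp_indicator_iff_restrict (measurableSet_slab d T)).2 (Lp.memLp f)).1
          (measurePreserving_timeShift h)
    _ = eLpNorm f 2 (slabMeasure d T) := eLpNorm_indicator_eq_eLpNorm_restrict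
        (measurableSet_slab d T)

/-- Translation by `h`, compressed to the slab by zero extension and restriction, has translation by
`-h` as its adjoint. -/
theorem inner_shift (h : ℝ) (f g : L2 d T) : ⟪shift h f, g⟫_ℝ = ⟪f, shift (-h) g⟫_ℝ := by
  rw [L2.inner_eq_integral, L2.inner_eq_integral]
  have e1 : ∫ p, shift h f p * g p ∂(slabMeasure d T) =
      ∫ p, (slab d T).indicator (fun q => f q * (slab d T).indicator g (timeShift (-h) q))
        (timeShift h p) ∂(slabMeasure d T) := by
    refine integral_congr_ae ?_
    filter_upwards [coeFn_shift h f, ae_mem_slab] with p hp hps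
    rw [hp]
    by_cases hq : timeShift h p ∈ slab d T
    · simp [hq, timeShift_timeShift, hps]
    · simp [hq]
  rw [e1, integral_indicator_timeShift]
  refine integral_congr_ae ?_
  filter_upwards [coeFn_shift (-h) g] with p hp
  rw [hp]
  by_cases hq : timeShift (-h) p ∈ slab d T
  · simp [hq]
  · simp [hq]

/-- Moving the translation onto the test function may push its support through the ends of the time
interval, which `IsWeakGrad.integral_compactSupport` permits. So the jump in time of the zero
extension costs nothing, and translates are admissible in the form. -/
theorem IsWeakGrad.shift {f : L2 d T} {F : L2Vec d T} (hf : IsWeakGrad f F) (h : ℝ) :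
    IsWeakGrad (shift h f) (shift h F) := by
  intro φ hφ i
  obtain ⟨φ1, φ2, φ3⟩ := hφ.indicator
  set ψ := (slab d T).indicator φ with hψ
  have c1 := φ1.comp_timeShift (-h)
  have c2 : HasCompactSupport (fun p => ψ (timeShift (-h) p)) := by
    have : timeShift (d := d) (-h) = Homeomorph.addRight ((-h, 0) : SpaceTime d) := by
      ext p <;> simp [timeShift]
    have h2 := φ2.comp_homeomorph (Homeomorph.addRight ((-h, 0) : SpaceTime d))
    rw [← this] at h2
    exact h2
  have key := hf.integral_compactSupport c1 c2 i
  rw [spaceDeriv_comp_timeShift] at key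
  have e1 : ∫ p, spaceDeriv i φ p * TimeCommutator.shift h f p ∂(slabMeasure d T) =
      ∫ p, (slab d T).indicator (fun q => spaceDeriv i ψ (timeShift (-h) q) * f q)
        (timeShift h p) ∂(slabMeasure d T) := by
    refine integral_congr_ae ?_
    filter_upwards [coeFn_shift h f, ae_mem_slab] with p hp hps
    rw [hp, ← spaceDeriv_congr (isOpen_slab d T) (eqOn_indicator φ) i hps]
    by_cases hq : timeShift h p ∈ slab d T
    · simp [hq, timeShift_timeShift, hψ]
    · simp [hq]
  have e2 : ∫ p, φ p * TimeCommutator.shift h F p i ∂(slabMeasure d T) =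
      ∫ p, (slab d T).indicator (fun q => ψ (timeShift (-h) q) * F q i)
        (timeShift h p) ∂(slabMeasure d T) := by
    refine integral_congr_ae ?_
    filter_upwards [coeFn_shift h F, ae_mem_slab] with p hp hps
    rw [hp, ← eqOn_indicator φ hps]
    by_cases hq : timeShift h p ∈ slab d T
    · simp [hq, timeShift_timeShift, hψ]
    · simp [hq]
  rw [e1, e2, integral_indicator_timeShift, integral_indicator_timeShift]
  convert key using 2
  · ext p
    by_cases hq : timeShift (-h) p ∈ slab d T
    · simp [hq]
    · simp [spaceDeriv_eq_zero_of_notMem_tsupport i (fun h => hq (φ3 h))]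
  · congr 1
    ext p
    by_cases hq : timeShift (-h) p ∈ slab d T
    · simp [hq]
    · simp [hψ, hq]

end ShiftOperator

end TimeCommutator

/-! ### The form of `a` on vector fields and its resolvents. -/

namespace TimeCommutator

open scoped InnerProductSpace

variable {d : ℕ} {T : ℝ}

section MatForm

variable (A : Matrix (Fin d) (Fin d) ℝ) (v w v' : EuclideanSpace ℝ (Fin d))

theorem matForm_add_left : matForm A (v + v') w = matForm A v w + matForm A v' w := by
  simp only [matForm, PiLp.add_apply, mul_add, add_mul, Finset.sum_add_distrib]

theorem matForm_add_right : matForm A w (v + v') = matForm A w v + matForm A w v' := by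
  simp only [matForm, PiLp.add_apply, mul_add, Finset.sum_add_distrib]

theorem matForm_smul_left (c : ℝ) : matForm A (c • v) w = c * matForm A v w := by
  simp only [matForm, PiLp.smul_apply, smul_eq_mul, Finset.mul_sum]
  exact Finset.sum_congr rfl fun i _ => Finset.sum_congr rfl fun j _ => by ring

theorem matForm_smul_right (c : ℝ) : matForm A v (c • w) = c * matForm A v w := by
  simp only [matForm, PiLp.smul_apply, smul_eq_mul, Finset.mul_sum]
  exact Finset.sum_congr rfl fun i _ => Finset.sum_congr rfl fun j _ => by ring

@[simp] theorem matForm_zero_left : matForm A 0 w = 0 := by simp [matForm]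

@[simp] theorem matForm_zero_right : matForm A v 0 = 0 := by simp [matForm]

variable {A} in
theorem matForm_comm (hA : A.IsSymm) : matForm A v w = matForm A w v := by
  simp only [matForm]
  rw [Finset.sum_comm]
  refine Finset.sum_congr rfl fun i _ => Finset.sum_congr rfl fun j _ => ?_
  rw [hA.apply]
  ring

/-- Cauchy–Schwarz over pairs of indices, between `A` and the rank-one matrix `v ⊗ w`. -/
theorem abs_matForm_le : |matForm A v w| ≤ matNorm A * ‖v‖ * ‖w‖ := by
  have h1 : matForm A v w = ∑ x : Fin d × Fin d, A x.1 x.2 * (v x.1 * w x.2) := by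
    rw [Fintype.sum_prod_type]
    simp only [matForm, mul_assoc]
  have h2 : ∑ x : Fin d × Fin d, (v x.1 * w x.2) ^ 2 = (‖v‖ * ‖w‖) ^ 2 := by
    rw [mul_pow, EuclideanSpace.norm_sq_eq, EuclideanSpace.norm_sq_eq, Fintype.sum_mul_sum,
      Fintype.sum_prod_type]
    simp only [mul_pow, Real.norm_eq_abs, sq_abs]
  have h3 : ∑ x : Fin d × Fin d, A x.1 x.2 ^ 2 = matNorm A ^ 2 := by
    rw [matNorm, Real.sq_sqrt (by positivity), Fintype.sum_prod_type]
  have h4 := Finset.sum_mul_sq_le_sq_mul_sq Finset.univ (fun x : Fin d × Fin d => A x.1 x.2)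
    (fun x => v x.1 * w x.2)
  rw [h2, h3, ← h1, ← mul_pow] at h4
  rw [mul_assoc]
  exact abs_le_of_sq_le_sq h4 (mul_nonneg (Real.sqrt_nonneg _) (by positivity))

end MatForm

/-- Measurable matrix fields on the slab whose bilinear forms are bounded by `C`. -/
structure IsBoundedField (T : ℝ) (A : SpaceTime d → Matrix (Fin d) (Fin d) ℝ) (C : ℝ) : Prop where
  meas : ∀ i j, AEStronglyMeasurable (fun p => A p i j) (slabMeasure d T)
  bound : ∀ᵐ p ∂(slabMeasure d T), ∀ v w, |matForm (A p) v w| ≤ C * ‖v‖ * ‖w‖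

theorem ae_matNorm_le {A : SpaceTime d → Matrix (Fin d) (Fin d) ℝ} (hA : linfNorm T A < ∞) :
    ∀ᵐ p ∂(slabMeasure d T), matNorm (A p) ≤ (linfNorm T A).toReal := by
  have h := ae_le_eLpNormEssSup (f := fun p => matNorm (A p)) (μ := slabMeasure d T)
  rw [← eLpNorm_exponent_top] at h
  filter_upwards [h] with p hp
  have := ENNReal.toReal_mono hA.ne hp
  rw [toReal_enorm] at this
  exact (le_abs_self _).trans this

theorem isBoundedField_of_linfNorm {A : SpaceTime d → Matrix (Fin d) (Fin d) ℝ}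
    (hm : ∀ i j, AEStronglyMeasurable (fun p => A p i j) (slabMeasure d T))
    (hA : linfNorm T A < ∞) : IsBoundedField T A (linfNorm T A).toReal := by
  refine ⟨hm, ?_⟩
  filter_upwards [ae_matNorm_le hA] with p hp v w
  exact (abs_matForm_le _ _ _).trans (by gcongr)

section Form

theorem integral_norm_mul_norm_le (F G : L2Vec d T) :
    Integrable (fun p => ‖F p‖ * ‖G p‖) (slabMeasure d T) ∧
      ∫ p, ‖F p‖ * ‖G p‖ ∂(slabMeasure d T) ≤ ‖F‖ * ‖G‖ := by
  have hF := (Lp.memLp F).norm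
  have hG := (Lp.memLp G).norm
  refine ⟨integrable_mul_of_memLp hF hG, ?_⟩
  have h1 := real_inner_le_norm (hF.toLp _) (hG.toLp _)
  rw [inner_toLp_eq_integral] at h1
  have e1 : ‖hF.toLp _‖ = ‖F‖ := by rw [Lp.norm_toLp, eLpNorm_norm, Lp.norm_def]
  have e2 : ‖hG.toLp _‖ = ‖G‖ := by rw [Lp.norm_toLp, eLpNorm_norm, Lp.norm_def]
  rw [e1, e2] at h1
  refine le_of_eq_of_le (integral_congr_ae ?_) h1
  filter_upwards [hG.coeFn_toLp] with p hp
  rw [hp]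

variable {A : SpaceTime d → Matrix (Fin d) (Fin d) ℝ} {C : ℝ} (hA : IsBoundedField T A C)

include hA

theorem IsBoundedField.integrable (F G : L2Vec d T) :
    Integrable (fun p => matForm (A p) (F p) (G p)) (slabMeasure d T) := by
  refine ((integral_norm_mul_norm_le F G).1.const_mul C).mono' ?_ ?_
  · unfold matForm
    refine Finset.aestronglyMeasurable_fun_sum _ fun i _ =>
      Finset.aestronglyMeasurable_fun_sum _ fun j _ => ?_
    exact ((hA.meas i j).mul (L2Vec.memLp_apply F i).1).mul (L2Vec.memLp_apply G j).1
  · filter_upwards [hA.bound] with p hp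
    rw [Real.norm_eq_abs, ← mul_assoc]
    exact hp _ _

theorem IsBoundedField.abs_integral_le (F G : L2Vec d T) :
    |∫ p, matForm (A p) (F p) (G p) ∂(slabMeasure d T)| ≤ |C| * ‖F‖ * ‖G‖ := by
  have h1 := (integral_norm_mul_norm_le F G).1.const_mul |C|
  have h2 : ‖∫ p, matForm (A p) (F p) (G p) ∂(slabMeasure d T)‖ ≤
      ∫ p, |C| * (‖F p‖ * ‖G p‖) ∂(slabMeasure d T) := by
    refine norm_integral_le_of_norm_le h1 ?_
    filter_upwards [hA.bound] with p hp
    rw [Real.norm_eq_abs, ← mul_assoc]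
    refine (hp _ _).trans ?_
    have := le_abs_self C
    gcongr
  rw [Real.norm_eq_abs, integral_const_mul] at h2
  rw [mul_assoc]
  exact h2.trans (mul_le_mul_of_nonneg_left (integral_norm_mul_norm_le F G).2 (abs_nonneg C))

/-- The bounded bilinear form `(F, G) ↦ ∫ A(F, G)` on square integrable vector fields. -/
def IsBoundedField.form : L2Vec d T →L[ℝ] L2Vec d T →L[ℝ] ℝ :=
  LinearMap.mkContinuous₂ (LinearMap.mk₂ ℝ
    (fun F G : L2Vec d T => ∫ p, matForm (A p) (F p) (G p) ∂(slabMeasure d T))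
    (fun F F' G => by
      rw [← integral_add (hA.integrable F G) (hA.integrable F' G)]
      refine integral_congr_ae ((Lp.coeFn_add F F').mono fun p hp => ?_)
      simp only [hp, Pi.add_apply, matForm_add_left])
    (fun c F G => by
      rw [smul_eq_mul, ← integral_const_mul]
      refine integral_congr_ae ((Lp.coeFn_smul c F).mono fun p hp => ?_)
      simp only [hp, Pi.smul_apply, matForm_smul_left])
    (fun F G G' => by
      rw [← integral_add (hA.integrable F G) (hA.integrable F G')]
      refine integral_congr_ae ((Lp.coeFn_add G G').mono fun p hp => ?_)
      simp only [hp, Pi.add_apply, matForm_add_right])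
    (fun c F G => by
      rw [smul_eq_mul, ← integral_const_mul]
      refine integral_congr_ae ((Lp.coeFn_smul c G).mono fun p hp => ?_)
      simp only [hp, Pi.smul_apply, matForm_smul_right])) |C| (hA.abs_integral_le)

theorem IsBoundedField.form_apply (F G : L2Vec d T) :
    hA.form F G = ∫ p, matForm (A p) (F p) (G p) ∂(slabMeasure d T) := rfl

end Form

section Resolvent

variable {a : SpaceTime d → Matrix (Fin d) (Fin d) ℝ} {lam : ℝ}

theorem IsBoundedElliptic.isBoundedField (ha : IsBoundedElliptic T lam a) :
    IsBoundedField T a (linfNorm T a).toReal :=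
  isBoundedField_of_linfNorm ha.meas ha.bounded

theorem IsBoundedElliptic.le_form (ha : IsBoundedElliptic T lam a) (F : L2Vec d T) :
    lam * ‖F‖ ^ 2 ≤ ha.isBoundedField.form F F := by
  have h1 : ‖F‖ ^ 2 = ∫ p, ‖F p‖ ^ 2 ∂(slabMeasure d T) := by
    rw [← real_inner_self_eq_norm_sq, L2.inner_def]
    simp only [real_inner_self_eq_norm_sq]
  rw [h1, ← integral_const_mul, IsBoundedField.form_apply]
  refine integral_mono_ae ?_ (ha.isBoundedField.integrable F F) ?_
  · exact ((memLp_two_iff_integrable_sq_norm (Lp.memLp F).1).1 (Lp.memLp F)).const_mul _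
  · filter_upwards [ha.elliptic] with p hp
    exact hp _

theorem IsBoundedElliptic.form_comm (ha : IsBoundedElliptic T lam a) (F G : L2Vec d T) :
    ha.isBoundedField.form F G = ha.isBoundedField.form G F := by
  rw [IsBoundedField.form_apply, IsBoundedField.form_apply]
  refine integral_congr_ae ?_
  filter_upwards [ha.symm] with p hp
  exact matForm_comm _ _ hp

/-- `J τ` is the resolvent `(1 - τ div(a∇))⁻¹` in variational form and `N τ` is its gradient. -/
structure IsFormResolvent {C : ℝ} (hA : IsBoundedField T a C) (J : ℝ → L2 d T →L[ℝ] L2 d T)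
    (N : ℝ → L2 d T → L2Vec d T) : Prop where
  grad : ∀ τ, 0 < τ → ∀ g, IsWeakGrad (J τ g) (N τ g)
  weak : ∀ τ, 0 < τ → ∀ (g w : L2 d T) (W : L2Vec d T), IsWeakGrad w W →
    ⟪J τ g, w⟫_ℝ + τ * hA.form (N τ g) W = ⟪g, w⟫_ℝ

/-- Lax–Milgram on the graph of the gradient, for the form `⟪f, w⟫ + τ ∫ a(F, W)`. Working on the
graph gives the solution and its gradient together. -/
theorem IsBoundedElliptic.exists_resolvent (ha : IsBoundedElliptic T lam a) (hlam : 0 < lam) :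
    ∃ J N, IsFormResolvent ha.isBoundedField J N := by
  have key : ∀ τ : ℝ, ∃ (J : L2 d T →L[ℝ] L2 d T) (N : L2 d T → L2Vec d T), 0 < τ → ∀ g,
      IsWeakGrad (J g) (N g) ∧ ∀ (w : L2 d T) (W : L2Vec d T), IsWeakGrad w W →
      ⟪J g, w⟫_ℝ + τ * ha.isBoundedField.form (N g) W = ⟪g, w⟫_ℝ := by
    intro τ
    by_cases hτ : 0 < τ
    swap
    -- For `τ ≤ 0` nothing is required of the resolvent; zero is a dummy value that makes the family
    -- total.
    · exact ⟨0, 0, fun h => absurd h hτ⟩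
    have : CompleteSpace (gradGraph d T) := isClosed_gradGraph.completeSpace_coe
    let pr1 : gradGraph d T →L[ℝ] L2 d T :=
      (WithLp.fstL 2 ℝ (L2 d T) (L2Vec d T)).comp (gradGraph d T).subtypeL
    let pr2 : gradGraph d T →L[ℝ] L2Vec d T :=
      (WithLp.sndL 2 ℝ (L2 d T) (L2Vec d T)).comp (gradGraph d T).subtypeL
    let I : L2 d T →L[ℝ] L2 d T →L[ℝ] ℝ := innerSL ℝ
    let B : gradGraph d T →L[ℝ] gradGraph d T →L[ℝ] ℝ :=
      I.bilinearComp pr1 pr1 + τ • ha.isBoundedField.form.bilinearComp pr2 pr2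
    have hB : ∀ v w, B v w = ⟪pr1 v, pr1 w⟫_ℝ + τ * ha.isBoundedField.form (pr2 v) (pr2 w) :=
      fun v w => rfl
    have hco : IsCoercive B := by
      -- The function part is coercive with constant `1`, the gradient part with `τ λ`.
      refine ⟨min 1 (τ * lam), by positivity, fun v => ?_⟩
      have e : ‖v‖ * ‖v‖ = ‖pr1 v‖ ^ 2 + ‖pr2 v‖ ^ 2 := by
        rw [← sq]
        exact WithLp.prod_norm_sq_eq_of_L2 (v : WithLp 2 (L2 d T × L2Vec d T))
      rw [mul_assoc, e, hB, real_inner_self_eq_norm_sq, mul_add]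
      have h1 := ha.le_form (pr2 v)
      have h2 : min 1 (τ * lam) * ‖pr1 v‖ ^ 2 ≤ 1 * ‖pr1 v‖ ^ 2 := by gcongr; exact min_le_left _ _
      have h3 : min 1 (τ * lam) * ‖pr2 v‖ ^ 2 ≤ τ * lam * ‖pr2 v‖ ^ 2 := by
        gcongr; exact min_le_right _ _
      have h4 := mul_le_mul_of_nonneg_left h1 hτ.le
      rw [← mul_assoc] at h4
      linarith
    let S : L2 d T →L[ℝ] gradGraph d T :=
      (hco.continuousLinearEquivOfBilin.symm : gradGraph d T →L[ℝ] gradGraph d T).comp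
        (ContinuousLinearMap.adjoint pr1)
    have hS : ∀ g w, B (S g) w = ⟪g, pr1 w⟫_ℝ := by
      intro g w
      rw [← hco.continuousLinearEquivOfBilin_apply]
      simp only [S, ContinuousLinearMap.comp_apply, ContinuousLinearEquiv.coe_coe,
        ContinuousLinearEquiv.apply_symm_apply]
      exact ContinuousLinearMap.adjoint_inner_left _ _ _
    refine ⟨pr1.comp S, fun g => pr2 (S g), fun _ g => ⟨(S g).2, fun w W hw => ?_⟩⟩
    have := hS g ⟨WithLp.toLp 2 (w, W), hw⟩
    rw [hB] at this
    exact this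
  choose J N h using key
  exact ⟨J, N, fun τ hτ g => (h τ hτ g).1, fun τ hτ g => (h τ hτ g).2⟩

theorem isDivFormOp_iff {C : ℝ} (hA : IsBoundedField T a C) {f h : L2 d T} :
    IsDivFormOp a f h ↔ ∃ F : L2Vec d T, IsWeakGrad f F ∧ ∀ (g : L2 d T) (G : L2Vec d T),
      IsWeakGrad g G → hA.form F G = - ⟪h, g⟫_ℝ := by
  simp only [L2.inner_eq_integral, IsBoundedField.form_apply]
  rfl

/-- The graph of `div(a∇)`. -/
def opGraph {C : ℝ} (hA : IsBoundedField T a C) : Submodule ℝ (L2 d T × L2 d T) where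
  carrier := {x | IsDivFormOp a x.1 x.2}
  add_mem' {x y} hx hy := by
    simp only [Set.mem_ofPred_eq, isDivFormOp_iff hA] at hx hy ⊢
    obtain ⟨F, hF, h1⟩ := hx
    obtain ⟨G, hG, h2⟩ := hy
    refine ⟨F + G, hF.add hG, fun g W hg => ?_⟩
    rw [map_add, add_apply, h1 g W hg, h2 g W hg, Prod.snd_add, inner_add_left]
    ring
  zero_mem' := by
    simp only [Set.mem_ofPred_eq, isDivFormOp_iff hA]
    exact ⟨0, isWeakGrad_zero, fun g W _ => by simp⟩
  smul_mem' c x hx := by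
    simp only [Set.mem_ofPred_eq, isDivFormOp_iff hA] at hx ⊢
    obtain ⟨F, hF, h1⟩ := hx
    refine ⟨c • F, hF.smul c, fun g W hg => ?_⟩
    rw [map_smul, smul_apply, h1 g W hg, Prod.smul_snd, real_inner_smul_left]
    simp

theorem isFormSemigroup_iff {C : ℝ} (hA : IsBoundedField T a C)
    {P : ℝ≥0 → (L2 d T →L[ℝ] L2 d T)} : IsFormSemigroup a P ↔ IsSemigroupOf (opGraph hA) P :=
  ⟨fun h => ⟨h.map_zero, h.map_add, h.cont, h.generator⟩,
    fun h => ⟨h.map_zero, h.map_add, h.cont, h.generator⟩⟩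

namespace IsFormResolvent

variable {J : ℝ → L2 d T →L[ℝ] L2 d T} {N : ℝ → L2 d T → L2Vec d T}

theorem isResolventFamily (ha : IsBoundedElliptic T lam a) (hlam : 0 < lam)
    (hJ : IsFormResolvent ha.isBoundedField J N) :
    IsResolventFamily (opGraph ha.isBoundedField) J where
  dissip f h hf := by
    obtain ⟨F, hF, h1⟩ := (isDivFormOp_iff ha.isBoundedField).1 hf
    have h2 := h1 f F hF
    have h3 := ha.le_form F
    have : 0 ≤ lam * ‖F‖ ^ 2 := by positivity
    linarith
  single h hf := by
    obtain ⟨F, hF, h1⟩ := (isDivFormOp_iff ha.isBoundedField).1 hf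
    obtain rfl := hF.unique_zero
    refine eq_zero_of_integral_formDomain fun g G hG => ?_
    rw [← L2.inner_eq_integral, ← neg_eq_zero, ← h1 g G hG]
    simp
  mem τ hτ g := by
    refine (isDivFormOp_iff ha.isBoundedField).2 ⟨N τ g, hJ.grad τ hτ g, fun w W hw => ?_⟩
    have h1 := hJ.weak τ hτ g w W hw
    rw [real_inner_smul_left, inner_sub_left, ← h1]
    field_simp
    ring

theorem inner_comm (ha : IsBoundedElliptic T lam a) (hJ : IsFormResolvent ha.isBoundedField J N)
    {τ : ℝ} (hτ : 0 < τ) (f g : L2 d T) : ⟪J τ f, g⟫_ℝ = ⟪f, J τ g⟫_ℝ := by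
  have h1 := hJ.weak τ hτ f _ _ (hJ.grad τ hτ g)
  have h2 := hJ.weak τ hτ g _ _ (hJ.grad τ hτ f)
  rw [ha.form_comm, real_inner_comm] at h2
  rw [← h1, real_inner_comm, ← h2]

/-- Test the equation with `J τ g` itself and use `⟪g, J τ g⟫ ≤ (‖g‖² + ‖J τ g‖²) / 2`. The right
side is left as a difference so that it telescopes along powers of `J τ`. -/
theorem energy (ha : IsBoundedElliptic T lam a) (hJ : IsFormResolvent ha.isBoundedField J N)
    {τ : ℝ} (hτ : 0 < τ) (g : L2 d T) :
    τ * lam * ‖N τ g‖ ^ 2 ≤ (‖g‖ ^ 2 - ‖J τ g‖ ^ 2) / 2 := by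
  have h1 := hJ.weak τ hτ g _ _ (hJ.grad τ hτ g)
  rw [real_inner_self_eq_norm_sq] at h1
  have h2 := mul_le_mul_of_nonneg_left (ha.le_form (N τ g)) hτ.le
  have h3 := real_inner_le_norm g (J τ g)
  nlinarith [sq_nonneg (‖g‖ - ‖J τ g‖)]

end IsFormResolvent

end Resolvent

end TimeCommutator

/-! ### Time increments of functions with a weak time derivative. -/

namespace TimeCommutator

open scoped InnerProductSpace

variable {d : ℕ} {T : ℝ}

section TimeIncrement

theorem continuous_timeShift_uncurry :
    Continuous fun x : SpaceTime d × ℝ => timeShift x.2 x.1 := by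
  unfold timeShift; fun_prop

theorem integrable_timeShift_prod {g : SpaceTime d → ℝ} (hg : StronglyMeasurable g)
    (hi : Integrable g volume) (h : ℝ) :
    Integrable (fun x : SpaceTime d × ℝ => g (timeShift x.2 x.1))
      (volume.prod (volume.restrict (Ioc 0 h))) := by
  refine (integrable_prod_iff' (hg.comp_measurable
    continuous_timeShift_uncurry.measurable).aestronglyMeasurable).2 ⟨?_, ?_⟩
  · exact Eventually.of_forall fun s => (measurePreserving_timeShift s).integrable_comp_of_integrable hi
  · have : ∀ s : ℝ, ∫ p, ‖g (timeShift s p)‖ = ∫ p, ‖g p‖ :=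
      fun s => integral_comp_timeShift s fun p => ‖g p‖
    exact (integrable_const (∫ p, ‖g p‖)).congr (Eventually.of_forall fun s => (this s).symm)

/-- The set swept by translating `K` over times in `[-h, h]`. -/
def sweep (K : Set (SpaceTime d)) (h : ℝ) : Set (SpaceTime d) :=
  (fun x : SpaceTime d × ℝ => timeShift x.2 x.1) '' (K ×ˢ Icc (-h) h)

theorem isCompact_sweep {K : Set (SpaceTime d)} (hK : IsCompact K) (h : ℝ) :
    IsCompact (sweep K h) :=
  (hK.prod isCompact_Icc).image continuous_timeShift_uncurry

theorem mem_sweep {K : Set (SpaceTime d)} {h s : ℝ} {p : SpaceTime d} (hp : p ∈ K)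
    (hs : s ∈ Icc (-h) h) : timeShift s p ∈ sweep K h :=
  ⟨(p, s), ⟨hp, hs⟩, rfl⟩

/-- Only the values of `β` on the compact set swept by the support of `ψ` enter, so `β` may be
truncated there and is then globally integrable. -/
theorem integrable_mul_timeShift_prod {β ψ : SpaceTime d → ℝ} (hβ : StronglyMeasurable β)
    (hi : LocallyIntegrable β volume) (hψ : Continuous ψ) (hc : HasCompactSupport ψ) (h : ℝ) :
    Integrable (fun x : SpaceTime d × ℝ => ψ x.1 * β (timeShift x.2 x.1))
      (volume.prod (volume.restrict (Ioc 0 h))) := by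
  have hK := isCompact_sweep hc.isCompact (h := h)
  have h1 := integrable_timeShift_prod (hβ.indicator hK.measurableSet)
    ((hi.integrableOn_isCompact hK).integrable_indicator hK.measurableSet) h
  obtain ⟨C, hC⟩ := hc.exists_bound_of_continuous hψ
  have h2 := h1.bdd_mul (f := fun x : SpaceTime d × ℝ => ψ x.1) (c := C)
    (by fun_prop) (Eventually.of_forall fun x => hC x.1)
  refine h2.congr ?_
  have : ∀ᵐ x : SpaceTime d × ℝ ∂(volume.prod (volume.restrict (Ioc 0 h))), x.2 ∈ Ioc 0 h :=
    Measure.quasiMeasurePreserving_snd.ae (ae_restrict_mem measurableSet_Ioc)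
  filter_upwards [this] with x hx
  by_cases hp : x.1 ∈ tsupport ψ
  · rw [indicator_of_mem (mem_sweep hp ⟨by linarith [hx.1, hx.2], hx.2⟩)]
  · simp [image_eq_zero_of_notMem_tsupport hp]

theorem tsupport_comp_timeShift (ψ : SpaceTime d → ℝ) (h : ℝ) :
    tsupport (fun p => ψ (timeShift h p)) = timeShift h ⁻¹' tsupport ψ := by
  have : timeShift (d := d) h = Homeomorph.addRight ((h, 0) : SpaceTime d) := by
    ext p <;> simp [timeShift]
  rw [this]
  exact tsupport_comp_eq_preimage ψ (Homeomorph.addRight ((h, 0) : SpaceTime d))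

theorem hasCompactSupport_comp_timeShift {ψ : SpaceTime d → ℝ} (hψ : HasCompactSupport ψ) (h : ℝ) :
    HasCompactSupport (fun p => ψ (timeShift h p)) := by
  have : timeShift (d := d) h = Homeomorph.addRight ((h, 0) : SpaceTime d) := by
    ext p <;> simp [timeShift]
  rw [this]
  exact hψ.comp_homeomorph (Homeomorph.addRight ((h, 0) : SpaceTime d))

theorem hasDerivAt_timeShift {ψ : SpaceTime d → ℝ} (hψ : IsC12On univ ψ) (p : SpaceTime d) (s : ℝ) :
    HasDerivAt (fun s : ℝ => ψ (timeShift (-s) p)) (-timeDeriv ψ (timeShift (-s) p)) s := by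
  have h1 := (hψ.diff_time (timeShift (-s) p) trivial).hasDerivAt
  have h2 : HasDerivAt (fun s : ℝ => p.1 + -s) (-1) s := (hasDerivAt_neg s).const_add p.1
  have h3 := h1.comp s h2
  rw [mul_neg_one] at h3
  exact h3

/-- The translation acts on the regular factor `ψ`, so nothing beyond local integrability is asked
of `b`. For parameters within distance one of `s`, all integrands live on one swept compact set. -/
theorem hasDerivAt_integral_timeShift {ψ b : SpaceTime d → ℝ} (hψ : IsC12On univ ψ)
    (hc : HasCompactSupport ψ) (hb : LocallyIntegrable b volume) (s : ℝ) :
    HasDerivAt (fun s : ℝ => ∫ p, ψ (timeShift (-s) p) * b p)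
      (∫ p, -timeDeriv ψ (timeShift (-s) p) * b p) s := by
  have hK := isCompact_sweep hc.isCompact (h := |s| + 1)
  obtain ⟨C, hC⟩ := (hasCompactSupport_timeDeriv hc).exists_bound_of_continuous
    hψ.continuous_timeDeriv
  have hψs : ∀ r : ℝ, Continuous fun p => ψ (timeShift (-r) p) :=
    fun r => hψ.continuous.comp (continuous_timeShift _)
  refine (hasDerivAt_integral_of_dominated_loc_of_deriv_le (𝕜 := ℝ) (E := ℝ)
    (F := fun r p => ψ (timeShift (-r) p) * b p)
    (F' := fun r p => -timeDeriv ψ (timeShift (-r) p) * b p)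
    (bound := fun p => C * (sweep (tsupport ψ) (|s| + 1)).indicator (fun p => ‖b p‖) p)
    (Metric.ball_mem_nhds s one_pos) ?_ ?_ ?_ ?_ ?_ ?_).2
  · exact Eventually.of_forall fun r => (hψs r).aestronglyMeasurable.mul hb.aestronglyMeasurable
  · have : Integrable (fun p => ψ (timeShift (-s) p) • b p) volume :=
      hb.integrable_smul_left_of_hasCompactSupport (hψs s) (hasCompactSupport_comp_timeShift hc _)
    exact this
  · exact ((hψ.continuous_timeDeriv.comp (continuous_timeShift (-s))).neg).aestronglyMeasurable.mul
      hb.aestronglyMeasurable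
  · refine Eventually.of_forall fun p r hr => ?_
    have hr' : |r - s| < 1 := hr
    have hrs : |r| ≤ |s| + 1 := by
      have := abs_add_le (r - s) s
      rw [sub_add_cancel] at this
      linarith
    by_cases hp : timeShift (-r) p ∈ tsupport ψ
    · have hp' : p ∈ sweep (tsupport ψ) (|s| + 1) := by
        have := mem_sweep hp (abs_le.1 hrs)
        simpa [timeShift_timeShift] using this
      rw [indicator_of_mem hp', norm_mul, norm_neg]
      exact mul_le_mul_of_nonneg_right (hC _) (norm_nonneg _)
    · rw [timeDeriv_eq_zero_of_notMem_tsupport hp, neg_zero, zero_mul, norm_zero]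
      have hC0 : 0 ≤ C := (norm_nonneg _).trans (hC p)
      exact mul_nonneg hC0 (indicator_nonneg (fun _ _ => norm_nonneg _) _)
  · have : IntegrableOn (fun p => ‖b p‖) (sweep (tsupport ψ) (|s| + 1)) volume :=
      (hb.integrableOn_isCompact hK).norm
    exact (this.integrable_indicator hK.measurableSet).const_mul C
  · exact Eventually.of_forall fun p r _ => (hasDerivAt_timeShift hψ p r).mul_const _

open scoped ContDiff in
/-- A function with a weak time derivative is the integral of this derivative. -/
theorem IsWeakTimeDeriv.ae_sub_eq {b β : SpaceTime d → ℝ} {q : ℝ≥0∞} (hq : 1 ≤ q)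
    (hb : MemLp b q (slabMeasure d T)) (hβm : StronglyMeasurable β)
    (hβ : LocallyIntegrable β volume) (hw : IsWeakTimeDeriv T b β) {h : ℝ} (hh : 0 ≤ h) :
    ∀ᵐ p ∂(volume : Measure (SpaceTime d)), p ∈ slab d T → timeShift h p ∈ slab d T →
      b (timeShift h p) - b p = ∫ s in (0 : ℝ)..h, β (timeShift s p) := by
  have hbt : MemLp ((slab d T).indicator b) q volume :=
    (memLp_indicator_iff_restrict (measurableSet_slab d T)).2 hb
  have hbl := hbt.locallyIntegrable hq
  have hbs : LocallyIntegrable (fun p => (slab d T).indicator b (timeShift h p)) volume :=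
    (hbt.comp_measurePreserving (measurePreserving_timeShift h)).locallyIntegrable hq
  have hκl : LocallyIntegrable (fun p : SpaceTime d => ∫ s in (0 : ℝ)..h, β (timeShift s p))
      volume := by
    refine (locallyIntegrable_iff).2 fun K hK => ?_
    have hS := isCompact_sweep hK (h := h)
    have h1 := (integrable_timeShift_prod (hβm.indicator hS.measurableSet)
      ((hβ.integrableOn_isCompact hS).integrable_indicator hS.measurableSet) h).integral_prod_left
    refine (h1.integrableOn (s := K)).congr_fun (fun p hp => ?_) hK.measurableSet
    simp only
    rw [intervalIntegral.integral_of_le hh]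
    refine setIntegral_congr_fun measurableSet_Ioc fun s hs => ?_
    simp only [indicator_of_mem (mem_sweep hp (h := h) ⟨by linarith [hs.1, hs.2], hs.2⟩)]
  set f : SpaceTime d → ℝ := fun p => (slab d T).indicator b (timeShift h p) -
    (slab d T).indicator b p - ∫ s in (0 : ℝ)..h, β (timeShift s p) with hf
  have hU : IsOpen (slab d T ∩ timeShift h ⁻¹' slab d T) :=
    (isOpen_slab d T).inter ((isOpen_slab d T).preimage (continuous_timeShift h))
  have key := hU.ae_eq_zero_of_integral_contDiff_smul_eq_zero (μ := volume) (f := f)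
    (((hbs.sub hbl).sub hκl).locallyIntegrableOn _) (fun ψ h1 h2 h3 => ?_)
  · filter_upwards [key] with p hp hp1 hp2
    have := hp ⟨hp1, hp2⟩
    simp only [hf, indicator_of_mem hp1, indicator_of_mem hp2] at this
    linarith
  · have hψ := isC12On_of_contDiff h1 univ
    -- The support of `ψ` and its translate by `h` both lie in the slab, hence so do all translates
    -- in between, and each may be used as a test function.
    have test : ∀ s ∈ Icc 0 h, tsupport (fun p => ψ (timeShift (-s) p)) ⊆ slab d T := by
      intro s hs p hp
      rw [tsupport_comp_timeShift] at hp
      have h4 := h3 hp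
      have h5 : 0 < p.1 + -s := h4.1.1.1
      have h6 : p.1 + -s + h < T := h4.2.1.2
      exact ⟨⟨by linarith [hs.1], by linarith [hs.2]⟩, trivial⟩
    have hder : ∀ s ∈ Icc 0 h, ∫ p, -timeDeriv ψ (timeShift (-s) p) * (slab d T).indicator b p =
        ∫ p, ψ p * β (timeShift s p) := by
      intro s hs
      have h5 := hw (fun p => ψ (timeShift (-s) p)) (isTestC_of_contDiff (h1.comp (by unfold timeShift; fun_prop))
        (hasCompactSupport_comp_timeShift h2 (-s)) (test s hs))
      have e1 : ∫ p, timeDeriv (fun p => ψ (timeShift (-s) p)) p * b p ∂(slabMeasure d T) =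
          ∫ p, timeDeriv ψ (timeShift (-s) p) * (slab d T).indicator b p := by
        refine integral_slab_eq (fun p hp => ?_) fun p hp => ?_
        · simp only [indicator_of_mem hp, timeDeriv_comp_timeShift]
        · simp [hp]
      have e2 : ∫ p, ψ (timeShift (-s) p) * β p ∂(slabMeasure d T) =
          ∫ p, ψ (timeShift (-s) p) * β p := by
        refine integral_slab_eq (fun p _ => rfl) fun p hp => ?_
        have h0 : (fun p => ψ (timeShift (-s) p)) p = 0 :=
          image_eq_zero_of_notMem_tsupport
            (f := fun p => ψ (timeShift (-s) p)) fun h => hp (test s hs h)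
        simp only at h0
        rw [h0, zero_mul]
      have e3 := integral_comp_timeShift s fun p => ψ (timeShift (-s) p) * β p
      simp only [timeShift_timeShift, add_neg_cancel, timeShift_zero] at e3
      rw [e3, ← e2]
      simp only [neg_mul]
      rw [integral_neg, ← e1, h5, neg_neg]
    have hprod := integrable_mul_timeShift_prod hβm hβ h1.continuous h2 h
    have hint : IntervalIntegrable (fun s => ∫ p, -timeDeriv ψ (timeShift (-s) p) *
        (slab d T).indicator b p) volume 0 h := by
      rw [intervalIntegrable_iff_integrableOn_Ioc_of_le hh]
      refine IntegrableOn.congr_fun hprod.integral_prod_right (fun s hs => ?_) measurableSet_Ioc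
      exact (hder s ⟨hs.1.le, hs.2⟩).symm
    have hftc := intervalIntegral.integral_eq_sub_of_hasDerivAt
      (fun s _ => hasDerivAt_integral_timeShift hψ h2 hbl s) hint
    have eh := integral_comp_timeShift h fun p => ψ (timeShift (-h) p) * (slab d T).indicator b p
    simp only [timeShift_timeShift, add_neg_cancel, timeShift_zero] at eh
    -- Fubini and `hder` turn the tested right side into the integral over `s` of the derivative of
    -- `∫ ψ(· - s) b`. The fundamental theorem of calculus then yields the tested increment of `b`.
    have esw : ∫ p, ψ p * (∫ s in (0 : ℝ)..h, β (timeShift s p)) =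
        ∫ s in (0 : ℝ)..h, ∫ p, -timeDeriv ψ (timeShift (-s) p) * (slab d T).indicator b p := by
      rw [intervalIntegral.integral_of_le hh, setIntegral_congr_fun measurableSet_Ioc
        (fun s hs => hder s ⟨hs.1.le, hs.2⟩), ← integral_integral_swap hprod]
      refine integral_congr_ae (Eventually.of_forall fun p => ?_)
      simp only
      rw [intervalIntegral.integral_of_le hh, integral_const_mul]
    have i1 : Integrable (fun p => ψ p * (slab d T).indicator b (timeShift h p)) volume :=
      hbs.integrable_smul_left_of_hasCompactSupport h1.continuous h2
    have i2 : Integrable (fun p => ψ p * (slab d T).indicator b p) volume :=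
      hbl.integrable_smul_left_of_hasCompactSupport h1.continuous h2
    have i3 : Integrable (fun p => ψ p * ∫ s in (0 : ℝ)..h, β (timeShift s p)) volume :=
      hκl.integrable_smul_left_of_hasCompactSupport h1.continuous h2
    simp only [hf, smul_eq_mul, mul_sub]
    have i12 : Integrable (fun p => ψ p * (slab d T).indicator b (timeShift h p) -
      ψ p * (slab d T).indicator b p) volume := i1.sub i2
    rw [integral_sub i12 i3, integral_sub i1 i2, esw, hftc, eh]
    simp

theorem timeShift_quasiMeasurePreserving (h : ℝ) :
    Measure.QuasiMeasurePreserving (timeShift (d := d) h) volume volume :=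
  (measurePreserving_timeShift h).quasiMeasurePreserving

theorem ae_volume_of_ae_slab {P : SpaceTime d → Prop} (h : ∀ᵐ p ∂(slabMeasure d T), P p) :
    ∀ᵐ p ∂(volume : Measure (SpaceTime d)), p ∈ slab d T → P p :=
  (ae_restrict_iff' (measurableSet_slab d T)).1 h

theorem abs_apply_le_matNorm (A : Matrix (Fin d) (Fin d) ℝ) (i j : Fin d) : |A i j| ≤ matNorm A := by
  refine Real.le_sqrt_of_sq_le ?_
  rw [sq_abs]
  exact (Finset.single_le_sum (f := fun j => A i j ^ 2) (fun j _ => sq_nonneg _)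
    (Finset.mem_univ j)).trans (Finset.single_le_sum (f := fun i => ∑ j, A i j ^ 2)
      (fun i _ => Finset.sum_nonneg fun j _ => sq_nonneg _) (Finset.mem_univ i))

theorem matForm_finset_eq_integral {B : ℝ → Matrix (Fin d) (Fin d) ℝ} {h : ℝ}
    (hB : ∀ i j, IntervalIntegrable (fun s => B s i j) volume 0 h)
    (v w : EuclideanSpace ℝ (Fin d)) :
    matForm (fun i j => ∫ s in (0 : ℝ)..h, B s i j) v w =
      ∫ s in (0 : ℝ)..h, matForm (B s) v w := by
  simp only [matForm]
  rw [intervalIntegral.integral_finsetSum]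
  · refine Finset.sum_congr rfl fun i _ => ?_
    rw [intervalIntegral.integral_finsetSum]
    · refine Finset.sum_congr rfl fun j _ => ?_
      rw [intervalIntegral.integral_mul_const, intervalIntegral.integral_mul_const]
    · exact fun j _ => ((hB i j).mul_const _).mul_const _
  · intro i _
    have := IntervalIntegrable.sum Finset.univ fun j _ => ((hB i j).mul_const (v i)).mul_const (w j)
    simpa only [Finset.sum_fn] using this

/-- Coefficients with a bounded weak time derivative are Lipschitz in time. -/
theorem IsBoundedTimeDeriv.ae_abs_matForm_sub_le
    {a dta : SpaceTime d → Matrix (Fin d) (Fin d) ℝ} (h : IsBoundedTimeDeriv T a dta)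
    (ham : ∀ i j, AEStronglyMeasurable (fun p => a p i j) (slabMeasure d T))
    (ha : linfNorm T a < ∞) {r : ℝ} (hr : 0 ≤ r) :
    ∀ᵐ p ∂(slabMeasure d T), timeShift r p ∈ slab d T → ∀ v w,
      |matForm (a (timeShift r p)) v w - matForm (a p) v w| ≤
        r * (linfNorm T dta).toReal * ‖v‖ * ‖w‖ := by
  set M := (linfNorm T dta).toReal with hM
  have hM0 : 0 ≤ M := ENNReal.toReal_nonneg
  let mk : SpaceTime d → Matrix (Fin d) (Fin d) ℝ := fun p i j => (h.meas i j).mk _ p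
  have hmk : ∀ i j, StronglyMeasurable fun p => mk p i j := fun i j =>
    (h.meas i j).stronglyMeasurable_mk
  have hae : ∀ᵐ p ∂(slabMeasure d T), mk p = dta p := by
    have : ∀ᵐ p ∂(slabMeasure d T), ∀ i j, dta p i j = mk p i j :=
      ae_all_iff.2 fun i => ae_all_iff.2 fun j => (h.meas i j).ae_eq_mk
    filter_upwards [this] with p hp
    ext i j
    exact (hp i j).symm
  have hmn : Measurable fun p => matNorm (mk p) := by
    unfold matNorm
    have := fun i j => (hmk i j).measurable
    fun_prop
  -- Integrals along time lines require a derivative bounded everywhere. A measurable representative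
  -- is set to zero where it exceeds `M`, which changes it only on a null set of the slab.
  let S : Set (SpaceTime d) := {p | matNorm (mk p) ≤ M}
  have hS : MeasurableSet S := measurableSet_le hmn measurable_const
  let B : SpaceTime d → Matrix (Fin d) (Fin d) ℝ := fun p i j => S.indicator (fun p => mk p i j) p
  have hBm : ∀ i j, StronglyMeasurable fun p => B p i j := fun i j => (hmk i j).indicator hS
  have hBeq : ∀ᵐ p ∂(slabMeasure d T), B p = dta p := by
    filter_upwards [hae, ae_matNorm_le h.bounded] with p h1 h2
    have : p ∈ S := by
      change matNorm (mk p) ≤ M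
      rwa [h1]
    rw [← h1]
    ext i j
    exact indicator_of_mem this _
  have hBn : ∀ p, matNorm (B p) ≤ M := by
    intro p
    by_cases hp : p ∈ S
    · have : B p = mk p := by
        ext i j
        exact indicator_of_mem hp _
      rw [this]
      exact hp
    · have : B p = 0 := by
        ext i j
        exact indicator_of_notMem hp _
      rw [this]
      simpa [matNorm] using hM0
  have hBb : ∀ i j p, ‖B p i j‖ ≤ M := fun i j p => (abs_apply_le_matNorm (B p) i j).trans (hBn p)
  have hBl : ∀ i j, LocallyIntegrable (fun p => B p i j) volume := fun i j =>
    (memLp_top_of_bound (hBm i j).aestronglyMeasurable M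
      (Eventually.of_forall (hBb i j))).locallyIntegrable le_top
  have hw : ∀ i j, IsWeakTimeDeriv T (fun p => a p i j) (fun p => B p i j) := by
    intro i j φ hφ
    rw [h.deriv i j φ hφ]
    congr 1
    refine integral_congr_ae ?_
    filter_upwards [hBeq] with p hp
    rw [hp]
  have hat : ∀ i j, MemLp (fun p => a p i j) ∞ (slabMeasure d T) := fun i j =>
    memLp_top_of_bound (ham i j) (linfNorm T a).toReal
      ((ae_matNorm_le ha).mono fun p hp => (abs_apply_le_matNorm (a p) i j).trans hp)
  have key : ∀ᵐ p ∂(volume : Measure (SpaceTime d)), ∀ i j, p ∈ slab d T → timeShift r p ∈ slab d T →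
      a (timeShift r p) i j - a p i j = ∫ s in (0 : ℝ)..r, B (timeShift s p) i j :=
    ae_all_iff.2 fun i => ae_all_iff.2 fun j =>
      (hw i j).ae_sub_eq le_top (hat i j) (hBm i j) (hBl i j) hr
  filter_upwards [ae_restrict_of_ae key, ae_mem_slab] with p hp hps hpr v w
  have hc : Measurable fun s : ℝ => timeShift s p :=
    (continuous_timeShift_uncurry.comp (by fun_prop : Continuous fun s : ℝ => (p, s))).measurable
  have hii : ∀ i j, IntervalIntegrable (fun s => B (timeShift s p) i j) volume 0 r := fun i j => by
    rw [intervalIntegrable_iff_integrableOn_Ioc_of_le hr]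
    exact Integrable.of_bound ((hBm i j).comp_measurable hc).aestronglyMeasurable M
      (Eventually.of_forall fun s => hBb i j _)
  have e : matForm (a (timeShift r p)) v w - matForm (a p) v w =
      ∫ s in (0 : ℝ)..r, matForm (B (timeShift s p)) v w := by
    rw [← matForm_finset_eq_integral hii]
    simp only [matForm, ← Finset.sum_sub_distrib, ← hp _ _ hps hpr, sub_mul]
  rw [e, ← Real.norm_eq_abs]
  refine (intervalIntegral.norm_integral_le_of_norm_le_const (C := M * ‖v‖ * ‖w‖)
    fun s _ => ?_).trans_eq ?_
  · exact (abs_matForm_le _ _ _).trans (by gcongr; exact hBn _)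
  · rw [sub_zero, abs_of_nonneg hr]
    ring

/-- Time increments of a function with a square integrable weak time derivative. -/
theorem IsWeakTimeDeriv.abs_inner_shift_sub_le {f g : L2 d T} (hf : IsWeakTimeDeriv T f g)
    {h : ℝ} (hh : 0 ≤ h) {ψ : L2 d T}
    (hψ : ∀ᵐ p ∂(slabMeasure d T), timeShift (-h) p ∉ slab d T → ψ p = 0) :
    |⟪ψ, shift (-h) f - f⟫_ℝ| ≤ h * ‖g‖ * ‖ψ‖ := by
  set β := (slab d T).indicator g with hβ
  have hβm : StronglyMeasurable β := (Lp.stronglyMeasurable g).indicator (measurableSet_slab d T)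
  have hβL : MemLp β 2 volume := (memLp_indicator_iff_restrict (measurableSet_slab d T)).2 (Lp.memLp g)
  have hw : IsWeakTimeDeriv T f β := by
    intro φ hφ
    rw [hf φ hφ]
    congr 1
    refine integral_congr_ae (ae_mem_slab.mono fun p hp => ?_)
    simp only [hβ, indicator_of_mem hp]
  have key := hw.ae_sub_eq (q := 2) (by norm_num) (Lp.memLp f) hβm
    (hβL.locallyIntegrable (by norm_num)) hh
  have key' := (timeShift_quasiMeasurePreserving (-h)).ae key
  set μ := slabMeasure d T with hμ
  have : SFinite μ := by rw [hμ, slabMeasure]; infer_instance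
  -- The product is dominated by the sum of the two squares, each integrable on the product space.
  have hprod : Integrable (fun x : SpaceTime d × ℝ => ψ x.1 * β (timeShift (x.2 - h) x.1))
      (μ.prod (volume.restrict (Ioc 0 h))) := by
    have b1 : Integrable (fun x : SpaceTime d × ℝ => (ψ x.1) ^ 2)
        (μ.prod (volume.restrict (Ioc 0 h))) := by
      have := (Lp.memLp ψ).integrable_sq.mul_prod (integrable_const (1 : ℝ)
        (μ := volume.restrict (Ioc 0 h)))
      simpa using this
    have b2 : Integrable (fun x : SpaceTime d × ℝ => (β (timeShift (x.2 - h) x.1)) ^ 2)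
        (μ.prod (volume.restrict (Ioc 0 h))) := by
      have := integrable_timeShift_prod (g := fun p => β (timeShift (-h) p) ^ 2)
        ((hβm.comp_measurable (continuous_timeShift _).measurable).pow 2)
        ((measurePreserving_timeShift (-h)).integrable_comp_of_integrable hβL.integrable_sq) h
      simp only [timeShift_timeShift, ← sub_eq_add_neg] at this
      exact this.mono_measure (Measure.prod_mono Measure.restrict_le_self le_rfl)
    refine (b1.add b2).mono' ?_ (Eventually.of_forall fun x => ?_)
    · refine ((Lp.stronglyMeasurable ψ).comp_measurable measurable_fst).aestronglyMeasurable.mul ?_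
      refine (hβm.comp_measurable ?_).aestronglyMeasurable
      exact (continuous_timeShift_uncurry.comp
        (by fun_prop : Continuous fun x : SpaceTime d × ℝ => (x.1, x.2 - h))).measurable
    · rw [Real.norm_eq_abs, abs_mul, Pi.add_apply]
      nlinarith [sq_nonneg (|ψ x.1| - |β (timeShift (x.2 - h) x.1)|), sq_abs (ψ x.1),
        sq_abs (β (timeShift (x.2 - h) x.1)), abs_nonneg (ψ x.1),
        abs_nonneg (β (timeShift (x.2 - h) x.1))]
  have hin : ∀ s : ℝ, ∫ p, ψ p * β (timeShift (s - h) p) ∂μ = ⟪ψ, shift (s - h) g⟫_ℝ := by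
    intro s
    rw [L2.inner_eq_integral]
    refine integral_congr_ae ?_
    filter_upwards [coeFn_shift (s - h) g] with p hp
    rw [hp]
  -- At points whose translate by `-h` leaves the slab, the zero extension may jump, but there `ψ`
  -- vanishes. Elsewhere the increment is the integral of `g` from `t - h` to `t`.
  have e : ⟪ψ, shift (-h) f - f⟫_ℝ = - ∫ s in (0 : ℝ)..h, ⟪ψ, shift (s - h) g⟫_ℝ := by
    simp only [← hin]
    rw [intervalIntegral.integral_of_le hh, ← integral_integral_swap hprod, L2.inner_eq_integral,
      ← integral_neg]
    refine integral_congr_ae ?_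
    filter_upwards [hψ, coeFn_shift (-h) f, Lp.coeFn_sub (shift (-h) f) f, ae_restrict_of_ae key',
      ae_mem_slab] with p h1 h2 h3 h4 h5
    rw [h3, Pi.sub_apply, h2, integral_const_mul]
    by_cases hp : timeShift (-h) p ∈ slab d T
    · have h6 := h4 hp (by simpa [timeShift_timeShift] using h5)
      simp only [timeShift_timeShift, neg_add_cancel, timeShift_zero] at h6
      rw [indicator_of_mem hp, ← intervalIntegral.integral_of_le hh]
      have h7 : ∀ s : ℝ, s - h = -h + s := fun s => by ring
      simp only [h7]
      rw [← h6]
      ring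
    · rw [h1 hp]
      simp
  rw [e, abs_neg, ← Real.norm_eq_abs]
  refine (intervalIntegral.norm_integral_le_of_norm_le_const (C := ‖ψ‖ * ‖g‖)
    fun s _ => ?_).trans_eq ?_
  · exact (norm_inner_le_norm _ _).trans
      (mul_le_mul_of_nonneg_left (norm_shift_le _ _) (norm_nonneg _))
  · rw [sub_zero, abs_of_nonneg hh]
    ring

end TimeIncrement

end TimeCommutator

/-! ### Commutators of resolvent powers with translations in time. -/

namespace TimeCommutator

open scoped ContDiff InnerProductSpace

variable {d : ℕ} {T : ℝ}

/-- Differences of matrix coefficients are admissible functionals in `norm_apply_semigroup_le`. With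
`K = 0` this also transfers identities, such as symmetry and commutation, from resolvents to the
semigroup. -/
theorem IsResolventFamily.abs_inner_sub_le {H : Type*} [NormedAddCommGroup H]
    [InnerProductSpace ℝ H] [CompleteSpace H] {G : Submodule ℝ (H × H)} {J : ℝ → H →L[ℝ] H}
    (hG : IsResolventFamily G J) {x y x' y' : H} {K : ℝ}
    (hK : ∀ τ, 0 < τ → ∀ k : ℕ, |⟪x, (J τ ^ k) y⟫_ℝ - ⟪x', (J τ ^ k) y'⟫_ℝ| ≤ K) (s : ℝ≥0) :
    |⟪x, hG.semigroup s y⟫_ℝ - ⟪x', hG.semigroup s y'⟫_ℝ| ≤ K := by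
  let ℓ : (H →L[ℝ] H) →L[ℝ] ℝ := (innerSL ℝ x).comp (ContinuousLinearMap.apply ℝ H y) -
    (innerSL ℝ x').comp (ContinuousLinearMap.apply ℝ H y')
  have hℓ : ∀ L, ℓ L = ⟪x, L y⟫_ℝ - ⟪x', L y'⟫_ℝ := fun L => rfl
  have := hG.norm_apply_semigroup_le ℓ (fun L M h => ?_) (K := K) (fun τ hτ k => hK τ hτ k) s
  · exact this
  · simp only [hℓ]
    exact (tendsto_const_nhds.inner (h y)).sub (tendsto_const_nhds.inner (h y'))

section MulOp

variable {m : SpaceTime d → ℝ} {C : ℝ}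

theorem memLp_mul (hm : Continuous m) (hC : ∀ p, |m p| ≤ C) (f : L2 d T) :
    MemLp (fun p => m p * f p) 2 (slabMeasure d T) := by
  refine (Lp.memLp f).of_le_mul (c := C) (hm.aestronglyMeasurable.mul (Lp.memLp f).1)
    (Eventually.of_forall fun p => ?_)
  rw [norm_mul]
  exact mul_le_mul_of_nonneg_right (hC p) (norm_nonneg _)

theorem memLp_smul (hm : Continuous m) (hC : ∀ p, |m p| ≤ C) (F : L2Vec d T) :
    MemLp (fun p => m p • F p) 2 (slabMeasure d T) := by
  refine (Lp.memLp F).of_le_mul (c := C) (hm.aestronglyMeasurable.smul (Lp.memLp F).1)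
    (Eventually.of_forall fun p => ?_)
  rw [norm_smul]
  exact mul_le_mul_of_nonneg_right (hC p) (norm_nonneg _)

/-- Multiplication by a bounded continuous function. -/
def mulOp (hm : Continuous m) (hC : ∀ p, |m p| ≤ C) : L2 d T →L[ℝ] L2 d T :=
  LinearMap.mkContinuous
    { toFun := fun f => (memLp_mul hm hC f).toLp _
      map_add' := fun f g => by
        refine Lp.ext ?_
        filter_upwards [(memLp_mul hm hC (f + g)).coeFn_toLp, (memLp_mul hm hC f).coeFn_toLp,
          (memLp_mul hm hC g).coeFn_toLp, Lp.coeFn_add f g, Lp.coeFn_add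
            ((memLp_mul hm hC f).toLp _) ((memLp_mul hm hC g).toLp _)] with p h1 h2 h3 h4 h5
        rw [h1, h5, Pi.add_apply, h2, h3, h4, Pi.add_apply, mul_add]
      map_smul' := fun c f => by
        refine Lp.ext ?_
        filter_upwards [(memLp_mul hm hC (c • f)).coeFn_toLp, (memLp_mul hm hC f).coeFn_toLp,
          Lp.coeFn_smul c f, Lp.coeFn_smul c ((memLp_mul hm hC f).toLp _)] with p h1 h2 h3 h4
        rw [h1, RingHom.id_apply, h4, Pi.smul_apply, h2, h3, Pi.smul_apply, smul_eq_mul,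
          smul_eq_mul]
        ring } |C| fun f => by
    refine Lp.norm_le_mul_norm_of_ae_le_mul ?_
    filter_upwards [(memLp_mul hm hC f).coeFn_toLp] with p hp
    simp only [LinearMap.coe_mk, AddHom.coe_mk]
    rw [hp, norm_mul]
    exact mul_le_mul_of_nonneg_right ((hC p).trans (le_abs_self C)) (norm_nonneg _)

theorem coeFn_mulOp (hm : Continuous m) (hC : ∀ p, |m p| ≤ C) (f : L2 d T) :
    mulOp hm hC f =ᵐ[slabMeasure d T] fun p => m p * f p :=
  (memLp_mul hm hC f).coeFn_toLp

theorem inner_mulOp (hm : Continuous m) (hC : ∀ p, |m p| ≤ C) (f g : L2 d T) :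
    ⟪mulOp hm hC f, g⟫_ℝ = ∫ p, m p * f p * g p ∂(slabMeasure d T) := by
  rw [L2.inner_eq_integral]
  exact integral_congr_ae ((coeFn_mulOp hm hC f).mono fun p hp => by simp only [hp])

theorem inner_mulOp_comm (hm : Continuous m) (hC : ∀ p, |m p| ≤ C) (f g : L2 d T) :
    ⟪mulOp hm hC f, g⟫_ℝ = ⟪f, mulOp hm hC g⟫_ℝ := by
  rw [real_inner_comm (mulOp hm hC g), inner_mulOp, inner_mulOp]
  exact integral_congr_ae (Eventually.of_forall fun p => by ring)

end MulOp

section TimeCutoff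

variable {a : SpaceTime d → Matrix (Fin d) (Fin d) ℝ} {C : ℝ} {η : ℝ → ℝ}

/-- Multiplication by a smooth bounded function of time. -/
def timeMul (η : ℝ → ℝ) (hη : ContDiff ℝ ∞ η) (hC : ∀ t, |η t| ≤ C) :
    L2 d T →L[ℝ] L2 d T :=
  mulOp (m := fun p : SpaceTime d => η p.1) (hη.continuous.comp continuous_fst) fun p => hC p.1

/-- A factor depending on time alone commutes with the spatial gradient and can be moved between the
two arguments of the form. -/
theorem opGraph_timeMul_mem {C' : ℝ} (hA : IsBoundedField T a C')
    (hη : ContDiff ℝ ∞ η) (hC : ∀ t, |η t| ≤ C) {f h : L2 d T}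
    (hf : (f, h) ∈ opGraph hA) : (timeMul η hη hC f, timeMul η hη hC h) ∈ opGraph hA := by
  have hgrad : ∀ {w : L2 d T} {W : L2Vec d T}, IsWeakGrad w W →
      IsWeakGrad (timeMul η hη hC w) ((memLp_smul (m := fun p : SpaceTime d => η p.1)
        (hη.continuous.comp continuous_fst) (fun p => hC p.1) W).toLp _) := by
    intro w W hw
    refine hw.mul (m := fun p : SpaceTime d => η p.1) (hη.comp contDiff_fst)
      (coeFn_mulOp _ _ _) fun i => ?_
    filter_upwards [(memLp_smul (m := fun p : SpaceTime d => η p.1)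
        (hη.continuous.comp continuous_fst) (fun p => hC p.1) W).coeFn_toLp] with p hp
    rw [hp]
    simp [spaceDeriv, spaceFDeriv]
  obtain ⟨F, hF, h1⟩ := (isDivFormOp_iff hA).1 hf
  refine (isDivFormOp_iff hA).2 ⟨_, hgrad hF, fun w W hw => ?_⟩
  have h2 := h1 _ _ (hgrad hw)
  rw [timeMul, inner_mulOp_comm]
  rw [timeMul] at h2
  rw [← h2, IsBoundedField.form_apply, IsBoundedField.form_apply]
  refine integral_congr_ae ?_
  filter_upwards [(memLp_smul (m := fun p : SpaceTime d => η p.1)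
    (hη.continuous.comp continuous_fst) (fun p => hC p.1) W).coeFn_toLp,
    (memLp_smul (m := fun p : SpaceTime d => η p.1)
    (hη.continuous.comp continuous_fst) (fun p => hC p.1) F).coeFn_toLp] with p h3 h4
  rw [h3, h4, matForm_smul_left, matForm_smul_right]

end TimeCutoff

section Commutator

variable {a dta : SpaceTime d → Matrix (Fin d) (Fin d) ℝ} {lam : ℝ}
  {J : ℝ → L2 d T →L[ℝ] L2 d T} {N : ℝ → L2 d T → L2Vec d T}

/-- After the change of variables `q = p + (r, 0)` both terms pair `F(p + (r, 0))` with `G(p)`,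
through `a(p + (r, 0))` and `a(p)` respectively. The Lipschitz bound in time for `a` applies to the
difference. -/
theorem abs_form_shift_sub_le (ha : IsBoundedElliptic T lam a) (hd : IsBoundedTimeDeriv T a dta)
    {r : ℝ} (hr : 0 ≤ r) (F G : L2Vec d T) :
    |ha.isBoundedField.form F (shift (-r) G) - ha.isBoundedField.form (shift r F) G| ≤
      r * (linfNorm T dta).toReal * ‖F‖ * ‖G‖ := by
  have hi := ha.isBoundedField.integrable F (shift (-r) G)
  rw [IsBoundedField.form_apply, IsBoundedField.form_apply]
  set k : SpaceTime d → ℝ := fun q => matForm (a q) (F q) (shift (-r) G q) with hk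
  have hki : Integrable (fun p => (slab d T).indicator k (timeShift r p)) (slabMeasure d T) := by
    have h1 : Integrable ((slab d T).indicator k) volume :=
      (integrable_indicator_iff (measurableSet_slab d T)).2 hi
    exact ((measurePreserving_timeShift r).integrable_comp_of_integrable h1).restrict
  have e1 : ∫ q, k q ∂(slabMeasure d T) =
      ∫ p, (slab d T).indicator k (timeShift r p) ∂(slabMeasure d T) := by
    rw [integral_indicator_timeShift]
    refine integral_congr_ae ?_
    filter_upwards [coeFn_shift (-r) G] with q hq
    by_cases hs : timeShift (-r) q ∈ slab d T
    · simp [hs]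
    · simp [hk, hq, hs]
  rw [e1, ← integral_sub hki (ha.isBoundedField.integrable _ _), ← Real.norm_eq_abs]
  have hM : 0 ≤ r * (linfNorm T dta).toReal := mul_nonneg hr ENNReal.toReal_nonneg
  have hb := integral_norm_mul_norm_le (shift r F) G
  refine (norm_integral_le_of_norm_le (hb.1.const_mul (r * (linfNorm T dta).toReal)) ?_).trans ?_
  · filter_upwards [hd.ae_abs_matForm_sub_le ha.meas ha.bounded hr, coeFn_shift r F, ae_mem_slab,
      ae_restrict_of_ae ((timeShift_quasiMeasurePreserving r).ae
        (ae_volume_of_ae_slab (coeFn_shift (-r) G)))] with p h1 h2 h3 h4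
    by_cases hs : timeShift r p ∈ slab d T
    · rw [Real.norm_eq_abs, h2, indicator_of_mem hs, indicator_of_mem hs]
      simp only [hk, h4 hs, timeShift_timeShift, add_neg_cancel, timeShift_zero,
        indicator_of_mem h3]
      rw [← mul_assoc]
      exact h1 hs _ _
    · rw [h2, indicator_of_notMem hs, indicator_of_notMem hs]
      simp
  · rw [integral_const_mul, mul_assoc (r * _)]
    refine mul_le_mul_of_nonneg_left (hb.2.trans ?_) hM
    exact mul_le_mul_of_nonneg_right (norm_shift_le _ _) (norm_nonneg _)

/-- In the two tested resolvent equations the zeroth-order terms agree, both being `⟪shift r (J τ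
φ), J τ g⟫`. Subtraction leaves `τ` times the difference of forms bounded by
`abs_form_shift_sub_le`. -/
theorem IsFormResolvent.abs_commutator_le (ha : IsBoundedElliptic T lam a)
    (hd : IsBoundedTimeDeriv T a dta) (hJ : IsFormResolvent ha.isBoundedField J N) {τ : ℝ}
    (hτ : 0 < τ) {r : ℝ} (hr : 0 ≤ r) (φ g : L2 d T) :
    |⟪shift r φ, J τ g⟫_ℝ - ⟪shift r (J τ φ), g⟫_ℝ| ≤
      τ * (r * (linfNorm T dta).toReal * ‖N τ φ‖ * ‖N τ g‖) := by
  have h1 := hJ.weak τ hτ φ _ _ ((hJ.grad τ hτ g).shift (-r))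
  have h2 := hJ.weak τ hτ g _ _ ((hJ.grad τ hτ φ).shift r)
  rw [← inner_shift, ← inner_shift] at h1
  rw [ha.form_comm, real_inner_comm, real_inner_comm (shift r (J τ φ)) g] at h2
  have e : ⟪shift r φ, J τ g⟫_ℝ - ⟪shift r (J τ φ), g⟫_ℝ =
      τ * (ha.isBoundedField.form (N τ φ) (shift (-r) (N τ g)) -
        ha.isBoundedField.form (shift r (N τ φ)) (N τ g)) := by
    linarith
  rw [e, abs_mul, abs_of_pos hτ]
  exact mul_le_mul_of_nonneg_left (abs_form_shift_sub_le ha hd hr _ _) hτ.le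

theorem IsFormResolvent.sum_norm_sq_le (ha : IsBoundedElliptic T lam a)
    (hJ : IsFormResolvent ha.isBoundedField J N) {τ : ℝ} (hτ : 0 < τ) (g : L2 d T) (n : ℕ) :
    τ * lam * ∑ k ∈ Finset.range n, ‖N τ ((J τ ^ k) g)‖ ^ 2 ≤ ‖g‖ ^ 2 / 2 := by
  have h1 : ∀ k ∈ Finset.range n, τ * lam * ‖N τ ((J τ ^ k) g)‖ ^ 2 ≤
      ‖(J τ ^ k) g‖ ^ 2 / 2 - ‖(J τ ^ (k + 1)) g‖ ^ 2 / 2 := by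
    intro k _
    have := hJ.energy ha hτ ((J τ ^ k) g)
    rw [pow_succ' (J τ), mul_apply_eq_comp]
    linarith
  rw [Finset.mul_sum]
  refine (Finset.sum_le_sum h1).trans ?_
  rw [Finset.sum_range_sub' fun k => ‖(J τ ^ k) g‖ ^ 2 / 2]
  have : 0 ≤ ‖(J τ ^ n) g‖ ^ 2 / 2 := by positivity
  simp only [pow_zero, one_apply_eq_self]
  linarith

/-- The naive sum of `n` commutators is not bounded uniformly in `n`; the gain is that the gradients
along the iterates are square summable with total of order `1/(τ λ)`, which absorbs the factor `τ`.
Half of `1/λ` remains, from the energy estimate. -/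
theorem IsFormResolvent.abs_commutator_pow_le (ha : IsBoundedElliptic T lam a) (hlam : 0 < lam)
    (hd : IsBoundedTimeDeriv T a dta) (hJ : IsFormResolvent ha.isBoundedField J N) {τ : ℝ}
    (hτ : 0 < τ) {r : ℝ} (hr : 0 ≤ r) (φ g : L2 d T) (n : ℕ) :
    |⟪shift r φ, (J τ ^ n) g⟫_ℝ - ⟪shift r ((J τ ^ n) φ), g⟫_ℝ| ≤
      r * (1 / (2 * lam) * (linfNorm T dta).toReal * ‖φ‖ * ‖g‖) := by
  set M := (linfNorm T dta).toReal with hM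
  have hM0 : 0 ≤ M := ENNReal.toReal_nonneg
  set x : ℕ → ℝ := fun k => ‖N τ ((J τ ^ k) φ)‖
  set y : ℕ → ℝ := fun k => ‖N τ ((J τ ^ k) g)‖
  have h1 : |⟪shift r φ, (J τ ^ n) g⟫_ℝ - ⟪shift r ((J τ ^ n) φ), g⟫_ℝ| ≤
      τ * r * M * ∑ k ∈ Finset.range n, x k * y (n - 1 - k) := by
    -- Move one factor `J τ` at a time from `g` to `φ`. The `k`-th step is the one-step commutator
    -- for `J τ ^ k φ` and `J τ ^ (n - 1 - k) g`.
    have h2 := Finset.sum_range_sub' (fun k => ⟪shift r ((J τ ^ k) φ), (J τ ^ (n - k)) g⟫_ℝ) n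
    simp only [pow_zero, one_apply_eq_self, tsub_zero, tsub_self] at h2
    rw [← h2, Finset.mul_sum]
    refine (Finset.abs_sum_le_sum_abs _ _).trans (Finset.sum_le_sum fun k hk => ?_)
    have hkn := Finset.mem_range.1 hk
    have h3 := hJ.abs_commutator_le ha hd hτ hr ((J τ ^ k) φ) ((J τ ^ (n - 1 - k)) g)
    have e1 : n - k = (n - 1 - k) + 1 := by omega
    have e2 : n - (k + 1) = n - 1 - k := by omega
    rw [e1, e2, pow_succ' _ (n - 1 - k), pow_succ' _ k, mul_apply_eq_comp,
      mul_apply_eq_comp]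
    refine h3.trans_eq ?_
    simp only [x, y, hM]
    ring
  have h2 : (∑ k ∈ Finset.range n, x k * y (n - 1 - k)) ^ 2 ≤
      (∑ k ∈ Finset.range n, x k ^ 2) * ∑ k ∈ Finset.range n, y k ^ 2 := by
    rw [← Finset.sum_range_reflect (fun k => y k ^ 2) n]
    exact Finset.sum_mul_sq_le_sq_mul_sq _ _ _
  have h3 := hJ.sum_norm_sq_le ha hτ φ n
  have h4 := hJ.sum_norm_sq_le ha hτ g n
  have h5 : τ * lam * ∑ k ∈ Finset.range n, x k * y (n - 1 - k) ≤ ‖φ‖ * ‖g‖ / 2 := by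
    refine (abs_le_of_sq_le_sq' ?_ (by positivity)).2
    calc (τ * lam * ∑ k ∈ Finset.range n, x k * y (n - 1 - k)) ^ 2
        = (τ * lam) ^ 2 * (∑ k ∈ Finset.range n, x k * y (n - 1 - k)) ^ 2 := by ring
      _ ≤ (τ * lam) ^ 2 * ((∑ k ∈ Finset.range n, x k ^ 2) * ∑ k ∈ Finset.range n, y k ^ 2) := by
          gcongr
      _ = (τ * lam * ∑ k ∈ Finset.range n, x k ^ 2) *
          (τ * lam * ∑ k ∈ Finset.range n, y k ^ 2) := by ring
      _ ≤ (‖φ‖ ^ 2 / 2) * (‖g‖ ^ 2 / 2) := by gcongr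
      _ = (‖φ‖ * ‖g‖ / 2) ^ 2 := by ring
  refine h1.trans ?_
  calc τ * r * M * ∑ k ∈ Finset.range n, x k * y (n - 1 - k)
      = r * M / lam * (τ * lam * ∑ k ∈ Finset.range n, x k * y (n - 1 - k)) := by
        field_simp
    _ ≤ r * M / lam * (‖φ‖ * ‖g‖ / 2) := by gcongr
    _ = r * (1 / (2 * lam) * M * ‖φ‖ * ‖g‖) := by
        field_simp

end Commutator

end TimeCommutator

/-! ### Weighted energy estimates and integrability of the semigroup. -/

namespace TimeCommutator

open scoped ContDiff InnerProductSpace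

variable {d : ℕ} {T : ℝ}

section Weight

/-- The growth function `(1 + |x|²)^d`. -/
def growth (x : EuclideanSpace ℝ (Fin d)) : ℝ := (1 + ‖x‖ ^ 2) ^ d

/-- Bounded regularizations of `growth`. -/
def weight (ε : ℝ) (p : SpaceTime d) : ℝ := growth p.2 / (1 + ε * growth p.2)

theorem growth_pos (x : EuclideanSpace ℝ (Fin d)) : 0 < growth x := by unfold growth; positivity

theorem contDiff_growth : ContDiff ℝ ∞ (growth (d := d)) :=
  (contDiff_const.add (contDiff_norm_sq ℝ)).pow d

variable {ε : ℝ}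

theorem weight_denom_pos (hε : 0 ≤ ε) (x : EuclideanSpace ℝ (Fin d)) : 0 < 1 + ε * growth x := by
  have := growth_pos x
  positivity

theorem contDiff_weight (hε : 0 ≤ ε) : ContDiff ℝ ∞ (weight (d := d) ε) :=
  (contDiff_growth.comp contDiff_snd).div
    (contDiff_const.add (contDiff_const.mul (contDiff_growth.comp contDiff_snd)))
    fun p => (weight_denom_pos hε p.2).ne'

theorem weight_nonneg (hε : 0 ≤ ε) (p : SpaceTime d) : 0 ≤ weight ε p :=
  div_nonneg (growth_pos _).le (weight_denom_pos hε _).le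

theorem weight_le_growth (hε : 0 ≤ ε) (p : SpaceTime d) : weight ε p ≤ growth p.2 := by
  have h := growth_pos p.2
  rw [weight, div_le_iff₀ (weight_denom_pos hε _)]
  nlinarith [mul_nonneg hε h.le]

theorem abs_weight_le (hε : 0 < ε) (p : SpaceTime d) : |weight ε p| ≤ ε⁻¹ := by
  rw [abs_of_nonneg (weight_nonneg hε.le p), weight, div_le_iff₀ (weight_denom_pos hε.le _),
    mul_add, inv_mul_cancel_left₀ hε.ne']
  have : 0 < ε⁻¹ := by positivity
  linarith

/-- As a function of `y = |x|²` the weight has derivative `d (1 + y)^(d-1) / (1 + ε (1 + y)^d)²`,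
and `2|x| ≤ 1 + y`. What matters is that the constant `d` does not depend on `ε`. -/
theorem norm_spaceFDeriv_weight_le (hε : 0 ≤ ε) (p : SpaceTime d) :
    ‖spaceFDeriv (weight ε) p‖ ≤ d * weight ε p := by
  set y : ℝ := ‖p.2‖ ^ 2 with hy
  have hy0 : 0 ≤ y := by positivity
  have hD : 0 < 1 + ε * (1 + y) ^ d := by positivity
  have h1 : HasDerivAt (fun y : ℝ => (1 + y) ^ d) (d * (1 + y) ^ (d - 1)) y := by
    simpa using ((hasDerivAt_id y).const_add 1).fun_pow d
  have h2 : HasDerivAt (fun y : ℝ => (1 + y) ^ d / (1 + ε * (1 + y) ^ d))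
      (d * (1 + y) ^ (d - 1) / (1 + ε * (1 + y) ^ d) ^ 2) y := by
    refine (h1.fun_div ((h1.const_mul ε).const_add 1) hD.ne').congr_deriv ?_
    congr 1
    ring
  have h3 := h2.comp_hasFDerivAt (f := fun x => ‖x‖ ^ 2) p.2
    (hasStrictFDerivAt_norm_sq p.2).hasFDerivAt
  have h3' : fderiv ℝ (fun x => weight ε (p.1, x)) p.2 = _ := h3.fderiv
  rw [spaceFDeriv, h3', norm_smul, two_nsmul, ← two_smul ℝ, norm_smul, innerSL_apply_norm,
    Real.norm_of_nonneg (by positivity), Real.norm_of_nonneg zero_le_two]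
  have h4 : 2 * ‖p.2‖ ≤ 1 + y := by nlinarith [sq_nonneg (‖p.2‖ - 1)]
  have h5 : (d : ℝ) * (1 + y) ^ (d - 1) * (2 * ‖p.2‖) ≤ d * (1 + y) ^ d := by
    rcases Nat.eq_zero_or_pos d with h0 | h0
    · simp [h0]
    · calc (d : ℝ) * (1 + y) ^ (d - 1) * (2 * ‖p.2‖) ≤ d * (1 + y) ^ (d - 1) * (1 + y) := by gcongr
        _ = d * (1 + y) ^ d := by rw [mul_assoc, ← pow_succ, Nat.sub_add_cancel h0]
  have h6 : weight ε p = (1 + y) ^ d / (1 + ε * (1 + y) ^ d) := rfl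
  rw [h6, div_mul_eq_mul_div, ← mul_div_assoc]
  have h7 : 1 + ε * (1 + y) ^ d ≤ (1 + ε * (1 + y) ^ d) ^ 2 := by
    refine le_self_pow₀ ?_ two_ne_zero
    have : 0 ≤ ε * (1 + y) ^ d := by positivity
    linarith
  exact div_le_div₀ (by positivity) h5 hD h7

/-- The gradient in space as a vector field. -/
def gradVec (m : SpaceTime d → ℝ) (p : SpaceTime d) : EuclideanSpace ℝ (Fin d) :=
  WithLp.toLp 2 fun i => spaceDeriv i m p

theorem norm_gradVec_le (m : SpaceTime d → ℝ) (p : SpaceTime d) :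
    ‖gradVec m p‖ ≤ ‖spaceFDeriv m p‖ := by
  have h1 : spaceFDeriv m p (gradVec m p) = ‖gradVec m p‖ ^ 2 := by
    have h2 : gradVec m p = ∑ i, gradVec m p i • EuclideanSpace.single i (1 : ℝ) := by
      ext j
      simp [Finset.sum_apply, Pi.single_apply]
    rw [EuclideanSpace.norm_sq_eq]
    nth_rw 1 [h2]
    rw [map_sum]
    refine Finset.sum_congr rfl fun i _ => ?_
    rw [map_smul, Real.norm_eq_abs, sq_abs, sq, smul_eq_mul]
    rfl
  have h3 := (spaceFDeriv m p).le_opNorm (gradVec m p)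
  rw [h1, Real.norm_of_nonneg (by positivity)] at h3
  by_contra! h4
  nlinarith [norm_nonneg (spaceFDeriv m p), norm_nonneg (gradVec m p)]

theorem IsC12On.continuous_gradVec {m : SpaceTime d → ℝ} (hm : IsC12On univ m) :
    Continuous (gradVec m) :=
  (PiLp.continuous_toLp 2 _).comp (continuous_pi fun i => hm.continuous_spaceDeriv i)

/-- Multiplication by a weight. -/
def weightOp (hε : 0 < ε) : L2 d T →L[ℝ] L2 d T :=
  mulOp (contDiff_weight hε.le).continuous (abs_weight_le hε)

theorem inner_weightOp (hε : 0 < ε) (f g : L2 d T) :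
    ⟪weightOp hε f, g⟫_ℝ = ∫ p, weight ε p * f p * g p ∂(slabMeasure d T) := inner_mulOp _ _ f g

/-- Test the equation with `w f`, where `w` is the weight. Ellipticity gives `-λ w |F|²`, which
absorbs the cross term `f a(F, ∇w)` because `|∇w| ≤ d w`. Completing the square leaves a constant
independent of `ε`. -/
theorem inner_weightOp_opGraph_le {a : SpaceTime d → Matrix (Fin d) (Fin d) ℝ} {lam C : ℝ}
    (ha : IsBoundedElliptic T lam a) (hlam : 0 < lam) (hA : IsBoundedField T a C) (hε : 0 < ε)
    {f h : L2 d T} (hf : (f, h) ∈ opGraph hA) :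
    ⟪weightOp hε f, h⟫_ℝ ≤ (C * d) ^ 2 / (4 * lam) * ⟪weightOp hε f, f⟫_ℝ := by
  obtain ⟨F, hF, h1⟩ := (isDivFormOp_iff hA).1 hf
  have hw := contDiff_weight (d := d) hε.le
  have hg : ∀ p : SpaceTime d, ‖gradVec (weight ε) p‖ ≤ d * weight ε p := fun p =>
    (norm_gradVec_le _ _).trans (norm_spaceFDeriv_weight_le hε.le p)
  have m1 := memLp_smul hw.continuous (abs_weight_le hε) F
  have m2 : MemLp (fun p => f p • gradVec (weight ε) p) 2 (slabMeasure d T) := by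
    refine (Lp.memLp f).of_le_mul (c := d * ε⁻¹) ((Lp.memLp f).1.smul
      (isC12On_of_contDiff hw univ).continuous_gradVec.aestronglyMeasurable)
      (Eventually.of_forall fun p => ?_)
    rw [norm_smul, mul_comm]
    refine mul_le_mul_of_nonneg_right ((hg p).trans ?_) (norm_nonneg _)
    exact mul_le_mul_of_nonneg_left ((le_abs_self _).trans (abs_weight_le hε p)) d.cast_nonneg
  have hG : IsWeakGrad (weightOp hε f) ((m1.add m2).toLp _) := by
    refine hF.mul hw (coeFn_mulOp _ _ _) fun i => ?_
    filter_upwards [(m1.add m2).coeFn_toLp] with p hp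
    rw [hp]
    simp [gradVec]
  rw [real_inner_comm, ← neg_neg ⟪h, _⟫_ℝ, ← h1 _ _ hG, inner_weightOp, IsBoundedField.form_apply,
    ← integral_const_mul, ← integral_neg]
  have i1 : Integrable (fun p => weight ε p * f p * f p) (slabMeasure d T) :=
    integrable_mul_of_memLp (memLp_mul hw.continuous (abs_weight_le hε) f) (Lp.memLp f)
  refine integral_mono_ae (hA.integrable _ _).neg (i1.const_mul _) ?_
  filter_upwards [(m1.add m2).coeFn_toLp, ha.elliptic, hA.bound] with p hp he hb
  simp only [hp, Pi.add_apply]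
  rw [matForm_add_right, matForm_smul_right, matForm_smul_right]
  have w0 := weight_nonneg hε.le p
  have b1 := mul_le_mul_of_nonneg_left (he (F p)) w0
  have b2 : -(f p * matForm (a p) (F p) (gradVec (weight ε) p)) ≤
      |f p| * (|C| * ‖F p‖ * (d * weight ε p)) := by
    refine (neg_le_abs _).trans ?_
    rw [abs_mul]
    refine mul_le_mul_of_nonneg_left ((hb _ _).trans ?_) (abs_nonneg _)
    have := le_abs_self C
    have := hg p
    gcongr
  have b3 : |f p| * (|C| * ‖F p‖ * (d * weight ε p)) ≤ weight ε p * (lam * ‖F p‖ ^ 2) +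
      (C * d) ^ 2 / (4 * lam) * (weight ε p * f p * f p) := by
    have e : weight ε p * (lam * ‖F p‖ ^ 2) + (C * d) ^ 2 / (4 * lam) * (weight ε p * f p * f p) -
        |f p| * (|C| * ‖F p‖ * (d * weight ε p)) =
        weight ε p * (2 * lam * ‖F p‖ - |C| * d * |f p|) ^ 2 / (4 * lam) := by
      have hC : C ^ 2 = |C| ^ 2 := (sq_abs C).symm
      have hfp : f p * f p = |f p| ^ 2 := by rw [sq_abs, sq]
      rw [mul_assoc (weight ε p) (f p), hfp, mul_pow C, hC]
      field_simp
      ring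
    have : 0 ≤ weight ε p * (2 * lam * ‖F p‖ - |C| * d * |f p|) ^ 2 / (4 * lam) := by positivity
    linarith
  linarith

end Weight

section L1

/-- The power `d` of `1 + |x|²` decays like `|x|^(-2d)`, which is integrable on `ℝ^d` since `2d >
d`; the time interval is bounded. -/
theorem integrable_inv_growth (hd : 1 ≤ d) :
    Integrable (fun p : SpaceTime d => (growth p.2)⁻¹) (slabMeasure d T) := by
  have h1 : Integrable (fun x : EuclideanSpace ℝ (Fin d) => (growth x)⁻¹) volume := by
    have hd' : (1 : ℝ) ≤ d := by exact_mod_cast hd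
    have h2 := integrable_rpow_neg_one_add_norm_sq (E := EuclideanSpace ℝ (Fin d))
      (μ := volume) (r := 2 * d) (by rw [finrank_euclideanSpace_fin]; linarith)
    refine h2.congr (Eventually.of_forall fun x => ?_)
    have : -(2 * (d : ℝ)) / 2 = -(d : ℝ) := by ring
    simp only [this, growth]
    rw [Real.rpow_neg (by positivity), Real.rpow_natCast]
  have h3 : slabMeasure d T = (volume.restrict (Ioo 0 T)).prod volume := by
    rw [slabMeasure, slab, Measure.volume_eq_prod, ← Measure.prod_restrict, Measure.restrict_univ]
  have h4 := (integrable_const (1 : ℝ) (μ := volume.restrict (Ioo 0 T))).mul_prod h1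
  rw [h3]
  simpa using h4

/-- Fatou's lemma along `ε = 1/(n + 1)`, as the bounded weights converge to the growth function. -/
theorem integrable_growth_mul_sq {v : L2 d T} {K : ℝ}
    (hK : ∀ ε (hε : 0 < ε), ⟪weightOp hε v, v⟫_ℝ ≤ K) :
    Integrable (fun p => growth p.2 * v p ^ 2) (slabMeasure d T) := by
  have hc : Continuous fun p : SpaceTime d => growth p.2 :=
    contDiff_growth.continuous.comp continuous_snd
  have hm : ∀ w : SpaceTime d → ℝ, Continuous w →
      AEStronglyMeasurable (fun p => w p * v p ^ 2) (slabMeasure d T) := fun w hw =>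
    hw.aestronglyMeasurable.mul ((Lp.memLp v).1.pow 2)
  refine ⟨hm _ hc, ?_⟩
  have hpos : ∀ p, 0 ≤ growth p.2 * v p ^ 2 := fun p => by
    have := growth_pos p.2
    positivity
  rw [hasFiniteIntegral_iff_ofReal (Eventually.of_forall hpos)]
  let e : ℕ → ℝ := fun n => 1 / ((n : ℝ) + 1)
  have he : ∀ n, 0 < e n := fun n => by positivity
  have hlim : ∀ p : SpaceTime d, Tendsto (fun n => ENNReal.ofReal (weight (e n) p * v p ^ 2)) atTop
      (𝓝 (ENNReal.ofReal (growth p.2 * v p ^ 2))) := by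
    intro p
    refine ENNReal.tendsto_ofReal (Tendsto.mul_const _ ?_)
    have h1 := (tendsto_one_div_add_atTop_nhds_zero_nat (𝕜 := ℝ)).mul_const (growth p.2)
    have h2 := (h1.const_add 1)
    rw [zero_mul, add_zero] at h2
    have h3 := (tendsto_const_nhds (x := growth p.2)).div h2 one_ne_zero
    rw [div_one] at h3
    exact h3
  have hle : ∀ n, ∫⁻ p, ENNReal.ofReal (weight (e n) p * v p ^ 2) ∂(slabMeasure d T) ≤
      ENNReal.ofReal K := by
    intro n
    have i1 : Integrable (fun p => weight (e n) p * v p ^ 2) (slabMeasure d T) := by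
      have := integrable_mul_of_memLp (memLp_mul (contDiff_weight (he n).le).continuous
        (abs_weight_le (he n)) v) (Lp.memLp v)
      refine this.congr (Eventually.of_forall fun p => ?_)
      simp only
      ring
    rw [← ofReal_integral_eq_lintegral_ofReal i1 (Eventually.of_forall fun p =>
      mul_nonneg (weight_nonneg (he n).le p) (sq_nonneg _))]
    refine ENNReal.ofReal_le_ofReal ?_
    have := hK (e n) (he n)
    rw [inner_weightOp] at this
    refine le_of_eq_of_le (integral_congr_ae (Eventually.of_forall fun p => ?_)) this
    simp only
    ring
  calc ∫⁻ p, ENNReal.ofReal (growth p.2 * v p ^ 2) ∂(slabMeasure d T)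
      = ∫⁻ p, liminf (fun n => ENNReal.ofReal (weight (e n) p * v p ^ 2)) atTop
          ∂(slabMeasure d T) := lintegral_congr fun p => (hlim p).liminf_eq.symm
    _ ≤ liminf (fun n => ∫⁻ p, ENNReal.ofReal (weight (e n) p * v p ^ 2) ∂(slabMeasure d T)) atTop :=
        lintegral_liminf_le' fun n =>
          (hm _ (contDiff_weight (he n).le).continuous).aemeasurable.ennreal_ofReal
    _ ≤ liminf (fun _ : ℕ => ENNReal.ofReal K) atTop :=
        liminf_le_liminf (Eventually.of_forall hle)
    _ < ⊤ := by simp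

theorem integrable_of_inner_weightOp_le (hd : 1 ≤ d) {v : L2 d T} {K : ℝ}
    (hK : ∀ ε (hε : 0 < ε), ⟪weightOp hε v, v⟫_ℝ ≤ K) : Integrable v (slabMeasure d T) := by
  refine ((integrable_growth_mul_sq hK).add (integrable_inv_growth hd)).mono' (Lp.memLp v).1
    (Eventually.of_forall fun p => ?_)
  have h1 := growth_pos p.2
  -- A pointwise form of Cauchy–Schwarz: `2|v| ≤ ρ v² + ρ⁻¹`, where `ρ` is the growth function.
  have h2 : growth p.2 * v p ^ 2 + (growth p.2)⁻¹ - 2 * |v p| =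
      (growth p.2 * |v p| - 1) ^ 2 / growth p.2 := by
    rw [← sq_abs (v p)]
    field_simp
    ring
  have h3 : 0 ≤ (growth p.2 * |v p| - 1) ^ 2 / growth p.2 := by positivity
  rw [Pi.add_apply, Real.norm_eq_abs]
  linarith [abs_nonneg (v p)]

/-- The semigroup maps square integrable functions of compact support to integrable functions. -/
theorem IsSemigroupOf.integrable_apply (hd : 1 ≤ d) {a : SpaceTime d → Matrix (Fin d) (Fin d) ℝ}
    {lam C : ℝ} (ha : IsBoundedElliptic T lam a) (hlam : 0 < lam) (hA : IsBoundedField T a C)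
    {P : ℝ≥0 → (L2 d T →L[ℝ] L2 d T)} (hP : IsSemigroupOf (opGraph hA) P)
    (hG : Dense {f : L2 d T | ∃ h, (f, h) ∈ opGraph hA}) {u : L2 d T} {K : Set (SpaceTime d)}
    (hK : IsCompact K) (hu : ∀ᵐ p ∂(slabMeasure d T), p ∉ K → u p = 0) (s : ℝ≥0) :
    Integrable (P s u) (slabMeasure d T) := by
  have hc : Continuous fun p : SpaceTime d => growth p.2 :=
    contDiff_growth.continuous.comp continuous_snd
  obtain ⟨B, hB⟩ := hK.exists_bound_of_continuousOn hc.continuousOn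
  refine integrable_of_inner_weightOp_le hd
    (K := Real.exp (2 * ((C * d) ^ 2 / (4 * lam)) * s) * (|B| * ‖u‖ ^ 2)) fun ε hε => ?_
  refine (hP.inner_le (W := weightOp hε) hG (inner_mulOp_comm _ _)
    (fun f h hf => inner_weightOp_opGraph_le ha hlam hA hε hf) s u).trans ?_
  refine mul_le_mul_of_nonneg_left ?_ (Real.exp_pos _).le
  rw [inner_weightOp, ← real_inner_self_eq_norm_sq, L2.inner_eq_integral, ← integral_const_mul]
  refine integral_mono_ae (integrable_mul_of_memLp (memLp_mul (contDiff_weight hε.le).continuous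
    (abs_weight_le hε) u) (Lp.memLp u))
    ((integrable_mul_of_memLp (Lp.memLp u) (Lp.memLp u)).const_mul _) ?_
  filter_upwards [hu] with p hp
  by_cases hpK : p ∈ K
  · rw [mul_assoc]
    refine mul_le_mul_of_nonneg_right ?_ (mul_self_nonneg _)
    exact (weight_le_growth hε.le p).trans ((le_abs_self _).trans ((hB p hpK).trans
      (le_abs_self B)))
  · simp [hp hpK]

end L1

end TimeCommutator

/-! ### Transfer to the semigroup and passage to the limit in difference quotients. -/

namespace TimeCommutator

open scoped ContDiff InnerProductSpace

variable {d : ℕ} {T : ℝ}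

section Abstract

variable {H : Type*} [NormedAddCommGroup H] [InnerProductSpace ℝ H] [CompleteSpace H]
  {G : Submodule ℝ (H × H)} {J : ℝ → H →L[ℝ] H}

theorem IsResolventFamily.inner_semigroup_comm (hG : IsResolventFamily G J)
    (hJ : ∀ τ, 0 < τ → ∀ f g, ⟪J τ f, g⟫_ℝ = ⟪f, J τ g⟫_ℝ) (s : ℝ≥0) (f g : H) :
    ⟪hG.semigroup s f, g⟫_ℝ = ⟪f, hG.semigroup s g⟫_ℝ := by
  have hpow : ∀ τ, 0 < τ → ∀ k : ℕ, ⟪g, (J τ ^ k) f⟫_ℝ = ⟪f, (J τ ^ k) g⟫_ℝ := by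
    intro τ hτ k
    have h : ∀ x y, ⟪(J τ ^ k) x, y⟫_ℝ = ⟪x, (J τ ^ k) y⟫_ℝ := by
      induction k with
      | zero => simp
      | succ k ih =>
        intro x y
        nth_rw 2 [pow_succ]
        rw [pow_succ', mul_apply_eq_comp, mul_apply_eq_comp, hJ τ hτ, ih]
    rw [← h, real_inner_comm]
  have := hG.abs_inner_sub_le (x := g) (y := f) (x' := f) (y' := g) (K := 0)
    (fun τ hτ k => by rw [hpow τ hτ k, sub_self, abs_zero]) s
  rw [real_inner_comm]
  exact sub_eq_zero.1 (abs_nonpos_iff.1 this)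

theorem IsResolventFamily.semigroup_comm (hG : IsResolventFamily G J) {M : H →L[ℝ] H}
    (hM : ∀ f h, (f, h) ∈ G → (M f, M h) ∈ G) (hs : ∀ f g, ⟪M f, g⟫_ℝ = ⟪f, M g⟫_ℝ) (s : ℝ≥0)
    (f : H) : hG.semigroup s (M f) = M (hG.semigroup s f) := by
  have h1 : ∀ τ, 0 < τ → ∀ x, J τ (M x) = M (J τ x) := by
    intro τ hτ x
    have := hG.apply_eq hτ (hM _ _ (hG.mem τ hτ x))
    rwa [map_smul, smul_inv_smul₀ hτ.ne', map_sub M, sub_sub_cancel] at this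
  have h2 : ∀ τ, 0 < τ → ∀ (k : ℕ) x, (J τ ^ k) (M x) = M ((J τ ^ k) x) := by
    intro τ hτ k
    induction k with
    | zero => simp
    | succ k ih =>
      intro x
      rw [pow_succ, mul_apply_eq_comp, mul_apply_eq_comp, h1 τ hτ, ih]
  refine ext_inner_left ℝ fun y => ?_
  have := hG.abs_inner_sub_le (x := y) (y := M f) (x' := M y) (y' := f) (K := 0)
    (fun τ hτ k => by rw [h2 τ hτ k, hs, sub_self, abs_zero]) s
  rw [← hs]
  exact sub_eq_zero.1 (abs_nonpos_iff.1 this)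

/-- Riesz representation of a bounded functional given by its graph. -/
theorem exists_inner_eq_of_graph (S : Submodule ℝ (H × ℝ)) {C : ℝ}
    (hS : ∀ x ∈ S, |x.2| ≤ C * ‖x.1‖) : ∃ g : H, ∀ x ∈ S, x.2 = ⟪g, x.1⟫_ℝ := by
  let ι : S →ₗ[ℝ] H := (LinearMap.fst ℝ H ℝ).comp S.subtype
  let ℓ : S →ₗ[ℝ] ℝ := (LinearMap.snd ℝ H ℝ).comp S.subtype
  -- The bound makes the second component a function of the first, so the functional descends to the
  -- range. Hahn–Banach then extends it before Riesz applies.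
  have hker : LinearMap.ker ι ≤ LinearMap.ker ℓ := by
    intro x hx
    have h1 : x.1.1 = 0 := hx
    have h2 := hS x.1 x.2
    rw [h1, norm_zero, mul_zero] at h2
    exact abs_nonpos_iff.1 h2
  let ℓ' : LinearMap.range ι →ₗ[ℝ] ℝ :=
    ((LinearMap.ker ι).liftQ ℓ hker).comp ι.quotKerEquivRange.symm.toLinearMap
  have hℓ' : ∀ x : S, ℓ' ⟨ι x, x, rfl⟩ = x.1.2 := by
    intro x
    have : ι.quotKerEquivRange.symm ⟨ι x, x, rfl⟩ = (LinearMap.ker ι).mkQ x := by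
      rw [LinearEquiv.symm_apply_eq]
      rfl
    change (LinearMap.ker ι).liftQ ℓ hker (ι.quotKerEquivRange.symm ⟨ι x, x, rfl⟩) = _
    rw [this]
    rfl
  obtain ⟨L, hL, -⟩ := exists_extension_norm_eq (LinearMap.range ι)
    (ℓ'.mkContinuous C fun y => by
      obtain ⟨-, x, rfl⟩ := y
      rw [hℓ']
      exact hS x.1 x.2)
  refine ⟨(InnerProductSpace.toDual ℝ H).symm L, fun x hx => ?_⟩
  rw [InnerProductSpace.toDual_symm_apply]
  have h1 := hL ⟨ι ⟨x, hx⟩, ⟨x, hx⟩, rfl⟩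
  have h2 := hℓ' ⟨x, hx⟩
  exact h2.symm.trans h1.symm

end Abstract

section TimeSupport

/-- Vanishing near the initial and the final time. -/
def HasTimeMargin (δ : ℝ) (u : L2 d T) : Prop :=
  ∀ᵐ p ∂(slabMeasure d T), p.1 < δ ∨ T - δ < p.1 → u p = 0

theorem HasTimeMargin.mono {δ δ' : ℝ} {u : L2 d T} (hu : HasTimeMargin δ u) (h : δ' ≤ δ) :
    HasTimeMargin δ' u := by
  filter_upwards [hu] with p hp h1
  exact hp (h1.imp (fun h => by linarith) (fun h => by linarith))

theorem HasTimeMargin.ae_eq_zero {δ r : ℝ} {u : L2 d T} (hu : HasTimeMargin δ u) (hr : 0 ≤ r)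
    (hrδ : r < δ) : ∀ᵐ p ∂(slabMeasure d T), timeShift (-r) p ∉ slab d T → u p = 0 := by
  filter_upwards [hu, ae_mem_slab] with p hp hps h
  refine hp (Or.inl ?_)
  by_contra! h1
  have h2 := hps.1.2
  exact h ⟨⟨by simp only [timeShift]; linarith, by simp only [timeShift]; linarith⟩, trivial⟩

theorem IsTestC.exists_hasTimeMargin {φ : SpaceTime d → ℝ} (hφ : IsTestC T φ) :
    ∃ δ > 0, HasTimeMargin δ (hφ.memLp.toLp φ) := by
  obtain ⟨K, hK, hKs, h0⟩ := hφ.compact_supp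
  obtain ⟨δ, hδ, h1⟩ := exists_time_margin hK hKs
  refine ⟨δ, hδ, ?_⟩
  filter_upwards [hφ.memLp.coeFn_toLp, ae_mem_slab] with p hp hps h2
  rw [hp]
  refine h0 p hps fun hpK => ?_
  have := h1 p hpK
  rcases h2 with h2 | h2 <;> linarith

/-- A cutoff `η(t)` equal to one on `[δ, T - δ]` fixes `u` and commutes with the semigroup, so the
image of `u` equals `η` times itself. The new margin `1/n` is the same for all times `s`. -/
theorem HasTimeMargin.semigroup {a : SpaceTime d → Matrix (Fin d) (Fin d) ℝ} {C : ℝ}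
    {hA : IsBoundedField T a C} {J : ℝ → L2 d T →L[ℝ] L2 d T}
    (hG : IsResolventFamily (opGraph hA) J) {δ : ℝ} {u : L2 d T} (hu : HasTimeMargin δ u)
    (hδ : 0 < δ) : ∃ δ' > 0, ∀ s, HasTimeMargin δ' (hG.semigroup s u) := by
  obtain ⟨n, hn, hn0⟩ := ((eventually_cutoff_eq_one (T := T) hδ).and (eventually_gt_atTop 0)).exists
  have hn0' : (0 : ℝ) < n := by exact_mod_cast hn0
  have hc : ∀ t, |cutoff T n t| ≤ 1 := fun t => by
    rw [abs_of_nonneg (cutoff_nonneg n t)]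
    exact cutoff_le_one n t
  have h1 : timeMul (cutoff T n) (contDiff_cutoff n) hc u = u := by
    refine Lp.ext ?_
    filter_upwards [coeFn_mulOp ((contDiff_cutoff (T := T) n).continuous.comp continuous_fst)
      (fun p : SpaceTime d => hc p.1) u, hu] with p h2 h3
    refine Eq.trans h2 ?_
    by_cases h4 : p.1 < δ ∨ T - δ < p.1
    · rw [h3 h4, mul_zero]
    · push Not at h4
      rw [Function.comp_apply, hn _ h4.1 h4.2, one_mul]
  refine ⟨(n : ℝ)⁻¹, by positivity, fun s => ?_⟩
  have h2 := hG.semigroup_comm (M := timeMul (cutoff T n) (contDiff_cutoff n) hc)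
    (fun _ _ hf => opGraph_timeMul_mem hA _ _ hf) (inner_mulOp_comm _ _) s u
  rw [h1] at h2
  rw [h2]
  filter_upwards [coeFn_mulOp ((contDiff_cutoff (T := T) n).continuous.comp continuous_fst)
      (fun p : SpaceTime d => hc p.1) (hG.semigroup s u)] with p h3 h4
  refine Eq.trans h3 ?_
  rw [Function.comp_apply, cutoff_eq_zero, zero_mul]
  refine h4.imp (fun h => ?_) (fun h => ?_)
  · have := mul_le_mul_of_nonneg_left h.le hn0'.le
    rwa [mul_inv_cancel₀ hn0'.ne'] at this
  · have := mul_le_mul_of_nonneg_left (by linarith : T - p.1 ≤ (n : ℝ)⁻¹) hn0'.le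
    rwa [mul_inv_cancel₀ hn0'.ne'] at this

end TimeSupport

section Commutator

variable {a dta : SpaceTime d → Matrix (Fin d) (Fin d) ℝ} {lam : ℝ}
  {J : ℝ → L2 d T →L[ℝ] L2 d T} {N : ℝ → L2 d T → L2Vec d T}

/-- The terms without translation, `⟪φ, P g⟫` and `⟪P φ, g⟫`, cancel by symmetry; what remains is
the commutator bound carried over from powers of resolvents. -/
theorem IsFormResolvent.abs_inner_semigroup_sub_le (ha : IsBoundedElliptic T lam a)
    (hlam : 0 < lam) (hd : IsBoundedTimeDeriv T a dta)
    (hJ : IsFormResolvent ha.isBoundedField J N) {r : ℝ} (hr : 0 ≤ r) (s : ℝ≥0) (φ g : L2 d T) :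
    |⟪φ, shift (-r) ((hJ.isResolventFamily ha hlam).semigroup s g) -
        (hJ.isResolventFamily ha hlam).semigroup s g⟫_ℝ -
      ⟪(hJ.isResolventFamily ha hlam).semigroup s φ, shift (-r) g - g⟫_ℝ| ≤
      r * (1 / (2 * lam) * (linfNorm T dta).toReal * ‖φ‖ * ‖g‖) := by
  have hG := hJ.isResolventFamily ha hlam
  have h := hG.abs_inner_sub_le (x := shift r φ) (y := g) (x' := shift (-r) g) (y' := φ)
    (K := r * (1 / (2 * lam) * (linfNorm T dta).toReal * ‖φ‖ * ‖g‖)) (fun τ hτ k => ?_) s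
  · rw [inner_sub_right, inner_sub_right, hG.inner_semigroup_comm (fun τ => hJ.inner_comm ha) s φ g,
      sub_sub_sub_cancel_right, ← inner_shift, real_inner_comm (shift (-r) g)]
    exact h
  · have := hJ.abs_commutator_pow_le ha hlam hd hτ hr φ g k
    rwa [inner_shift r ((J τ ^ k) φ), real_inner_comm (shift (-r) g)] at this

end Commutator

section Limits

theorem ae_indicator_comp_timeShift {f g : SpaceTime d → ℝ} (h : f =ᵐ[slabMeasure d T] g) (r : ℝ) :
    ∀ᵐ p ∂(slabMeasure d T), (slab d T).indicator f (timeShift r p) =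
      (slab d T).indicator g (timeShift r p) := by
  refine ae_restrict_of_ae (((timeShift_quasiMeasurePreserving r).ae
    (ae_volume_of_ae_slab h)).mono fun p hp => ?_)
  by_cases hps : timeShift r p ∈ slab d T
  · rw [indicator_of_mem hps, indicator_of_mem hps, hp hps]
  · rw [indicator_of_notMem hps, indicator_of_notMem hps]

/-- By adjointness the difference quotient falls on the test function, so `v` needs no regularity in
time. -/
theorem IsTestC.tendsto_inner_shift {φ : SpaceTime d → ℝ} (hφ : IsTestC T φ) (v : L2 d T) :
    Tendsto (fun r : ℝ => r⁻¹ * ⟪hφ.memLp.toLp φ, shift (-r) v - v⟫_ℝ) (𝓝[>] 0)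
      (𝓝 (∫ p, timeDeriv φ p * v p ∂(slabMeasure d T))) := by
  obtain ⟨φ1, φ2, -⟩ := hφ.indicator
  set ψ := (slab d T).indicator φ with hψ
  have hv : LocallyIntegrable ((slab d T).indicator v) volume :=
    ((memLp_indicator_iff_restrict (measurableSet_slab d T)).2 (Lp.memLp v)).locallyIntegrable
      (by norm_num)
  have e : ∀ r : ℝ, ⟪hφ.memLp.toLp φ, shift (-r) v⟫_ℝ =
      ∫ p, ψ (timeShift (- -r) p) * (slab d T).indicator v p := by
    intro r
    rw [← inner_shift, L2.inner_eq_integral, neg_neg]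
    have h0 : ∫ p, ψ (timeShift r p) * v p ∂(slabMeasure d T) =
        ∫ p, ψ (timeShift r p) * (slab d T).indicator v p :=
      integral_slab_eq (fun p hp => by simp [indicator_of_mem hp])
        (fun p hp => by simp [indicator_of_notMem hp])
    rw [← h0]
    refine integral_congr_ae ?_
    filter_upwards [coeFn_shift r (hφ.memLp.toLp φ),
      ae_indicator_comp_timeShift hφ.memLp.coeFn_toLp r] with p h1 h2
    rw [h1, h2]
  have e0 : ⟪hφ.memLp.toLp φ, v⟫_ℝ = ∫ p, ψ (timeShift (- -0) p) * (slab d T).indicator v p := by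
    rw [inner_toLp_eq_integral]
    refine integral_slab_eq (fun p hp => ?_) (fun p hp => by simp [indicator_of_notMem hp])
    simp [hψ, indicator_of_mem hp]
  have h1 := hasDerivAt_integral_timeShift φ1 φ2 hv (-0)
  have h2 := (h1.comp (0 : ℝ) (hasDerivAt_neg 0)).tendsto_slope_zero_right
  simp only [zero_add, Function.comp_apply, smul_eq_mul] at h2
  have e1 : ∫ p, timeDeriv φ p * v p ∂(slabMeasure d T) =
      (∫ p, -timeDeriv ψ (timeShift (- -0) p) * (slab d T).indicator v p) * -1 := by
    rw [mul_neg_one, ← integral_neg]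
    refine integral_slab_eq (fun p hp => ?_) (fun p hp => by simp [indicator_of_notMem hp])
    have := timeDeriv_congr (isOpen_slab d T) (eqOn_indicator φ) hp
    simp [indicator_of_mem hp, ← this, hψ]
  rw [e1]
  refine h2.congr fun r => ?_
  rw [inner_sub_right, e, e0]

/-- Here the quotient stays on `f`, whose time derivative is bounded but need not be square
integrable. Integrability of `w` gives the dominating function, and the margin keeps the segment
from `t - r` to `t` inside `(0, T)` wherever `w` is not zero. -/
theorem IsTest.tendsto_inner_shift {f : SpaceTime d → ℝ} (hf : IsTest T f)
    (hfm : MemLp f 2 (slabMeasure d T)) {w : L2 d T} {δ : ℝ} (hδ : 0 < δ)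
    (hw : HasTimeMargin δ w) (hwi : Integrable w (slabMeasure d T)) :
    Tendsto (fun r : ℝ => r⁻¹ * ⟪w, shift (-r) (hfm.toLp f) - hfm.toLp f⟫_ℝ) (𝓝[>] 0)
      (𝓝 (-∫ p, w p * timeDeriv f p ∂(slabMeasure d T))) := by
  obtain ⟨C, hC⟩ := hf.bounded
  have e : ∀ r : ℝ, r⁻¹ * ⟪w, shift (-r) (hfm.toLp f) - hfm.toLp f⟫_ℝ =
      ∫ p, w p * (r⁻¹ * ((slab d T).indicator f (timeShift (-r) p) - f p)) ∂(slabMeasure d T) := by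
    intro r
    rw [L2.inner_eq_integral, ← integral_const_mul]
    refine integral_congr_ae ?_
    filter_upwards [coeFn_shift (-r) (hfm.toLp f), Lp.coeFn_sub (shift (-r) (hfm.toLp f))
      (hfm.toLp f), hfm.coeFn_toLp, ae_indicator_comp_timeShift hfm.coeFn_toLp (-r)]
      with p h1 h2 h3 h4
    rw [h2, Pi.sub_apply, h1, h3, h4]
    ring
  simp only [e]
  rw [← integral_neg]
  have hind : AEStronglyMeasurable ((slab d T).indicator f) volume :=
    (aestronglyMeasurable_indicator_iff (measurableSet_slab d T)).2 hfm.1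
  refine tendsto_integral_filter_of_dominated_convergence (fun p => C * ‖w p‖) ?_ ?_
    (hwi.norm.const_mul C) ?_
  · refine Eventually.of_forall fun r => (Lp.memLp w).1.mul (AEStronglyMeasurable.const_mul
      (AEStronglyMeasurable.sub ?_ hfm.1) _)
    exact (hind.comp_quasiMeasurePreserving (timeShift_quasiMeasurePreserving (-r))).restrict
  · filter_upwards [Ioo_mem_nhdsGT hδ] with r hr
    filter_upwards [hw, ae_mem_slab] with p hp hps
    rw [norm_mul, mul_comm]
    by_cases h : p.1 < δ ∨ T - δ < p.1
    · rw [hp h]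
      simp
    · push Not at h
      refine mul_le_mul_of_nonneg_right ?_ (norm_nonneg _)
      have hpt : ∀ t ∈ Icc (p.1 - r) p.1, (t, p.2) ∈ slab d T := fun t ht =>
        ⟨⟨by linarith [ht.1, h.1, hr.2], ht.2.trans_lt hps.1.2⟩, trivial⟩
      have hmv := norm_image_sub_le_of_norm_deriv_le_segment' (f := fun t => f (t, p.2))
        (f' := fun t => timeDeriv f (t, p.2)) (a := p.1 - r) (b := p.1) (C := C)
        (fun t ht => (hf.diff_time _ (hpt t ht)).hasDerivAt.hasDerivWithinAt)
        (fun t ht => (hC _ (hpt t ⟨ht.1, ht.2.le⟩)).2.1) p.1 (right_mem_Icc.2 (by linarith [hr.1]))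
      have hsh : timeShift (-r) p = (p.1 - r, p.2) := rfl
      rw [hsh, indicator_of_mem (hpt _ (left_mem_Icc.2 (by linarith [hr.1]))), norm_mul, norm_inv,
        Real.norm_of_nonneg hr.1.le, inv_mul_le_iff₀ hr.1, norm_sub_rev]
      rw [sub_sub_cancel] at hmv
      linarith
  · filter_upwards [ae_mem_slab] with p hp
    rw [← mul_neg]
    refine Tendsto.const_mul _ ?_
    have h1 := (hf.diff_time p hp).hasDerivAt
    have h2 : HasDerivAt (fun r : ℝ => p.1 + -r) (-1) 0 := (hasDerivAt_neg 0).const_add p.1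
    have h3 : HasDerivAt (fun t => f (t, p.2)) (deriv (fun t => f (t, p.2)) p.1) (p.1 + -0) := by
      simpa using h1
    have h4 := (h3.comp (0 : ℝ) h2).tendsto_slope_zero_right
    simp only [zero_add, Function.comp_apply, smul_eq_mul, mul_neg_one, neg_zero, add_zero] at h4
    refine Tendsto.congr' ?_ h4
    have h5 : ∀ᶠ r : ℝ in 𝓝[>] 0, timeShift (-r) p ∈ slab d T := by
      refine (Tendsto.mono_left ?_ nhdsWithin_le_nhds).eventually ((isOpen_slab d T).mem_nhds hp)
      refine Continuous.tendsto' ?_ 0 p (by simp)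
      unfold timeShift
      fun_prop
    filter_upwards [h5] with r hr
    rw [indicator_of_mem hr]
    rfl

end Limits

section Main

variable {a dta : SpaceTime d → Matrix (Fin d) (Fin d) ℝ} {lam : ℝ}
  {J : ℝ → L2 d T →L[ℝ] L2 d T} {N : ℝ → L2 d T → L2Vec d T}

theorem IsFormResolvent.integrable_and_abs_integral_le (hd1 : 1 ≤ d)
    (ha : IsBoundedElliptic T lam a) (hlam : 0 < lam) (hd : IsBoundedTimeDeriv T a dta)
    (hJ : IsFormResolvent ha.isBoundedField J N) (s : ℝ≥0) {u f : SpaceTime d → ℝ}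
    (hu : IsTestC T u) (hf : IsTest T f) (hfm : MemLp f 2 (slabMeasure d T)) :
    Integrable (commIntegrand u f ((hJ.isResolventFamily ha hlam).semigroup s (hu.memLp.toLp u))
      ((hJ.isResolventFamily ha hlam).semigroup s (hfm.toLp f))) (slabMeasure d T) ∧
    |∫ p, commIntegrand u f ((hJ.isResolventFamily ha hlam).semigroup s (hu.memLp.toLp u))
      ((hJ.isResolventFamily ha hlam).semigroup s (hfm.toLp f)) p ∂(slabMeasure d T)| ≤
      1 / (2 * lam) * (linfNorm T dta).toReal * ‖hu.memLp.toLp u‖ * ‖hfm.toLp f‖ := by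
  have hG := hJ.isResolventFamily ha hlam
  obtain ⟨K, hK, hKs, h0⟩ := hu.compact_supp
  have huK : ∀ᵐ p ∂(slabMeasure d T), p ∉ K → hu.memLp.toLp u p = 0 := by
    filter_upwards [hu.memLp.coeFn_toLp, ae_mem_slab] with p h1 h2 h3
    rw [h1, h0 p h2 h3]
  have hPu : Integrable (hG.semigroup s (hu.memLp.toLp u)) (slabMeasure d T) :=
    hG.isSemigroupOf.integrable_apply hd1 ha hlam ha.isBoundedField hG.dense_domain hK huK s
  obtain ⟨δ, hδ, h1⟩ := hu.exists_hasTimeMargin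
  obtain ⟨δ', hδ', h2⟩ := h1.semigroup hG hδ
  obtain ⟨C, hC⟩ := hf.bounded
  have i1 : Integrable (fun p => hG.semigroup s (hu.memLp.toLp u) p * timeDeriv f p)
      (slabMeasure d T) :=
    hPu.mul_bdd (c := C) (hf.cont_time.aestronglyMeasurable (measurableSet_slab d T))
      (ae_of_forall_slab fun p hp => (hC p hp).2.1)
  have i2 : Integrable (fun p => timeDeriv u p * hG.semigroup s (hfm.toLp f) p)
      (slabMeasure d T) := integrable_mul_of_memLp hu.memLp_timeDeriv (Lp.memLp _)
  refine ⟨i1.add i2, ?_⟩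
  have t1 := hu.tendsto_inner_shift (hG.semigroup s (hfm.toLp f))
  have t2 := hf.tendsto_inner_shift hfm hδ' (h2 s) hPu
  -- The limits are `∫ ∂_t u P f` and `-∫ P u ∂_t f`, so their difference is the weak commutator;
  -- the bound, linear in `r`, survives division by `r`.
  have t3 := (t1.sub t2).abs
  have e : ∫ p, commIntegrand u f (hG.semigroup s (hu.memLp.toLp u))
      (hG.semigroup s (hfm.toLp f)) p ∂(slabMeasure d T) =
      (∫ p, timeDeriv u p * hG.semigroup s (hfm.toLp f) p ∂(slabMeasure d T)) -
        -∫ p, hG.semigroup s (hu.memLp.toLp u) p * timeDeriv f p ∂(slabMeasure d T) := by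
    rw [sub_neg_eq_add, add_comm]
    exact integral_add i1 i2
  rw [e]
  refine le_of_tendsto t3 ?_
  filter_upwards [self_mem_nhdsWithin] with r hr
  have hr0 : (0 : ℝ) < r := hr
  rw [← mul_sub, abs_mul, abs_inv, abs_of_pos hr0, inv_mul_le_iff₀ hr0]
  exact hJ.abs_inner_semigroup_sub_le ha hlam hd hr0.le s _ _

theorem memW12t_of_abs_inner_shift_le {v : L2 d T} {C : ℝ}
    (hv : ∀ (u : L2 d T) (δ : ℝ), 0 < δ → HasTimeMargin δ u →
      ∀ᶠ r in 𝓝[>] (0 : ℝ), |⟪u, shift (-r) v - v⟫_ℝ| ≤ r * (C * ‖u‖)) : MemW12t v := by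
  -- The graph of `u ↦ lim r⁻¹ ⟪u, shift (-r) v - v⟫`, over those `u` with a time margin for which
  -- the limit exists. Test functions belong to it, with value `∫ ∂_t φ v`; the weak derivative is
  -- therefore minus the Riesz representative.
  let S : Submodule ℝ (L2 d T × ℝ) :=
    { carrier := {x | (∃ δ > 0, HasTimeMargin δ x.1) ∧
        Tendsto (fun r : ℝ => r⁻¹ * ⟪x.1, shift (-r) v - v⟫_ℝ) (𝓝[>] 0) (𝓝 x.2)}
      add_mem' := by
        rintro x y ⟨⟨δ, hδ, h1⟩, h2⟩ ⟨⟨δ', hδ', h1'⟩, h2'⟩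
        refine ⟨⟨min δ δ', lt_min hδ hδ', ?_⟩, ?_⟩
        · filter_upwards [h1.mono (min_le_left δ δ'), h1'.mono (min_le_right δ δ'),
            Lp.coeFn_add x.1 y.1] with p p1 p2 p3 p4
          rw [Prod.fst_add, p3, Pi.add_apply, p1 p4, p2 p4, add_zero]
        · simpa only [Prod.fst_add, Prod.snd_add, inner_add_left, mul_add] using h2.add h2'
      zero_mem' := by
        refine ⟨⟨1, one_pos, ?_⟩, by simp⟩
        filter_upwards [Lp.coeFn_zero ℝ 2 (slabMeasure d T)] with p p1 _
        exact p1
      smul_mem' := by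
        rintro c x ⟨⟨δ, hδ, h1⟩, h2⟩
        refine ⟨⟨δ, hδ, ?_⟩, ?_⟩
        · filter_upwards [h1, Lp.coeFn_smul c x.1] with p p1 p2 p3
          rw [Prod.smul_fst, p2, Pi.smul_apply, p1 p3, smul_zero]
        · simpa only [Prod.smul_fst, Prod.smul_snd, real_inner_smul_left, smul_eq_mul,
            mul_left_comm c] using h2.const_mul c }
  obtain ⟨g, hg⟩ := exists_inner_eq_of_graph S (C := C) (by
    rintro x ⟨⟨δ, hδ, h1⟩, h2⟩
    refine le_of_tendsto h2.abs ?_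
    filter_upwards [hv _ δ hδ h1, self_mem_nhdsWithin] with r h3 hr
    have hr0 : (0 : ℝ) < r := hr
    rwa [abs_mul, abs_inv, abs_of_pos hr0, inv_mul_le_iff₀ hr0])
  refine ⟨-g, fun φ hφ => ?_⟩
  have h1 := hg (hφ.memLp.toLp φ, ∫ p, timeDeriv φ p * v p ∂(slabMeasure d T))
    ⟨hφ.exists_hasTimeMargin, hφ.tendsto_inner_shift v⟩
  simp only at h1
  rw [h1, ← inner_toLp_eq_integral hφ.memLp, inner_neg_right, neg_neg, real_inner_comm]

theorem IsFormResolvent.memW12t_semigroup (ha : IsBoundedElliptic T lam a) (hlam : 0 < lam)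
    (hd : IsBoundedTimeDeriv T a dta) (hJ : IsFormResolvent ha.isBoundedField J N) (s : ℝ≥0)
    {f : L2 d T} (hf : MemW12t f) : MemW12t ((hJ.isResolventFamily ha hlam).semigroup s f) := by
  have hG := hJ.isResolventFamily ha hlam
  obtain ⟨g, hg⟩ := hf
  refine memW12t_of_abs_inner_shift_le
    (C := 1 / (2 * lam) * (linfNorm T dta).toReal * ‖f‖ + ‖g‖) fun u δ hδ hu => ?_
  obtain ⟨δ', hδ', h1⟩ := hu.semigroup hG hδ
  filter_upwards [Ioo_mem_nhdsGT hδ'] with r hr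
  have h2 := hJ.abs_inner_semigroup_sub_le ha hlam hd hr.1.le s u f
  -- The commutator bound transfers the increment of `P f` tested with `u` to that of `f` tested
  -- with `P u`, which vanishes near the ends of the time interval.
  have h3 := hg.abs_inner_shift_sub_le hr.1.le ((h1 s).ae_eq_zero hr.1.le hr.2)
  have h4 := mul_le_mul_of_nonneg_left (hG.norm_semigroup_apply_le s u)
    (mul_nonneg hr.1.le (norm_nonneg g))
  have h5 := abs_sub_abs_le_abs_sub
    ⟪u, shift (-r) (hG.semigroup s f) - hG.semigroup s f⟫_ℝ
    ⟪hG.semigroup s u, shift (-r) f - f⟫_ℝ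
  linarith

end Main

end TimeCommutator
end

theorem lemma3p5 (lam : ℝ) (hlam : 0 < lam) :
    ∃ c : ℝ, ∀ (d : ℕ) (_ : 1 ≤ d) (T : ℝ) (_ : 0 < T)
      (a dta : SpaceTime d → Matrix (Fin d) (Fin d) ℝ),
      IsBoundedElliptic T lam a → IsBoundedTimeDeriv T a dta →
      -- the semigroup of the Dirichlet form exists and is unique
      (∃! P : ℝ≥0 → (L2 d T →L[ℝ] L2 d T), IsFormSemigroup a P) ∧
      ∀ P : ℝ≥0 → (L2 d T →L[ℝ] L2 d T), IsFormSemigroup a P →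
        -- the weak commutator is well defined and satisfies the bilinear estimate
        (∀ α : ℝ≥0, 0 < α → α < 1 →
          ∀ (u f : SpaceTime d → ℝ) (hu : IsTestC T u) (_ : IsTest T f)
            (hf : MemLp f 2 (slabMeasure d T)),
            Integrable (commIntegrand u f (P α (hu.memLp.toLp u)) (P α (hf.toLp f)))
              (slabMeasure d T) ∧
            |∫ p, commIntegrand u f (P α (hu.memLp.toLp u)) (P α (hf.toLp f)) p
                ∂(slabMeasure d T)| ≤
              c * (linfNorm T dta).toReal * ‖hu.memLp.toLp u‖ * ‖hf.toLp f‖) ∧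
        -- the semigroup preserves `W^{1,2}_t(L²_x)`
        (∀ (α : ℝ≥0) (f : L2 d T), MemW12t f → MemW12t (P α f)) := by
  refine ⟨1 / (2 * lam), fun d hd1 T _ a dta ha hd => ?_⟩
  obtain ⟨J, N, hJ⟩ := ha.exists_resolvent hlam
  have hG := hJ.isResolventFamily ha hlam
  have huniq : ∀ P : ℝ≥0 → (L2 d T →L[ℝ] L2 d T), IsFormSemigroup a P → P = hG.semigroup :=
    fun P hP => ((isFormSemigroup_iff ha.isBoundedField).1 hP).unique hG.isSemigroupOf
      hG.dense_domain hG.dissip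
  refine ⟨⟨hG.semigroup, (isFormSemigroup_iff ha.isBoundedField).2 hG.isSemigroupOf, huniq⟩,
    fun P hP => ?_⟩
  obtain rfl := huniq P hP
  exact ⟨fun α _ _ u f hu hf hfm => hJ.integrable_and_abs_integral_le hd1 ha hlam hd α hu hf hfm,
    fun α f hf => hJ.memW12t_semigroup ha hlam hd α hf⟩
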